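/- Propositional formulas in CNF are finite sets of clauses, and clauses are finite sets of literals; $\#(\varphi)$ is the number of assignments to the variables occurring in $\varphi$ that satisfy all clauses, and $|\varphi|=1+\sum_{c\in\varphi}(1+|c|)$ is the size of $\varphi$. The incidence graph $I_\varphi$ has the variables and the clauses of $\varphi$ as vertices, with a variable adjacent to the clauses in which it occurs (positively or negatively), and $\mathrm{itw}(\varphi)$ is the treewidth of $I_\varphi$ (read as $0$ for the empty formula, whose incidence graph has no vertices). There is an algorithm that computes $\#(\varphi)$ with $O\big(2^{\mathrm{itw}(\varphi)}\,|\varphi|\big)$ arithmetic operations. More precisely: (1) There are a constant $C$ and a single program for a unit-cost random access machine (index registers and arrays over $\mathbb N$ with addition, truncated subtraction, comparison and indirect addressing; number registers and arrays over $\mathbb Z$ on which only $+,-,\times$ are available) that, given any CNF $\varphi$ and any rooted tree decomposition of $I_\varphi$ of width $k$ with $N$ nodes (listed so that each node stands after its parent), outputs $\#(\varphi)$ after at most $C\cdot 2^{k}\cdot(|\varphi|+N)$ steps, where every arithmetic operation and every other instruction or test is one step. (2) There is a computable function that maps every CNF $\varphi$ to a tree decomposition of $I_\varphi$ of width $\mathrm{itw}(\varphi)$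 with at most $|\varphi|$ nodes (this preprocessing is not counted), and on $\varphi$ together with this decomposition the program of (1) outputs $\#(\varphi)$ after at most $C\cdot 2^{\mathrm{itw}(\varphi)}\cdot|\varphi|$ steps. -/

import Mathlib

namespace SharpSat

/-! ### Propositional formulas in conjunctive normal form -/

/-- A literal: `(x, true)` is the variable `x`, and `(x, false)` is its negation. -/
abbrev Literal : Type := ℕ × Bool

/-- A clause is a finite set of literals (possibly empty, possibly tautological). -/
abbrev Clause : Type := Finset Literal

/-- A CNF is a finite set of clauses. -/
abbrev CNF : Type := Finset Clause

/-- The variables that occur in `φ`. -/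
def vars (φ : CNF) : Finset ℕ := φ.biUnion fun c => c.image Prod.fst

/-- The assignment `β` (the set of the true variables) satisfies the clause `c`. -/
def SatisfiesClause (β : Finset ℕ) (c : Clause) : Prop :=
  ∃ x, ((x, true) ∈ c ∧ x ∈ β) ∨ ((x, false) ∈ c ∧ x ∉ β)

/-- `β` is a model of `φ`. -/
def IsModel (β : Finset ℕ) (φ : CNF) : Prop := ∀ c ∈ φ, SatisfiesClause β c

open Classical in
/-- `#(φ)`, the number of assignments `β ⊆ vars φ` that are models of `φ`. -/
noncomputable def modelCount (φ : CNF) : ℕ :=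
  ((vars φ).powerset.filter fun β => IsModel β φ).card

/-- `|φ|`: one symbol for the formula, one for each clause, one for each literal occurrence. -/
def formulaSize (φ : CNF) : ℕ := 1 + ∑ c ∈ φ, (1 + c.card)

/-! ### Tree decompositions and incidence treewidth -/

/-- A tree decomposition of the graph `G` with the node set `ι`. (`Connected` includes
non-emptiness.) -/
structure TreeDecomposition {V : Type} (G : SimpleGraph V) (ι : Type) where
  tree : SimpleGraph ι
  isTree : tree.IsTree
  bag : ι → Finset V
  connected : ∀ v : V, (tree.induce {i | v ∈ bag i}).Connected
  edge_mem : ∀ u v : V, G.Adj u v → ∃ i, u ∈ bag i ∧ v ∈ bag i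

/-- The width: the maximum size of the bags minus one (`0` if all the bags are empty). -/
def TreeDecomposition.width {V ι : Type} [Fintype ι] {G : SimpleGraph V}
    (D : TreeDecomposition G ι) : ℕ :=
  (Finset.univ.sup fun i => (D.bag i).card) - 1

/-- The treewidth of a finite graph: the minimum width of its tree decompositions. -/
noncomputable def treewidth {V : Type} (G : SimpleGraph V) : ℕ :=
  sInf {w | ∃ (N : ℕ) (D : TreeDecomposition G (Fin N)), D.width = w}

/-- The vertices of the incidence graph of `φ`: its variables and its clauses. -/
abbrev IncVertex (φ : CNF) : Type := {x : ℕ // x ∈ vars φ} ⊕ {c : Clause // c ∈ φ}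

/-- The variable `x` occurs, positively or negatively, in the clause `c`. -/
def Occurs (x : ℕ) (c : Clause) : Prop := (x, true) ∈ c ∨ (x, false) ∈ c

/-- The incidence graph of `φ`: a variable is adjacent to the clauses in which it occurs. -/
def incidenceGraph (φ : CNF) : SimpleGraph (IncVertex φ) where
  Adj
    | .inl x, .inr c => Occurs x.1 c.1
    | .inr c, .inl x => Occurs x.1 c.1
    | _, _ => False
  symm := ⟨by rintro (x | c) (y | d) h <;> exact h⟩
  loopless := ⟨by rintro (x | c) h <;> exact h⟩

/-- The incidence treewidth of `φ`. -/
noncomputable def itw (φ : CNF) : ℕ := treewidth (incidenceGraph φ)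

/-! ### Input format -/

/-- `L` lists the clauses of `φ`, and the literals of each clause, without repetitions
and in an arbitrary order. -/
def IsListing (L : List (List Literal)) (φ : CNF) : Prop :=
  (∀ c ∈ L, c.Nodup) ∧ (L.map List.toFinset).Nodup ∧ (L.map List.toFinset).toFinset = φ

/-- The name of a vertex of the incidence graph in the input: `inl x` for the variable `x`, and
`inr j` for the clause that stands at position `j` of the list `L`. -/
def vertexName (L : List (List Literal)) {φ : CNF} : IncVertex φ → ℕ ⊕ ℕ
  | .inl x => .inl x.1
  | .inr c => .inr ((L.map List.toFinset).idxOf c.1)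

/-- A rooted tree with bags, as input data: entry `i` consists of the number of the parent of
node `i` and of the list of the names of the vertices in its bag. Node `0` is the root; the
parent that is given for it has no meaning. -/
abbrev TreeCode : Type := List (ℕ × List (ℕ ⊕ ℕ))

/-- `T` is a listing of the tree decomposition `D`, rooted at node `0`, in which every node stands
after its parent and no bag has repetitions. -/
structure Describes (L : List (List Literal)) {φ : CNF} (T : TreeCode)
    (D : TreeDecomposition (incidenceGraph φ) (Fin T.length)) : Prop where
  parent_lt : ∀ i : Fin T.length, 0 < i.val → (T.get i).1 < i.val
  adj_iff : ∀ i j : Fin T.length, D.tree.Adj i j ↔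
    (0 < i.val ∧ (T.get i).1 = j.val) ∨ (0 < j.val ∧ (T.get j).1 = i.val)
  bag_nodup : ∀ i : Fin T.length, (T.get i).2.Nodup
  bag_eq : ∀ i : Fin T.length, (T.get i).2.toFinset = (D.bag i).image (vertexName L)

/-- The formula as a word of natural numbers: the number of clauses, and then for each clause
its length and, for each of its literals, the variable and the sign. -/
def encodeFormula (L : List (List Literal)) : List ℕ :=
  L.length :: L.flatMap fun c => c.length :: c.flatMap fun l => [l.1, l.2.toNat]

/-- The tree as a word of natural numbers: the number of nodes, and then for each node its parent,
the size of its bag and, for each vertex in the bag, its kind (`0` for variables, `1` for clauses)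
and its number. -/
def encodeTree (T : TreeCode) : List ℕ :=
  T.length :: T.flatMap fun p => p.1 :: p.2.length ::
    p.2.flatMap fun v => Sum.elim (fun x => [0, x]) (fun j => [1, j]) v

/-! ### The machine model

A random access machine with unit costs, programmed in a structured language. It has index
registers and arrays of natural numbers, for control and addressing, which can be added,
subtracted (with truncation at `0`) and compared; and number registers and arrays of
integers, on which the only operations are the arithmetic operations `+`, `-`, `*`. Integers
cannot be tested or converted into indices. -/

/-- A memory state. -/
structure RamState where
  /-- index registers -/
  reg : ℕ → ℕ
  /-- index arrays -/
  arr : ℕ → ℕ → ℕ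
  /-- number registers -/
  num : ℕ → ℤ
  /-- number arrays -/
  numArr : ℕ → ℕ → ℤ

/-- The programs. All the parameters of instructions (names of registers and arrays, constants)
are fixed parts of the program. -/
inductive RamProg : Type
  /-- no operation -/
  | skip
  /-- `reg r := n` -/
  | const (r n : ℕ)
  /-- `reg r := reg s` -/
  | copy (r s : ℕ)
  /-- `reg r := reg s + reg t` -/
  | add (r s t : ℕ)
  /-- `reg r := reg s - reg t`, truncated -/
  | sub (r s t : ℕ)
  /-- `reg r := arr a (reg s)` -/
  | load (r a s : ℕ)
  /-- `arr a (reg s) := reg r` -/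
  | store (a s r : ℕ)
  /-- `num x := z` -/
  | numConst (x : ℕ) (z : ℤ)
  /-- `num x := num y + num z` -/
  | numAdd (x y z : ℕ)
  /-- `num x := num y - num z` -/
  | numSub (x y z : ℕ)
  /-- `num x := num y * num z` -/
  | numMul (x y z : ℕ)
  /-- `num x := numArr a (reg s)` -/
  | numLoad (x a s : ℕ)
  /-- `numArr a (reg s) := num x` -/
  | numStore (a s x : ℕ)
  /-- first `p`, then `q` -/
  | seq (p q : RamProg)
  /-- if `reg r < reg s` then `p` else `q` -/
  | ite (r s : ℕ) (p q : RamProg)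
  /-- while `reg r < reg s` do `p` -/
  | while (r s : ℕ) (p : RamProg)

namespace RamState

def setReg (σ : RamState) (r n : ℕ) : RamState :=
  { σ with reg := Function.update σ.reg r n }

def setArr (σ : RamState) (a i n : ℕ) : RamState :=
  { σ with arr := Function.update σ.arr a (Function.update (σ.arr a) i n) }

def setNum (σ : RamState) (x : ℕ) (z : ℤ) : RamState :=
  { σ with num := Function.update σ.num x z }

def setNumArr (σ : RamState) (a i : ℕ) (z : ℤ) : RamState :=
  { σ with numArr := Function.update σ.numArr a (Function.update (σ.numArr a) i z) }

/-- The initial state: the input word stands in the index array `0`, all else is `0`. -/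
def init (w : List ℕ) : RamState where
  reg := fun _ => 0
  arr := fun a i => if a = 0 then w.getD i 0 else 0
  num := fun _ => 0
  numArr := fun _ _ => 0

end RamState

/-- `Exec p σ t τ`: started in `σ`, the program `p` halts in `τ` after exactly `t` steps. Every
instruction, in particular every arithmetic operation, and every evaluation of a test is
one step. -/
inductive Exec : RamProg → RamState → ℕ → RamState → Prop
  | skip (σ : RamState) : Exec .skip σ 1 σ
  | const (σ : RamState) (r n : ℕ) : Exec (.const r n) σ 1 (σ.setReg r n)
  | copy (σ : RamState) (r s : ℕ) : Exec (.copy r s) σ 1 (σ.setReg r (σ.reg s))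
  | add (σ : RamState) (r s t : ℕ) :
      Exec (.add r s t) σ 1 (σ.setReg r (σ.reg s + σ.reg t))
  | sub (σ : RamState) (r s t : ℕ) :
      Exec (.sub r s t) σ 1 (σ.setReg r (σ.reg s - σ.reg t))
  | load (σ : RamState) (r a s : ℕ) :
      Exec (.load r a s) σ 1 (σ.setReg r (σ.arr a (σ.reg s)))
  | store (σ : RamState) (a s r : ℕ) :
      Exec (.store a s r) σ 1 (σ.setArr a (σ.reg s) (σ.reg r))
  | numConst (σ : RamState) (x : ℕ) (z : ℤ) : Exec (.numConst x z) σ 1 (σ.setNum x z)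
  | numAdd (σ : RamState) (x y z : ℕ) :
      Exec (.numAdd x y z) σ 1 (σ.setNum x (σ.num y + σ.num z))
  | numSub (σ : RamState) (x y z : ℕ) :
      Exec (.numSub x y z) σ 1 (σ.setNum x (σ.num y - σ.num z))
  | numMul (σ : RamState) (x y z : ℕ) :
      Exec (.numMul x y z) σ 1 (σ.setNum x (σ.num y * σ.num z))
  | numLoad (σ : RamState) (x a s : ℕ) :
      Exec (.numLoad x a s) σ 1 (σ.setNum x (σ.numArr a (σ.reg s)))
  | numStore (σ : RamState) (a s x : ℕ) :
      Exec (.numStore a s x) σ 1 (σ.setNumArr a (σ.reg s) (σ.num x))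
  | seq {p q : RamProg} {σ τ υ : RamState} {t u : ℕ} :
      Exec p σ t τ → Exec q τ u υ → Exec (.seq p q) σ (t + u) υ
  | iteTrue {r s : ℕ} {p q : RamProg} {σ τ : RamState} {t : ℕ} :
      σ.reg r < σ.reg s → Exec p σ t τ → Exec (.ite r s p q) σ (t + 1) τ
  | iteFalse {r s : ℕ} {p q : RamProg} {σ τ : RamState} {t : ℕ} :
      ¬ σ.reg r < σ.reg s → Exec q σ t τ → Exec (.ite r s p q) σ (t + 1) τ
  | whileTrue {r s : ℕ} {p : RamProg} {σ τ υ : RamState} {t u : ℕ} :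
      σ.reg r < σ.reg s → Exec p σ t τ → Exec (.while r s p) τ u υ →
      Exec (.while r s p) σ (t + u + 1) υ
  | whileFalse {r s : ℕ} {p : RamProg} {σ : RamState} :
      ¬ σ.reg r < σ.reg s → Exec (.while r s p) σ 1 σ

/-- On the input word `w`, the program `p` halts after at most `B` steps, with the integer `z` in
its output register, the number register `0`. -/
def ComputesWithin (p : RamProg) (w : List ℕ) (z : ℤ) (B : ℕ) : Prop :=
  ∃ (t : ℕ) (τ : RamState), Exec p (RamState.init w) t τ ∧ t ≤ B ∧ τ.num 0 = z

end SharpSat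

open SharpSat

namespace SharpSat

/-! ### Reasoning about programs -/

/-- Started in `σ`, the program `p` halts after `t` steps in a state `τ` such that `Q t τ`. -/
def Runs (p : RamProg) (σ : RamState) (Q : ℕ → RamState → Prop) : Prop :=
  ∃ t τ, Exec p σ t τ ∧ Q t τ

namespace RamProg

def writesReg : RamProg → ℕ → Bool
  | .const r _, s => r == s
  | .copy r _, s => r == s
  | .add r _ _, s => r == s
  | .sub r _ _, s => r == s
  | .load r _ _, s => r == s
  | .seq p q, s => p.writesReg s || q.writesReg s
  | .ite _ _ p q, s => p.writesReg s || q.writesReg s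
  | .while _ _ p, s => p.writesReg s
  | _, _ => false

def writesArr : RamProg → ℕ → Bool
  | .store a _ _, s => a == s
  | .seq p q, s => p.writesArr s || q.writesArr s
  | .ite _ _ p q, s => p.writesArr s || q.writesArr s
  | .while _ _ p, s => p.writesArr s
  | _, _ => false

def writesNum : RamProg → ℕ → Bool
  | .numConst x _, s => x == s
  | .numAdd x _ _, s => x == s
  | .numSub x _ _, s => x == s
  | .numMul x _ _, s => x == s
  | .numLoad x _ _, s => x == s
  | .seq p q, s => p.writesNum s || q.writesNum s
  | .ite _ _ p q, s => p.writesNum s || q.writesNum s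
  | .while _ _ p, s => p.writesNum s
  | _, _ => false

def writesNumArr : RamProg → ℕ → Bool
  | .numStore a _ _, s => a == s
  | .seq p q, s => p.writesNumArr s || q.writesNumArr s
  | .ite _ _ p q, s => p.writesNumArr s || q.writesNumArr s
  | .while _ _ p, s => p.writesNumArr s
  | _, _ => false

/-- Execute `body` for the values `0, 1, …` of register `r` below the value of register `s`.
Register `1` has to hold the number `1`. -/
def forLoop (r s : ℕ) (body : RamProg) : RamProg :=
  .seq (.const r 0) (.while r s (.seq body (.add r r 1)))

end RamProg

open RamProg

/-- `τ` agrees with `σ` on everything that `p` does not write to. -/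
structure Frame (p : RamProg) (σ τ : RamState) : Prop where
  reg : ∀ r, p.writesReg r = false → τ.reg r = σ.reg r
  arr : ∀ a, p.writesArr a = false → τ.arr a = σ.arr a
  num : ∀ x, p.writesNum x = false → τ.num x = σ.num x
  numArr : ∀ a, p.writesNumArr a = false → τ.numArr a = σ.numArr a

namespace Frame

theorem refl (p : RamProg) (σ : RamState) : Frame p σ σ :=
  ⟨fun _ _ => rfl, fun _ _ => rfl, fun _ _ => rfl, fun _ _ => rfl⟩

theorem trans {p : RamProg} {σ τ υ : RamState} (h : Frame p σ τ) (h' : Frame p τ υ) :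
    Frame p σ υ :=
  ⟨fun r hr => (h'.reg r hr).trans (h.reg r hr), fun r hr => (h'.arr r hr).trans (h.arr r hr),
    fun r hr => (h'.num r hr).trans (h.num r hr),
    fun r hr => (h'.numArr r hr).trans (h.numArr r hr)⟩

theorem mono {p q : RamProg} {σ τ : RamState} (h : Frame p σ τ)
    (h1 : ∀ r, q.writesReg r = false → p.writesReg r = false)
    (h2 : ∀ r, q.writesArr r = false → p.writesArr r = false)
    (h3 : ∀ r, q.writesNum r = false → p.writesNum r = false)
    (h4 : ∀ r, q.writesNumArr r = false → p.writesNumArr r = false) : Frame q σ τ :=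
  ⟨fun r hr => h.reg r (h1 r hr), fun r hr => h.arr r (h2 r hr),
    fun r hr => h.num r (h3 r hr), fun r hr => h.numArr r (h4 r hr)⟩

theorem seq_left {p : RamProg} (q : RamProg) {σ τ : RamState} (h : Frame p σ τ) :
    Frame (.seq p q) σ τ := by
  apply h.mono <;> intro r hr <;>
    simp_all [writesReg, writesArr, writesNum, writesNumArr]

theorem seq_right (p : RamProg) {q : RamProg} {σ τ : RamState} (h : Frame q σ τ) :
    Frame (.seq p q) σ τ := by
  apply h.mono <;> intro r hr <;>
    simp_all [writesReg, writesArr, writesNum, writesNumArr]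

end Frame

theorem Exec.frame {p : RamProg} {σ τ : RamState} {t : ℕ} (h : Exec p σ t τ) :
    Frame p σ τ := by
  induction h with
  | skip σ => exact Frame.refl _ _
  | const | copy | add | sub | load | store | numConst | numAdd | numSub | numMul | numLoad
  | numStore =>
    constructor <;> intro r hr <;> first
      | rfl
      | exact Function.update_of_ne (fun e => by
          simp [writesReg, writesArr, writesNum, writesNumArr, e] at hr) _ _
  | seq _ _ h1 h2 => exact (h1.seq_left _).trans (h2.seq_right _)
  | iteTrue _ _ h | iteFalse _ _ h =>
    apply h.mono <;> intro r hr <;> simp_all [writesReg, writesArr, writesNum, writesNumArr]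
  | whileTrue _ _ _ h1 h2 =>
    refine Frame.trans (Frame.mono h1 ?_ ?_ ?_ ?_) h2 <;> exact fun _ h => h
  | whileFalse _ => exact Frame.refl _ _

namespace Runs

theorem mono {p : RamProg} {σ : RamState} {Q Q' : ℕ → RamState → Prop} (h : Runs p σ Q)
    (hQ : ∀ t τ, Q t τ → Frame p σ τ → Q' t τ) : Runs p σ Q' :=
  let ⟨t, τ, h1, h2⟩ := h
  ⟨t, τ, h1, hQ t τ h2 h1.frame⟩

theorem skip {σ : RamState} {Q : ℕ → RamState → Prop} : Runs .skip σ Q ↔ Q 1 σ :=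
  ⟨fun ⟨_, _, h, hQ⟩ => by cases h; exact hQ, fun h => ⟨_, _, .skip _, h⟩⟩

theorem const {σ : RamState} {Q : ℕ → RamState → Prop} {r n : ℕ} :
    Runs (.const r n) σ Q ↔ Q 1 (σ.setReg r n) :=
  ⟨fun ⟨_, _, h, hQ⟩ => by cases h; exact hQ, fun h => ⟨_, _, .const _ _ _, h⟩⟩

theorem copy {σ : RamState} {Q : ℕ → RamState → Prop} {r s : ℕ} :
    Runs (.copy r s) σ Q ↔ Q 1 (σ.setReg r (σ.reg s)) :=
  ⟨fun ⟨_, _, h, hQ⟩ => by cases h; exact hQ, fun h => ⟨_, _, .copy _ _ _, h⟩⟩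

theorem add {σ : RamState} {Q : ℕ → RamState → Prop} {r s t : ℕ} :
    Runs (.add r s t) σ Q ↔ Q 1 (σ.setReg r (σ.reg s + σ.reg t)) :=
  ⟨fun ⟨_, _, h, hQ⟩ => by cases h; exact hQ, fun h => ⟨_, _, .add _ _ _ _, h⟩⟩

theorem sub {σ : RamState} {Q : ℕ → RamState → Prop} {r s t : ℕ} :
    Runs (.sub r s t) σ Q ↔ Q 1 (σ.setReg r (σ.reg s - σ.reg t)) :=
  ⟨fun ⟨_, _, h, hQ⟩ => by cases h; exact hQ, fun h => ⟨_, _, .sub _ _ _ _, h⟩⟩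

theorem load {σ : RamState} {Q : ℕ → RamState → Prop} {r a s : ℕ} :
    Runs (.load r a s) σ Q ↔ Q 1 (σ.setReg r (σ.arr a (σ.reg s))) :=
  ⟨fun ⟨_, _, h, hQ⟩ => by cases h; exact hQ, fun h => ⟨_, _, .load _ _ _ _, h⟩⟩

theorem store {σ : RamState} {Q : ℕ → RamState → Prop} {r a s : ℕ} :
    Runs (.store a s r) σ Q ↔ Q 1 (σ.setArr a (σ.reg s) (σ.reg r)) :=
  ⟨fun ⟨_, _, h, hQ⟩ => by cases h; exact hQ, fun h => ⟨_, _, .store _ _ _ _, h⟩⟩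

theorem numConst {σ : RamState} {Q : ℕ → RamState → Prop} {x : ℕ} {z : ℤ} :
    Runs (.numConst x z) σ Q ↔ Q 1 (σ.setNum x z) :=
  ⟨fun ⟨_, _, h, hQ⟩ => by cases h; exact hQ, fun h => ⟨_, _, .numConst _ _ _, h⟩⟩

theorem numAdd {σ : RamState} {Q : ℕ → RamState → Prop} {x y z : ℕ} :
    Runs (.numAdd x y z) σ Q ↔ Q 1 (σ.setNum x (σ.num y + σ.num z)) :=
  ⟨fun ⟨_, _, h, hQ⟩ => by cases h; exact hQ, fun h => ⟨_, _, .numAdd _ _ _ _, h⟩⟩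

theorem numSub {σ : RamState} {Q : ℕ → RamState → Prop} {x y z : ℕ} :
    Runs (.numSub x y z) σ Q ↔ Q 1 (σ.setNum x (σ.num y - σ.num z)) :=
  ⟨fun ⟨_, _, h, hQ⟩ => by cases h; exact hQ, fun h => ⟨_, _, .numSub _ _ _ _, h⟩⟩

theorem numMul {σ : RamState} {Q : ℕ → RamState → Prop} {x y z : ℕ} :
    Runs (.numMul x y z) σ Q ↔ Q 1 (σ.setNum x (σ.num y * σ.num z)) :=
  ⟨fun ⟨_, _, h, hQ⟩ => by cases h; exact hQ, fun h => ⟨_, _, .numMul _ _ _ _, h⟩⟩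

theorem numLoad {σ : RamState} {Q : ℕ → RamState → Prop} {x a s : ℕ} :
    Runs (.numLoad x a s) σ Q ↔ Q 1 (σ.setNum x (σ.numArr a (σ.reg s))) :=
  ⟨fun ⟨_, _, h, hQ⟩ => by cases h; exact hQ, fun h => ⟨_, _, .numLoad _ _ _ _, h⟩⟩

theorem numStore {σ : RamState} {Q : ℕ → RamState → Prop} {x a s : ℕ} :
    Runs (.numStore a s x) σ Q ↔ Q 1 (σ.setNumArr a (σ.reg s) (σ.num x)) :=
  ⟨fun ⟨_, _, h, hQ⟩ => by cases h; exact hQ, fun h => ⟨_, _, .numStore _ _ _ _, h⟩⟩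

theorem seq {p q : RamProg} {σ : RamState} {Q : ℕ → RamState → Prop} :
    Runs (.seq p q) σ Q ↔ Runs p σ fun t τ => Runs q τ fun u υ => Q (t + u) υ :=
  ⟨fun ⟨_, _, h, hQ⟩ => by cases h with | seq h1 h2 => exact ⟨_, _, h1, _, _, h2, hQ⟩,
    fun ⟨_, _, h1, _, _, h2, hQ⟩ => ⟨_, _, .seq h1 h2, hQ⟩⟩

theorem ite {p q : RamProg} {σ : RamState} {Q : ℕ → RamState → Prop} {r s : ℕ} :
    Runs (.ite r s p q) σ Q ↔
      (σ.reg r < σ.reg s → Runs p σ fun t τ => Q (t + 1) τ) ∧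
      (¬ σ.reg r < σ.reg s → Runs q σ fun t τ => Q (t + 1) τ) := by
  constructor
  · rintro ⟨_, _, h, hQ⟩
    cases h with
    | iteTrue h1 h2 => exact ⟨fun _ => ⟨_, _, h2, hQ⟩, fun h => absurd h1 h⟩
    | iteFalse h1 h2 => exact ⟨fun h => absurd h h1, fun _ => ⟨_, _, h2, hQ⟩⟩
  · rintro ⟨h1, h2⟩
    by_cases h : σ.reg r < σ.reg s
    · obtain ⟨t, τ, h3, h4⟩ := h1 h
      exact ⟨_, _, .iteTrue h h3, h4⟩
    · obtain ⟨t, τ, h3, h4⟩ := h2 h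
      exact ⟨_, _, .iteFalse h h3, h4⟩

/-- The rule for loops: `I` is an invariant, and `B n` bounds the cost of the round `n`. -/
theorem forLoop {r s : ℕ} {body : RamProg} {σ : RamState} (I : ℕ → RamState → Prop) (B : ℕ → ℕ)
    (h1 : σ.reg 1 = 1) (hr : r ≠ 1) (hrs : r ≠ s)
    (hw : body.writesReg r = false ∧ body.writesReg s = false ∧ body.writesReg 1 = false)
    (h0 : I 0 (σ.setReg r 0))
    (hstep : ∀ n τ, n < σ.reg s → I n τ → Frame (RamProg.forLoop r s body) σ τ → τ.reg r = n →
      Runs body τ fun t υ => t ≤ B n ∧ I (n + 1) (υ.setReg r (n + 1))) :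
    Runs (RamProg.forLoop r s body) σ fun t τ =>
      t ≤ 2 + ∑ n ∈ Finset.range (σ.reg s), (B n + 2) ∧ I (σ.reg s) τ := by
  have hs1 : (RamProg.forLoop r s body).writesReg s = false := by
    simp [RamProg.forLoop, writesReg, hw, hrs]
  have h11 : (RamProg.forLoop r s body).writesReg 1 = false := by
    simp [RamProg.forLoop, writesReg, hw, hr]
  have key : ∀ d n τ, n + d = σ.reg s → I n τ → Frame (RamProg.forLoop r s body) σ τ →
      τ.reg r = n → Runs (.while r s (.seq body (.add r r 1))) τ fun t υ =>
        t ≤ 1 + ∑ j ∈ Finset.range d, (B (n + j) + 2) ∧ I (σ.reg s) υ := by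
    intro d
    induction d with
    | zero =>
      intro n τ hn hI hF hτ
      refine ⟨1, τ, .whileFalse ?_, by simp, ?_⟩
      · rw [hτ, hF.reg s hs1]; omega
      · rw [← hn]; exact hI
    | succ d ih =>
      intro n τ hn hI hF hτ
      obtain ⟨t, υ, e1, hB, hI'⟩ := hstep n τ (by omega) hI hF hτ
      have hυr : υ.reg r = n := by rw [e1.frame.reg r hw.1, hτ]
      have hυ1 : υ.reg 1 = 1 := by rw [e1.frame.reg 1 hw.2.2, hF.reg 1 h11, h1]
      have e2 : Exec (.add r r 1) υ 1 (υ.setReg r (n + 1)) := by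
        have := Exec.add υ r r 1
        rwa [hυr, hυ1] at this
      have hF' : Frame (RamProg.forLoop r s body) σ (υ.setReg r (n + 1)) := by
        refine hF.trans ((Exec.seq e1 e2).frame.mono ?_ ?_ ?_ ?_) <;> intro x hx <;>
          simp_all [RamProg.forLoop, writesReg, writesArr, writesNum, writesNumArr]
      obtain ⟨u, χ, e3, hu, hχ⟩ := ih (n + 1) _ (by omega) hI' hF' (by simp [RamState.setReg])
      refine ⟨_, _, .whileTrue (by rw [hτ, hF.reg s hs1]; omega) (.seq e1 e2) e3, ?_, hχ⟩
      rw [Finset.sum_range_succ']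
      have : ∀ j, n + 1 + j = n + (j + 1) := by intro j; omega
      simp only [this] at hu
      simp only [add_zero]
      omega
  rw [RamProg.forLoop, seq, const]
  refine (key (σ.reg s) 0 _ (by simp) h0 ?_ (by simp [RamState.setReg])).mono ?_
  · exact (Exec.const σ r 0).frame.seq_left _
  · intro t τ h _
    simp only [zero_add] at h
    exact ⟨by omega, h.2⟩

/-- The rule for loops whose rounds have the same bound. -/
theorem forLoop_const {r s : ℕ} {body : RamProg} {σ : RamState} (I : ℕ → RamState → Prop) (B : ℕ)
    (h1 : σ.reg 1 = 1) (hr : r ≠ 1) (hrs : r ≠ s)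
    (hw : body.writesReg r = false ∧ body.writesReg s = false ∧ body.writesReg 1 = false)
    (h0 : I 0 (σ.setReg r 0))
    (hstep : ∀ n τ, n < σ.reg s → I n τ → Frame (RamProg.forLoop r s body) σ τ → τ.reg r = n →
      Runs body τ fun t υ => t ≤ B ∧ I (n + 1) (υ.setReg r (n + 1))) :
    Runs (RamProg.forLoop r s body) σ fun t τ =>
      t ≤ 2 + σ.reg s * (B + 2) ∧ I (σ.reg s) τ := by
  refine (forLoop I (fun _ => B) h1 hr hrs hw h0 hstep).mono fun t τ h _ => ?_
  simpa using h

end Runs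

namespace RamState

theorem reg_setReg (σ : RamState) (r n s : ℕ) :
    (σ.setReg r n).reg s = if s = r then n else σ.reg s := by
  simp [setReg, Function.update_apply]

@[simp] theorem arr_setReg (σ : RamState) (r n : ℕ) : (σ.setReg r n).arr = σ.arr := rfl
@[simp] theorem num_setReg (σ : RamState) (r n : ℕ) : (σ.setReg r n).num = σ.num := rfl
@[simp] theorem numArr_setReg (σ : RamState) (r n : ℕ) : (σ.setReg r n).numArr = σ.numArr := rfl
@[simp] theorem reg_setArr (σ : RamState) (a i n : ℕ) : (σ.setArr a i n).reg = σ.reg := rfl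

theorem arr_setArr (σ : RamState) (a i n b : ℕ) :
    (σ.setArr a i n).arr b = if b = a then Function.update (σ.arr a) i n else σ.arr b := by
  simp only [setArr, Function.update_apply]

@[simp] theorem num_setArr (σ : RamState) (a i n : ℕ) : (σ.setArr a i n).num = σ.num := rfl
@[simp] theorem numArr_setArr (σ : RamState) (a i n : ℕ) :
    (σ.setArr a i n).numArr = σ.numArr := rfl
@[simp] theorem reg_setNum (σ : RamState) (x : ℕ) (z : ℤ) : (σ.setNum x z).reg = σ.reg := rfl
@[simp] theorem arr_setNum (σ : RamState) (x : ℕ) (z : ℤ) : (σ.setNum x z).arr = σ.arr := rfl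

theorem num_setNum (σ : RamState) (x : ℕ) (z : ℤ) (y : ℕ) :
    (σ.setNum x z).num y = if y = x then z else σ.num y := by
  simp [setNum, Function.update_apply]

@[simp] theorem numArr_setNum (σ : RamState) (x : ℕ) (z : ℤ) :
    (σ.setNum x z).numArr = σ.numArr := rfl
@[simp] theorem reg_setNumArr (σ : RamState) (a i : ℕ) (z : ℤ) :
    (σ.setNumArr a i z).reg = σ.reg := rfl
@[simp] theorem arr_setNumArr (σ : RamState) (a i : ℕ) (z : ℤ) :
    (σ.setNumArr a i z).arr = σ.arr := rfl
@[simp] theorem num_setNumArr (σ : RamState) (a i : ℕ) (z : ℤ) :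
    (σ.setNumArr a i z).num = σ.num := rfl

theorem numArr_setNumArr (σ : RamState) (a i : ℕ) (z : ℤ) (b : ℕ) :
    (σ.setNumArr a i z).numArr b =
      if b = a then Function.update (σ.numArr a) i z else σ.numArr b := by
  simp only [setNumArr, Function.update_apply]

end RamState
end SharpSat
namespace SharpSat

/-! ### The program -/

namespace RamProg

/-- Sequential composition of a list of programs. -/
def block : List RamProg → RamProg
  | [] => .skip
  | p :: l => .seq p (block l)

/-- Skips the formula. Afterwards register `1` holds `1`, register `2` the number of clauses, and
register `6` the position of the tree. -/
def skipFormula : RamProg := block [.const 1 1, .load 2 0 0, .const 6 1,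
  forLoop 10 2 (block [.load 7 0 6, .add 6 6 7, .add 6 6 7, .add 6 6 1])]

/-- Puts the number of nodes into register `3`, the maximum size of the bags into register `4`,
and the positions of the nodes into array `1`. -/
def readTree : RamProg := block [.load 3 0 6, .add 6 6 1, .const 4 0,
  forLoop 10 3 (block [.store 1 10 6, .add 6 6 1, .load 7 0 6, .ite 4 7 (.copy 4 7) .skip,
    .add 6 6 1, .add 6 6 7, .add 6 6 7])]

/-- Puts `2 ^ s` into entry `s` of array `2`, and the size of the tables into register `5`. -/
def powers : RamProg := block [.const 5 1, forLoop 10 4 (block [.store 2 10 5, .add 5 5 5])]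

/-- Puts the bits of all table indices into array `4`; the bits number `s` start at the position
given by array `3`. -/
def bits : RamProg := block [.const 6 0,
  forLoop 10 4 (block [.store 3 10 6, .load 7 2 10,
    forLoop 11 5 (block [
      .ite 11 7 (.const 8 0) (block [.sub 9 11 7, .add 9 9 6, .load 9 4 9, .sub 8 1 9]),
      .add 9 6 11, .store 4 9 8]),
    .add 6 6 5])]

/-- Fills the tables of all nodes with `1`. Array `5` holds the positions of the tables. -/
def tables : RamProg := block [.const 6 0, .numConst 1 1,
  forLoop 10 3 (block [.store 5 10 6, forLoop 11 5 (block [.numStore 0 6 1, .add 6 6 1])])]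

/-- Reads the vertex at the position in register `13`. -/
def readVertex : RamProg := block [.load 15 0 13, .add 13 13 1, .load 16 0 13, .add 13 13 1,
  .add 16 16 16, .add 16 16 15]

/-- Marks the slots of those vertices of a bag which occurred before. -/
def markSlots : RamProg := forLoop 11 14 (block [readVertex, .load 18 6 16,
  .ite 0 18 (block [.load 19 7 16, .store 8 19 17]) .skip])

/-- Puts an unmarked slot into register `22`. -/
def freeSlot : RamProg := forLoop 20 4 (block [.load 21 8 20, .ite 21 17 (.copy 22 20) .skip])

/-- Gives slots to the new vertices of a bag. -/
def assignSlots : RamProg := forLoop 11 14 (block [readVertex, .load 18 6 16,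
  .ite 0 18 .skip (block [freeSlot, .store 6 16 17, .store 7 16 22, .store 8 22 17])])

/-- Puts into array `6`, for each vertex, the number of the first bag in which it occurs, plus
one, and into array `7` its slot. -/
def slots : RamProg := forLoop 10 3 (block [.load 12 1 10, .add 13 12 1, .load 14 0 13,
  .add 13 13 1, .add 17 10 1, markSlots, .add 13 12 1, .add 13 13 1, assignSlots])

/-- Clears the entries of a table in which the clause is chosen and the literal is true. -/
def clearEntries : RamProg := forLoop 20 5 (block [.add 21 26 20, .load 21 4 21, .add 22 19 20,
  .load 22 4 22, .sub 23 22 15, .sub 22 15 22, .add 22 22 23,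
  .ite 22 21 (block [.add 23 27 20, .numStore 0 23 2]) .skip])

/-- Processes the literals of a clause. -/
def clauseLiterals : RamProg := forLoop 11 14 (block [.load 16 0 6, .add 6 6 1, .load 15 0 6,
  .add 6 6 1, .add 16 16 16, .load 18 6 16, .load 19 7 16, .load 19 3 19,
  .ite 18 25 (.copy 18 25) .skip, .sub 18 18 1, .load 27 5 18, clearEntries])

/-- Processes all literals. -/
def literals : RamProg := block [.const 6 1, .const 24 1,
  forLoop 10 2 (block [.load 14 0 6, .add 6 6 1, .load 25 6 24, .load 26 7 24, .load 26 3 26,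
    clauseLiterals, .add 24 24 1, .add 24 24 1])]

/-- Sums a table over the two values of a vertex, with a minus sign for clauses. -/
def forget : RamProg := forLoop 20 5 (block [.add 21 19 20, .load 21 4 21,
  .ite 0 21 .skip (block [.add 22 27 20, .add 23 22 28, .numLoad 1 0 22, .numLoad 3 0 23,
    .ite 0 15 (.numSub 1 1 3) (.numAdd 1 1 3), .numStore 0 22 1, .numStore 0 23 1])])

/-- Multiplies the table of a node into the table of the parent. -/
def mulInto : RamProg := forLoop 20 5 (block [.add 22 27 20, .add 23 29 20, .numLoad 1 0 22,
  .numLoad 3 0 23, .numMul 1 1 3, .numStore 0 23 1])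

/-- Eliminates from a table those vertices which do not occur in the bag of the parent. -/
def forgetVertices : RamProg := forLoop 11 14 (block [readVertex, .load 18 6 16,
  .ite 18 31 .skip (block [.load 19 7 16, .load 28 2 19, .load 19 3 19, forget])])

/-- Goes through the nodes bottom-up. -/
def eliminate : RamProg := forLoop 10 3 (block [.sub 30 3 10, .sub 30 30 1, .add 31 30 1,
  .load 12 1 30, .load 27 5 30, .load 32 0 12, .add 13 12 1, .load 14 0 13, .add 13 13 1,
  forgetVertices, .ite 0 30 (block [.load 29 5 32, mulInto]) .skip])

/-- Everything that precedes the work on the tables. -/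
def prepare : RamProg := block [skipFormula, readTree, powers, bits, tables, slots]

/-- The program for model counting. -/
def countModels : RamProg := block [prepare, literals, eliminate, .numLoad 0 0 0]

end RamProg

/-! ### Reading the input -/

/-- The parent of node `i`. -/
def parent (T : TreeCode) (i : ℕ) : ℕ := (T.getD i (0, [])).1

/-- The bag of node `i`. -/
def bag (T : TreeCode) (i : ℕ) : List (ℕ ⊕ ℕ) := (T.getD i (0, [])).2

/-- The number of a vertex: `2x` for the variable `x`, and `2j + 1` for the clause `j`. -/
def vid : ℕ ⊕ ℕ → ℕ := Sum.elim (fun x => 2 * x) (fun j => 2 * j + 1)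

/-- The position of clause `j` in the input. -/
def clausePos (L : List (List Literal)) (j : ℕ) : ℕ :=
  1 + ∑ i ∈ Finset.range j, (1 + 2 * (L.getD i []).length)

/-- The position of node `i` in the input. -/
def nodePos (L : List (List Literal)) (T : TreeCode) (i : ℕ) : ℕ :=
  clausePos L L.length + 1 + ∑ i ∈ Finset.range i, (2 + 2 * (bag T i).length)

/-- The input array. -/
def input (L : List (List Literal)) (T : TreeCode) (i : ℕ) : ℕ :=
  (encodeFormula L ++ encodeTree T).getD i 0

theorem vid_injective : Function.Injective vid := by
  rintro (x | x) (y | y) h <;> simp [vid] at h ⊢ <;> omega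

theorem length_flatMap_pair {α : Type} (l : List α) (f : α → List ℕ) (k : ℕ)
    (hf : ∀ a, (f a).length = k) : (l.flatMap f).length = k * l.length := by
  induction l with
  | nil => simp
  | cons a l ih => simp [ih, hf]; ring

theorem length_flatMap_getD {α : Type} (d : α) (l : List α) (f : α → List ℕ) :
    (l.flatMap f).length = ∑ i ∈ Finset.range l.length, (f (l.getD i d)).length := by
  induction l with
  | nil => simp
  | cons a l ih => simp [Finset.sum_range_succ', ih, add_comm]

theorem getD_flatMap {α : Type} (d : α) (l : List α) (f : α → List ℕ) (j r : ℕ)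
    (hj : j < l.length) (hr : r < (f (l.getD j d)).length) :
    (l.flatMap f).getD (∑ i ∈ Finset.range j, (f (l.getD i d)).length + r) 0 =
      (f (l.getD j d)).getD r 0 := by
  induction l generalizing j with
  | nil => simp at hj
  | cons a l ih =>
    cases j with
    | zero =>
      simp only [List.getD_cons_zero] at hr
      rw [List.flatMap_cons, Finset.sum_range_zero, zero_add, List.getD_append _ _ _ _ hr,
        List.getD_cons_zero]
    | succ j =>
      simp only [List.getD_cons_succ, List.length_cons] at hr hj ⊢
      rw [List.flatMap_cons, Finset.sum_range_succ', List.getD_append_right _ _ _ _ (by simp; omega),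
        ← ih j (by omega) hr]
      congr 1
      simp
      omega

/-- The code of a clause. -/
def clauseWord (c : List Literal) : List ℕ := c.length :: c.flatMap fun l => [l.1, l.2.toNat]

/-- The code of a node. -/
def nodeWord (p : ℕ × List (ℕ ⊕ ℕ)) : List ℕ := p.1 :: p.2.length ::
    p.2.flatMap fun v => Sum.elim (fun x => [0, x]) (fun j => [1, j]) v

theorem length_clauseWord (c : List Literal) : (clauseWord c).length = 1 + 2 * c.length := by
  rw [clauseWord, List.length_cons, length_flatMap_pair _ _ 2 (by simp), add_comm]

theorem length_nodeWord (p : ℕ × List (ℕ ⊕ ℕ)) : (nodeWord p).length = 2 + 2 * p.2.length := by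
  rw [nodeWord, List.length_cons, List.length_cons, length_flatMap_pair _ _ 2 (by
    rintro (x | x) <;> rfl), add_comm, ← add_assoc, add_comm _ (2 * _)]
  omega

theorem length_encodeFormula (L : List (List Literal)) :
    (encodeFormula L).length = clausePos L L.length := by
  have : encodeFormula L = L.length :: L.flatMap clauseWord := rfl
  rw [this, List.length_cons, length_flatMap_getD [], clausePos, add_comm]
  simp [length_clauseWord]

theorem input_zero (L : List (List Literal)) (T : TreeCode) : input L T 0 = L.length := rfl

theorem clausePos_mono (L : List (List Literal)) : Monotone (clausePos L) := by
  refine monotone_nat_of_le_succ fun n => ?_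
  simp [clausePos, Finset.sum_range_succ]

theorem clausePos_succ (L : List (List Literal)) (j : ℕ) :
    clausePos L (j + 1) = clausePos L j + (1 + 2 * (L.getD j []).length) := by
  simp only [clausePos, Finset.sum_range_succ]; omega

theorem input_clause (L : List (List Literal)) (T : TreeCode) (j r : ℕ) (hj : j < L.length)
    (hr : r < 1 + 2 * (L.getD j []).length) :
    input L T (clausePos L j + r) = (clauseWord (L.getD j [])).getD r 0 := by
  have h1 : encodeFormula L = L.length :: L.flatMap clauseWord := rfl
  have h2 := clausePos_succ L j
  have h3 : clausePos L (j + 1) ≤ clausePos L L.length := clausePos_mono L hj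
  rw [input, List.getD_append _ _ _ _ (by rw [length_encodeFormula]; omega), h1,
    ← getD_flatMap [] L clauseWord j r hj (by rw [length_clauseWord]; exact hr)]
  have h4 : clausePos L j + r =
      ∑ i ∈ Finset.range j, (clauseWord (L.getD i [])).length + r + 1 := by
    simp only [clausePos, length_clauseWord]; omega
  rw [h4, List.getD_cons_succ]

theorem input_clause_length (L : List (List Literal)) (T : TreeCode) (j : ℕ) (hj : j < L.length) :
    input L T (clausePos L j) = (L.getD j []).length := by
  have := input_clause L T j 0 hj (by omega)
  rw [add_zero] at this
  rw [this]; rfl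

theorem getD_flatMap_pair {α : Type} (d : α) (l : List α) (f : α → List ℕ) (k j r : ℕ)
    (hf : ∀ a, (f a).length = k) (hj : j < l.length) (hr : r < k) :
    (l.flatMap f).getD (k * j + r) 0 = (f (l.getD j d)).getD r 0 := by
  rw [← getD_flatMap d l f j r hj (by rw [hf]; exact hr)]
  simp [hf, mul_comm]

theorem input_literal (L : List (List Literal)) (T : TreeCode) (j e : ℕ) (hj : j < L.length)
    (he : e < (L.getD j []).length) :
    input L T (clausePos L j + 1 + 2 * e) = ((L.getD j []).getD e (0, true)).1 ∧
    input L T (clausePos L j + 1 + 2 * e + 1) =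
      ((L.getD j []).getD e (0, true)).2.toNat := by
  constructor
  · rw [show clausePos L j + 1 + 2 * e = clausePos L j + (2 * e + 0 + 1) by omega,
      input_clause _ _ _ _ hj (by omega), clauseWord, List.getD_cons_succ]
    exact getD_flatMap_pair (0, true) _ (fun l : Literal => [l.1, l.2.toNat]) 2 e 0 (by simp) he
      (by omega)
  · rw [show clausePos L j + 1 + 2 * e + 1 = clausePos L j + (2 * e + 1 + 1) by omega,
      input_clause _ _ _ _ hj (by omega), clauseWord, List.getD_cons_succ]
    exact getD_flatMap_pair (0, true) _ (fun l : Literal => [l.1, l.2.toNat]) 2 e 1 (by simp) he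
      (by omega)

theorem input_length (L : List (List Literal)) (T : TreeCode) :
    input L T (clausePos L L.length) = T.length := by
  rw [input, List.getD_append_right _ _ _ _ (by rw [length_encodeFormula]), length_encodeFormula,
    Nat.sub_self]
  rfl

theorem nodePos_succ (L : List (List Literal)) (T : TreeCode) (i : ℕ) :
    nodePos L T (i + 1) = nodePos L T i + (2 + 2 * (bag T i).length) := by
  simp only [nodePos, Finset.sum_range_succ]; omega

theorem input_node (L : List (List Literal)) (T : TreeCode) (i r : ℕ) (hi : i < T.length)
    (hr : r < 2 + 2 * (bag T i).length) :
    input L T (nodePos L T i + r) = (nodeWord (T.getD i (0, []))).getD r 0 := by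
  have h1 : encodeTree T = T.length :: T.flatMap nodeWord := rfl
  rw [input, List.getD_append_right _ _ _ _ (by rw [length_encodeFormula, nodePos]; omega), h1,
    ← getD_flatMap (0, []) T nodeWord i r hi (by rw [length_nodeWord]; exact hr)]
  have h4 : nodePos L T i + r - (encodeFormula L).length =
      ∑ i ∈ Finset.range i, (nodeWord (T.getD i (0, []))).length + r + 1 := by
    simp only [nodePos, length_nodeWord, length_encodeFormula, bag]; omega
  rw [h4, List.getD_cons_succ]

theorem input_parent (L : List (List Literal)) (T : TreeCode) (i : ℕ) (hi : i < T.length) :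
    input L T (nodePos L T i) = parent T i := by
  have := input_node L T i 0 hi (by omega)
  rw [add_zero] at this
  rw [this]; rfl

theorem input_bag_length (L : List (List Literal)) (T : TreeCode) (i : ℕ) (hi : i < T.length) :
    input L T (nodePos L T i + 1) = (bag T i).length := by
  rw [input_node L T i 1 hi (by omega)]; rfl

/-- The kind of a vertex: `0` for variables and `1` for clauses. -/
def kind : ℕ ⊕ ℕ → ℕ := Sum.elim (fun _ => 0) (fun _ => 1)

theorem input_vertex (L : List (List Literal)) (T : TreeCode) (i e : ℕ) (hi : i < T.length)
    (he : e < (bag T i).length) :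
    input L T (nodePos L T i + 2 + 2 * e) = kind ((bag T i).getD e (.inl 0)) ∧
    2 * input L T (nodePos L T i + 2 + 2 * e + 1) + kind ((bag T i).getD e (.inl 0)) =
      vid ((bag T i).getD e (.inl 0)) := by
  have h : ∀ v : ℕ ⊕ ℕ, (Sum.elim (fun x => [0, x]) (fun j => [1, j]) v : List ℕ).length = 2 := by
    rintro (x | x) <;> rfl
  rw [show nodePos L T i + 2 + 2 * e = nodePos L T i + (2 * e + 0 + 1 + 1) by omega,
    show nodePos L T i + (2 * e + 0 + 1 + 1) + 1 = nodePos L T i + (2 * e + 1 + 1 + 1) by omega,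
      input_node _ _ _ _ hi (by omega), input_node _ _ _ _ hi (by omega), nodeWord,
      List.getD_cons_succ, List.getD_cons_succ, List.getD_cons_succ, List.getD_cons_succ]
  have h1 := getD_flatMap_pair (.inl 0) (bag T i) _ 2 e 0 h he (by omega)
  have h2 := getD_flatMap_pair (.inl 0) (bag T i) _ 2 e 1 h he (by omega)
  rw [add_zero] at h1
  refine (congrArg₂ (fun a b => a = kind ((bag T i).getD e (.inl 0)) ∧
    2 * b + kind ((bag T i).getD e (.inl 0)) = vid ((bag T i).getD e (.inl 0))) h1 h2).mpr ?_
  generalize (bag T i).getD e (.inl 0) = v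
  rcases v with x | x <;> simp [kind, vid]

/-- The maximum size of the bags of the first `i` nodes. -/
def maxBag (T : TreeCode) (i : ℕ) : ℕ := (Finset.range i).sup fun i => (bag T i).length

end SharpSat
namespace SharpSat
open RamProg

attribute [simp] Runs.skip Runs.const Runs.copy Runs.add Runs.sub Runs.load Runs.store
  Runs.numConst Runs.numAdd Runs.numSub Runs.numMul Runs.numLoad Runs.numStore Runs.seq Runs.ite
  RamState.reg_setReg RamState.arr_setArr RamState.num_setNum RamState.numArr_setNumArr

theorem forall_le_update {β : Type} {f g : ℕ → β} {n : ℕ} {v : β} (hf : ∀ j < n, f j = g j)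
    (hv : v = g n) : ∀ j ≤ n, Function.update f n v j = g j := by
  intro j hj
  rcases hj.lt_or_eq with h | rfl
  · rw [Function.update_of_ne h.ne, hf j h]
  · rw [Function.update_self, hv]

theorem maxBag_succ (T : TreeCode) (i : ℕ) :
    maxBag T (i + 1) = max (bag T i).length (maxBag T i) := by
  simp [maxBag, Finset.range_add_one]

theorem runs_skipFormula {L : List (List Literal)} {T : TreeCode} {σ : RamState}
    (h : σ.arr 0 = input L T) (h0 : σ.reg 0 = 0) :
    Runs skipFormula σ fun t τ => t ≤ 7 + 7 * L.length ∧ τ.reg 1 = 1 ∧ τ.reg 2 = L.length ∧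
      τ.reg 6 = clausePos L L.length := by
  simp [skipFormula, block]
  refine (Runs.forLoop_const (fun j τ => τ.reg 6 = clausePos L j) 5 (by simp) (by decide)
    (by decide) (by decide) (by simp [clausePos]) ?_).mono ?_
  · intro n τ hn hI hF _
    have g1 := hF.reg 1 (by decide)
    have g2 := hF.arr 0 (by decide)
    simp [h, h0, input_zero] at hn g1 g2
    have := input_clause_length L T n hn
    simp [hI, g1, g2, this, clausePos_succ]
    omega
  · intro t τ hI hF
    have g1 := hF.reg 1 (by decide)
    have g2 := hF.reg 2 (by decide)
    simp [h, h0, input_zero] at hI g1 g2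
    simp [g1, g2, hI]
    omega

theorem runs_readTree {L : List (List Literal)} {T : TreeCode} {σ : RamState}
    (h : σ.arr 0 = input L T) (h1 : σ.reg 1 = 1) (h6 : σ.reg 6 = clausePos L L.length) :
    Runs readTree σ fun t τ => t ≤ 6 + 11 * T.length ∧ τ.reg 3 = T.length ∧
      τ.reg 4 = maxBag T T.length ∧ ∀ i < T.length, τ.arr 1 i = nodePos L T i := by
  simp [readTree, block]
  refine (Runs.forLoop_const (fun i τ => τ.reg 6 = nodePos L T i ∧ τ.reg 4 = maxBag T i ∧
    ∀ j < i, τ.arr 1 j = nodePos L T j) 9 (by simp [h1]) (by decide)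
    (by decide) (by decide) (by simp [nodePos, maxBag, h6, h1]) ?_).mono ?_
  · rintro n τ hn ⟨i1, i2, i3⟩ hF hn'
    have g1 := hF.reg 1 (by decide)
    have g2 := hF.arr 0 (by decide)
    simp [h, h6, input_length, h1] at hn g1 g2
    have := input_bag_length L T n hn
    have e := nodePos_succ L T n
    have e' := maxBag_succ T n
    have e'' := forall_le_update i3 (v := nodePos L T n) rfl
    simp [i1, i2, hn', g1, g2, this]
    exact ⟨fun _ => ⟨by omega, by omega, e''⟩, fun _ => ⟨by omega, by omega, e''⟩⟩
  · intro t τ hI hF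
    have g3 := hF.reg 3 (by decide)
    simp [h, h6, input_length] at hI g3
    refine ⟨by omega, g3, hI.2.2⟩

theorem runs_powers {σ : RamState} (h1 : σ.reg 1 = 1) :
    Runs powers σ fun t τ => t ≤ 4 + 5 * σ.reg 4 ∧ τ.reg 5 = 2 ^ σ.reg 4 ∧
      ∀ s < σ.reg 4, τ.arr 2 s = 2 ^ s := by
  simp [powers, block]
  refine (Runs.forLoop_const (fun s τ => τ.reg 5 = 2 ^ s ∧ ∀ j < s, τ.arr 2 j = 2 ^ j) 3
    (by simp [h1]) (by decide) (by decide) (by decide) (by simp) ?_).mono ?_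
  · rintro n τ hn ⟨i1, i2⟩ hF hn'
    have e := forall_le_update i2 (v := 2 ^ n) rfl
    simp [i1, hn', pow_succ]
    exact ⟨by omega, e⟩
  · intro t τ hI hF
    simp at hI
    exact ⟨by omega, hI.2⟩

/-- The bit number `s` of `i`. -/
def bit (s i : ℕ) : ℕ := i / 2 ^ s % 2

theorem bit_of_lt {s i : ℕ} (h : i < 2 ^ s) : bit s i = 0 := by
  simp [bit, Nat.div_eq_of_lt h]

theorem bit_sub {s i : ℕ} (h : 2 ^ s ≤ i) : 1 - bit s (i - 2 ^ s) = bit s i := by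
  obtain ⟨j, rfl⟩ := Nat.exists_eq_add_of_le h
  simp only [bit, Nat.add_sub_cancel_left]
  rw [Nat.add_div_left _ (by positivity)]
  omega

theorem runs_bits {σ : RamState} {K : ℕ} (h1 : σ.reg 1 = 1) (h4 : σ.reg 4 = K)
    (h5 : σ.reg 5 = 2 ^ K) (h2 : ∀ s < K, σ.arr 2 s = 2 ^ s) :
    Runs bits σ fun t τ => t ≤ 4 + K * (8 + 11 * 2 ^ K) ∧ (∀ s < K, τ.arr 3 s = s * 2 ^ K) ∧
      ∀ s < K, ∀ i < 2 ^ K, τ.arr 4 (s * 2 ^ K + i) = bit s i := by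
  simp [bits, block]
  refine (Runs.forLoop_const (fun s τ => τ.reg 6 = s * 2 ^ K ∧ (∀ j < s, τ.arr 3 j = j * 2 ^ K) ∧
    ∀ j < s, ∀ i < 2 ^ K, τ.arr 4 (j * 2 ^ K + i) = bit j i) (6 + 11 * 2 ^ K)
    (by simp [h1]) (by decide) (by decide) (by decide) (by simp) ?_).mono ?_
  · rintro s τ hs ⟨i1, i2, i3⟩ hF hn'
    have g1 := hF.reg 1 (by decide)
    have g2 := hF.arr 2 (by decide)
    have g5 := hF.reg 5 (by decide)
    simp [h1, h4, h5] at hs g1 g2 g5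
    simp [i1, hn', g2, h2 s hs]
    have e := forall_le_update i2 (v := s * 2 ^ K) rfl
    refine (Runs.forLoop_const (fun i υ => (∀ i < 2 ^ K, ∀ j < s,
      υ.arr 4 (j * 2 ^ K + i) = bit j i) ∧ ∀ j < i, υ.arr 4 (s * 2 ^ K + j) = bit s j) 9
      (by simp [g1]) (by decide) (by decide) (by decide) ?_ ?_).mono ?_
    · simp
      exact fun i hi j hj => i3 j hj i hi
    · rintro i υ hi ⟨i4, i5⟩ hG hi'
      have k1 := hG.reg 1 (by decide)
      have k6 := hG.reg 6 (by decide)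
      have k7 := hG.reg 7 (by decide)
      simp [g1, i1, g5] at hi k1 k6 k7
      have key : ∀ v, v = bit s i → (∀ i' < 2 ^ K, ∀ j < s, Function.update (υ.arr 4)
          (s * 2 ^ K + i) v (j * 2 ^ K + i') = bit j i') ∧ ∀ j ≤ i, Function.update (υ.arr 4)
          (s * 2 ^ K + i) v (s * 2 ^ K + j) = bit s j := by
        intro v hv
        refine ⟨fun i' hi' j hj => ?_, fun j hj => ?_⟩
        · rw [Function.update_of_ne, i4 i' hi' j hj]
          have : (j + 1) * 2 ^ K ≤ s * 2 ^ K := Nat.mul_le_mul_right _ hj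
          rw [Nat.add_mul] at this
          omega
        · rcases hj.lt_or_eq with h | rfl
          · rw [Function.update_of_ne (by omega), i5 j h]
          · rw [Function.update_self, hv]
      simp [k1, k6, k7, hi']
      constructor
      · intro hlt
        exact key 0 (bit_of_lt hlt).symm
      · intro hlt
        rw [show i - 2 ^ s + s * 2 ^ K = s * 2 ^ K + (i - 2 ^ s) by omega,
          i5 _ (by have := Nat.two_pow_pos s; omega)]
        exact key _ (bit_sub hlt)
    · intro t υ hI hG
      have k3 := hG.arr 3 (by decide)
      have k5 := hG.reg 5 (by decide)
      have k6 := hG.reg 6 (by decide)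
      simp [i1, g5] at hI k3 k5 k6
      simp [k3, k5, k6]
      refine ⟨by omega, by ring, e, ?_⟩
      · intro j hj i hi
        rcases hj.lt_or_eq with h | rfl
        · exact hI.2.1 i hi j h
        · exact hI.2.2 i hi
  · intro t τ hI hF
    simp [h4] at hI
    refine ⟨?_, hI.2.2⟩
    have : K * (6 + 11 * 2 ^ K + 2) = K * (8 + 11 * 2 ^ K) := by ring
    omega

theorem runs_tables {σ : RamState} {P : ℕ} (h1 : σ.reg 1 = 1) (h5 : σ.reg 5 = P) :
    Runs tables σ fun t τ => t ≤ 5 + σ.reg 3 * (6 + 5 * P) ∧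
      (∀ i < σ.reg 3, τ.arr 5 i = i * P) ∧
      ∀ a < σ.reg 3 * P, τ.numArr 0 a = 1 := by
  simp [tables, block]
  refine (Runs.forLoop_const (fun i τ => τ.reg 6 = i * P ∧ (∀ j < i, τ.arr 5 j = j * P) ∧
    ∀ a < i * P, τ.numArr 0 a = 1) (4 + 5 * P)
    (by simp [h1]) (by decide) (by decide) (by decide) (by simp) ?_).mono ?_
  · rintro i τ hi ⟨i1, i2, i3⟩ hF hn'
    have g1 := hF.reg 1 (by decide)
    have g2 := hF.num 1 (by decide)
    have g5 := hF.reg 5 (by decide)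
    simp [h1, h5] at hi g1 g2 g5
    simp [i1, hn']
    have e := forall_le_update i2 (v := i * P) rfl
    refine (Runs.forLoop_const (fun j υ => υ.reg 6 = i * P + j ∧
      ∀ a < i * P + j, υ.numArr 0 a = 1) 3
      (by simp [g1]) (by decide) (by decide) (by decide) ?_ ?_).mono ?_
    · simpa [i1] using i3
    · rintro j υ hj ⟨i4, i5⟩ hG hi'
      have k1 := hG.reg 1 (by decide)
      have k2 := hG.num 1 (by decide)
      simp [g1, g2] at k1 k2
      simp [k1, k2, i4]
      exact ⟨by omega, fun a ha => forall_le_update (g := fun _ => 1) i5 rfl a (by omega)⟩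
    · intro t υ hI hG
      have k3 := hG.arr 5 (by decide)
      simp [g5] at hI k3
      simp [k3, hI.2.1, Nat.add_mul]
      exact ⟨by omega, e, hI.2.2⟩
  · intro t τ hI hF
    simp at hI
    refine ⟨?_, hI.2.2⟩
    have : σ.reg 3 * (4 + 5 * P + 2) = σ.reg 3 * (6 + 5 * P) := by ring
    omega

end SharpSat
namespace SharpSat
open RamProg

/-! ### Valid tree codes -/

/-- The names of the vertices of the incidence graph. -/
def names (L : List (List Literal)) : List (ℕ ⊕ ℕ) :=
  (L.flatMap fun c => c.map fun l => .inl l.1) ++ (List.range L.length).map .inr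

/-- `T` is the code of a tree decomposition of the incidence graph. -/
structure ValidCode (L : List (List Literal)) (T : TreeCode) : Prop where
  pos : 0 < T.length
  parent_lt : ∀ i < T.length, 0 < i → parent T i < i
  nodup : ∀ i < T.length, (bag T i).Nodup
  mem_names : ∀ i < T.length, ∀ v ∈ bag T i, v ∈ names L
  cover : ∀ v ∈ names L, ∃ i < T.length, v ∈ bag T i
  conn : ∀ i < T.length, ∀ v ∈ bag T i, 0 < i → v ∉ bag T (parent T i) →
    ∀ j < i, v ∉ bag T j
  edge : ∀ j < L.length, ∀ l ∈ L.getD j [], ∃ i < T.length, .inl l.1 ∈ bag T i ∧ .inr j ∈ bag T i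

instance : LawfulBEq (ℕ ⊕ ℕ) where
  eq_of_beq {a b} h := by
    rcases a with a | a <;> rcases b with b | b
    · exact congrArg _ (eq_of_beq (α := ℕ) h)
    · cases h
    · cases h
    · exact congrArg _ (eq_of_beq (α := ℕ) h)
  rfl {a} := by rcases a with a | a <;> exact beq_self_eq_true (α := ℕ) a

theorem take_succ_getD {α : Type} (d : α) (l : List α) (e : ℕ) (he : e < l.length) :
    l.take (e + 1) = l.take e ++ [l.getD e d] := by
  rw [List.getD_eq_getElem _ _ he, List.take_append_getElem]

/-- The first node whose bag contains `v`. -/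
def first (T : TreeCode) (v : ℕ ⊕ ℕ) : ℕ := T.findIdx fun p : ℕ × List (ℕ ⊕ ℕ) => decide (v ∈ p.2)

theorem bag_of_lt {T : TreeCode} {i : ℕ} (h : i < T.length) : bag T i = T[i].2 := by
  simp [bag, List.getD_eq_getElem?_getD, h]

theorem lt_length_of_mem_bag {T : TreeCode} {i : ℕ} {v : ℕ ⊕ ℕ} (h : v ∈ bag T i) :
    i < T.length := by
  by_contra h'
  rw [bag, List.getD_eq_default _ _ (not_lt.mp h')] at h
  simp at h

theorem not_mem_of_lt_first {T : TreeCode} {i : ℕ} {v : ℕ ⊕ ℕ} (h : i < first T v) :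
    v ∉ bag T i := by
  have h1 : i < T.length := h.trans_le List.findIdx_le_length
  have := List.not_of_lt_findIdx h
  rw [bag_of_lt h1]
  simpa using this

theorem first_le {T : TreeCode} {i : ℕ} {v : ℕ ⊕ ℕ} (h : v ∈ bag T i) : first T v ≤ i :=
  not_lt.mp fun h' => not_mem_of_lt_first h' h

theorem mem_bag_first {T : TreeCode} {i : ℕ} {v : ℕ ⊕ ℕ} (h : v ∈ bag T i) :
    v ∈ bag T (first T v) := by
  have h1 : first T v < T.length := (first_le h).trans_lt (lt_length_of_mem_bag h)
  have := List.findIdx_getElem (w := h1)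
  rw [bag_of_lt h1]
  exact of_decide_eq_true this

theorem first_eq {T : TreeCode} {i : ℕ} {v : ℕ ⊕ ℕ} (h : v ∈ bag T i) (h' : ∀ j < i, v ∉ bag T j) :
    first T v = i :=
  (first_le h).antisymm (not_lt.mp fun hlt => h' _ hlt (mem_bag_first h))

theorem length_bag_le_maxBag {T : TreeCode} {i : ℕ} (h : i < T.length) :
    (bag T i).length ≤ maxBag T T.length :=
  Finset.le_sup (f := fun i => (bag T i).length) (Finset.mem_range.mpr h)

namespace ValidCode

variable {L : List (List Literal)} {T : TreeCode}

theorem mem_parent (hT : ValidCode L T) {i : ℕ} {v : ℕ ⊕ ℕ} (h : v ∈ bag T i)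
    (hi : first T v < i) : v ∈ bag T (parent T i) := by
  by_contra h'
  exact hT.conn i (lt_length_of_mem_bag h) v h (by omega) h' _ hi (mem_bag_first h)

theorem mem_bag_max (hT : ValidCode L T) {u v : ℕ ⊕ ℕ} (i : ℕ) (hu : u ∈ bag T i)
    (hv : v ∈ bag T i) :
    u ∈ bag T (max (first T u) (first T v)) ∧ v ∈ bag T (max (first T u) (first T v)) := by
  induction i using Nat.strong_induction_on with
  | h i ih =>
    have h1 := first_le hu
    have h2 := first_le hv
    by_cases h : max (first T u) (first T v) = i
    · rw [h]; exact ⟨hu, hv⟩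
    · exact ih _ (hT.parent_lt i (lt_length_of_mem_bag hu) (by omega))
        (hT.mem_parent hu (by omega)) (hT.mem_parent hv (by omega))

end ValidCode

/-! ### Assigning slots -/

theorem runs_readVertex {L : List (List Literal)} {T : TreeCode} {σ : RamState}
    {Q : ℕ → RamState → Prop} {i e : ℕ} (h : σ.arr 0 = input L T) (h1 : σ.reg 1 = 1)
    (h13 : σ.reg 13 = nodePos L T i + 2 + 2 * e) (hi : i < T.length) (he : e < (bag T i).length) :
    Runs readVertex σ Q ↔ Q 7 (((σ.setReg 15 (kind ((bag T i).getD e (.inl 0)))).setReg 16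
      (vid ((bag T i).getD e (.inl 0)))).setReg 13 (nodePos L T i + 2 + 2 * (e + 1))) := by
  obtain ⟨a1, a2⟩ := input_vertex L T i e hi he
  rw [← a2]
  simp only [readVertex, block, Runs.seq, Runs.load, Runs.add, Runs.skip]
  simp [h, h1, h13, a1]
  have : ∀ τ τ' : RamState, τ = τ' → (Q 7 τ ↔ Q 7 τ') := by rintro τ _ rfl; rfl
  apply this
  simp only [RamState.setReg, RamState.mk.injEq, and_true]
  funext r
  simp only [Function.update_apply]
  split_ifs <;> omega

theorem runs_freeSlot {σ : RamState} (h1 : σ.reg 1 = 1) (hs : ∃ s < σ.reg 4, σ.arr 8 s < σ.reg 17) :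
    Runs freeSlot σ fun t τ => t ≤ 2 + 6 * σ.reg 4 ∧ τ.reg 22 < σ.reg 4 ∧
      σ.arr 8 (τ.reg 22) < σ.reg 17 := by
  simp only [freeSlot, block]
  refine (Runs.forLoop_const (fun n τ => (∃ s < n, σ.arr 8 s < σ.reg 17) → τ.reg 22 < n ∧
    σ.arr 8 (τ.reg 22) < σ.reg 17) 4 h1 (by decide) (by decide) (by decide) (by simp) ?_).mono ?_
  · rintro n τ hn hI hF hn'
    have g8 := hF.arr 8 (by decide)
    have g17 := hF.reg 17 (by decide)
    simp [g8, g17, hn']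
    refine ⟨fun hlt _ _ _ => hlt, fun hle s hs hs' => ?_⟩
    have : s ≠ n := by rintro rfl; omega
    have := hI ⟨s, by omega, hs'⟩
    exact ⟨by omega, this.2⟩
  · intro t τ hI hF
    exact ⟨by omega, hI.2 hs⟩

/-- `v` occurs in one of the first `i` bags or among the first `e` vertices of bag number `i`. -/
def Seen (T : TreeCode) (i e : ℕ) (v : ℕ ⊕ ℕ) : Prop :=
  (∃ j < i, v ∈ bag T j) ∨ v ∈ (bag T i).take e

theorem seen_zero {T : TreeCode} {i : ℕ} {v : ℕ ⊕ ℕ} : Seen T i 0 v ↔ ∃ j < i, v ∈ bag T j := by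
  simp [Seen]

theorem seen_length {T : TreeCode} {i : ℕ} {v : ℕ ⊕ ℕ} :
    Seen T i (bag T i).length v ↔ Seen T (i + 1) 0 v := by
  simp only [Seen, List.take_length, List.take_zero, List.not_mem_nil, or_false]
  constructor
  · rintro (⟨j, h, h'⟩ | h)
    · exact ⟨j, by omega, h'⟩
    · exact ⟨i, by omega, h⟩
  · rintro ⟨j, h, h'⟩
    rcases Nat.lt_succ_iff_lt_or_eq.mp h with h | rfl
    · exact .inl ⟨j, h, h'⟩
    · exact .inr h'

theorem seen_succ {T : TreeCode} {i e : ℕ} {v : ℕ ⊕ ℕ} (he : e < (bag T i).length) :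
    Seen T i (e + 1) v ↔ Seen T i e v ∨ v = (bag T i).getD e (.inl 0) := by
  rw [Seen, Seen, take_succ_getD (.inl 0) _ _ he, List.mem_append, List.mem_singleton, or_assoc]

/-- The invariant of the assignment of slots. -/
structure SlotInv (T : TreeCode) (i e : ℕ) (σ : RamState) : Prop where
  first : ∀ v, Seen T i e v → σ.arr 6 (vid v) = first T v + 1
  unseen : ∀ v, ¬ Seen T i e v → σ.arr 6 (vid v) = 0
  lt : ∀ v, Seen T i e v → σ.arr 7 (vid v) < maxBag T T.length
  inj : ∀ j < i, Set.InjOn (fun v => σ.arr 7 (vid v)) {v | v ∈ bag T j}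

theorem SlotInv.congr {T : TreeCode} {i e : ℕ} {σ τ : RamState} (h : SlotInv T i e σ)
    (h6 : τ.arr 6 = σ.arr 6) (h7 : τ.arr 7 = σ.arr 7) : SlotInv T i e τ :=
  ⟨by rw [h6]; exact h.first, by rw [h6]; exact h.unseen, by rw [h7]; exact h.lt, by rw [h7]; exact h.inj⟩

theorem runs_markSlots {L : List (List Literal)} {T : TreeCode} {σ : RamState} {i : ℕ}
    (hi : i < T.length)
    (h : σ.arr 0 = input L T) (h0 : σ.reg 0 = 0) (h1 : σ.reg 1 = 1)
    (h13 : σ.reg 13 = nodePos L T i + 2) (h14 : σ.reg 14 = (bag T i).length)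
    (h17 : σ.reg 17 = i + 1) (h8 : ∀ s, σ.arr 8 s ≤ i) (hS : SlotInv T i 0 σ) :
    Runs markSlots σ fun t τ => t ≤ 2 + 15 * (bag T i).length ∧ (∀ s, τ.arr 8 s ≤ i + 1) ∧
      ∀ s, τ.arr 8 s = i + 1 ↔ ∃ v ∈ bag T i, Seen T i 0 v ∧ σ.arr 7 (vid v) = s := by
  simp only [markSlots, block]
  refine (Runs.forLoop_const (fun e τ => τ.reg 13 = nodePos L T i + 2 + 2 * e ∧
    (∀ s, τ.arr 8 s ≤ i + 1) ∧
      ∀ s, τ.arr 8 s = i + 1 ↔ ∃ v ∈ (bag T i).take e, Seen T i 0 v ∧ σ.arr 7 (vid v) = s) 13 h1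
      (by decide) (by decide) (by decide) ?_ ?_).mono ?_
  · simp [h13, -Sum.exists]
    refine ⟨fun s => (h8 s).trans (by omega), fun s => ?_⟩
    have := h8 s
    omega
  · rintro e τ he ⟨i1, i2, i3⟩ hF hn'
    have g0 := hF.reg 0 (by decide)
    have g1 := hF.reg 1 (by decide)
    have g17 := hF.reg 17 (by decide)
    have a0 := hF.arr 0 (by decide)
    have a6 := hF.arr 6 (by decide)
    have a7 := hF.arr 7 (by decide)
    rw [h14] at he
    rw [h0] at g0
    rw [h1] at g1
    rw [h] at a0
    rw [h17] at g17
    rw [Runs.seq, runs_readVertex a0 g1 i1 hi he]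
    have htake : (bag T i).take (e + 1) = (bag T i).take e ++ [(bag T i).getD e (.inl 0)] :=
      take_succ_getD _ _ _ he
    generalize (bag T i).getD e (.inl 0) = v at htake ⊢
    rw [htake]
    have hv' : 0 < σ.arr 6 (vid v) ↔ Seen T i 0 v := by
      by_cases hv : Seen T i 0 v
      · simp [hv, hS.first v hv]
      · simp [hv, hS.unseen v hv]
    have hv0 : σ.arr 6 (vid v) = 0 ↔ ¬ Seen T i 0 v := by rw [← hv']; omega
    simp [g0, a6, a7, g17, or_and_right, exists_or, hv', hv0, -Sum.exists]
    refine ⟨fun hv => ⟨fun s => ?_, fun s => ?_⟩, fun hv => ⟨i2, fun s => ?_⟩⟩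
    · rw [Function.update_apply]; split_ifs; exacts [le_rfl, i2 s]
    · rw [Function.update_apply]
      split_ifs with hs
      · simp [hv, hs, -Sum.exists]
      · rw [i3]
        simp [hv, Ne.symm hs, -Sum.exists]
    · simp [i3, hv, -Sum.exists]
  · intro t τ hI hF
    rw [h14, List.take_length] at hI
    exact ⟨by omega, hI.2.2⟩

theorem runs_assignSlots {L : List (List Literal)} {T : TreeCode} {σ : RamState} {i : ℕ}
    (hi : i < T.length) 
    (h : σ.arr 0 = input L T) (h0 : σ.reg 0 = 0) (h1 : σ.reg 1 = 1)
    (h4 : σ.reg 4 = maxBag T T.length)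
    (h13 : σ.reg 13 = nodePos L T i + 2) (h14 : σ.reg 14 = (bag T i).length)
    (h17 : σ.reg 17 = i + 1) (hle : ∀ s, σ.arr 8 s ≤ i + 1)
    (h8 : ∀ s, σ.arr 8 s = i + 1 ↔ ∃ v ∈ bag T i, Seen T i 0 v ∧ σ.arr 7 (vid v) = s)
    (hinj : Set.InjOn (fun v => σ.arr 7 (vid v)) {v | v ∈ bag T i ∧ Seen T i 0 v})
    (hS : SlotInv T i 0 σ) :
    Runs assignSlots σ fun t τ => t ≤ 2 + (bag T i).length * (20 + 6 * maxBag T T.length) ∧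
      (∀ s, τ.arr 8 s ≤ i + 1) ∧ SlotInv T (i + 1) 0 τ := by
  simp only [assignSlots, block]
  refine (Runs.forLoop_const (fun e τ => τ.reg 13 = nodePos L T i + 2 + 2 * e ∧
    (∀ s, τ.arr 8 s ≤ i + 1) ∧
    (∀ s, τ.arr 8 s = i + 1 ↔ ∃ v ∈ bag T i, Seen T i e v ∧ τ.arr 7 (vid v) = s) ∧
    Set.InjOn (fun v => τ.arr 7 (vid v)) {v | v ∈ bag T i ∧ Seen T i e v} ∧ SlotInv T i e τ)
    (18 + 6 * maxBag T T.length) h1 (by decide) (by decide) (by decide) ?_ ?_).mono ?_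
  · exact ⟨h13, hle, h8, hinj, hS.congr rfl rfl⟩
  · rintro e τ he ⟨i1, i2, i3, i4, i5⟩ hF hn'
    have g0 := hF.reg 0 (by decide)
    have g1 := hF.reg 1 (by decide)
    have g4 := hF.reg 4 (by decide)
    have g17 := hF.reg 17 (by decide)
    have a0 := hF.arr 0 (by decide)
    rw [h14] at he
    rw [h0] at g0
    rw [h1] at g1
    rw [h4] at g4
    rw [h] at a0
    rw [h17] at g17
    rw [Runs.seq, runs_readVertex a0 g1 i1 hi he]
    have hmem : (bag T i).getD e (.inl 0) ∈ bag T i := by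
      rw [List.getD_eq_getElem _ _ he]; exact List.getElem_mem he
    have hseen := fun u => seen_succ (v := u) he
    generalize (bag T i).getD e (.inl 0) = v at hmem hseen ⊢
    have hv' : 0 < τ.arr 6 (vid v) ↔ Seen T i e v := by
      by_cases hv : Seen T i e v
      · simp [hv, i5.first v hv]
      · simp [hv, i5.unseen v hv]
    have hv0 : τ.arr 6 (vid v) = 0 ↔ ¬ Seen T i e v := by rw [← hv']; omega
    simp [g0, hv', hv0, -Sum.exists]
    constructor
    · intro hv
      have hseen' : ∀ u, Seen T i (e + 1) u ↔ Seen T i e u := fun u => by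
        rw [hseen]; constructor
        · rintro (h | rfl) <;> assumption
        · exact .inl
      simp only [hseen']
      exact ⟨by omega, i2, i3, i4, ⟨by simp only [hseen']; exact i5.first,
        by simp only [hseen']; exact i5.unseen, by simp only [hseen']; exact i5.lt, i5.inj⟩⟩
    · intro hv
      have hfree : ∃ s < maxBag T T.length, τ.arr 8 s < i + 1 := by
        by_contra! hcon
        have h2 : Finset.range (maxBag T T.length) ⊆
            ((bag T i).toFinset.erase v).image fun v => τ.arr 7 (vid v) := by
          intro s hs
          obtain ⟨u, hu, hu', hus⟩ := (i3 s).mp ((i2 s).antisymm (hcon s (Finset.mem_range.mp hs)))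
          refine Finset.mem_image.mpr ⟨u, Finset.mem_erase.mpr ⟨?_, by simpa using hu⟩, hus⟩
          rintro rfl
          exact hv hu'
        have h3 := (Finset.card_le_card h2).trans Finset.card_image_le
        have h5 := Finset.card_erase_lt_of_mem (List.mem_toFinset.mpr hmem)
        have h6 := List.toFinset_card_le (bag T i)
        have h7 := length_bag_le_maxBag hi
        rw [Finset.card_range] at h3
        omega
      refine (runs_freeSlot (by simpa using g1) (by simpa [g4, g17] using hfree)).mono ?_
      intro t υ hI hG
      have k6 := hG.arr 6 (by decide)
      have k7 := hG.arr 7 (by decide)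
      have k8 := hG.arr 8 (by decide)
      have k17 := hG.reg 17 (by decide)
      have k16 := hG.reg 16 (by decide)
      have k13 := hG.reg 13 (by decide)
      simp [g4, g17] at hI k6 k7 k8 k17 k16 k13
      obtain ⟨hI1, hI2, hI3⟩ := hI
      simp [k13, k17, k16, k7, k8, -Sum.exists]
      generalize υ.reg 22 = f at *
      have hne : ∀ u, Seen T i e u → u ≠ v := by rintro u hu rfl; exact hv hu
      have hupd : ∀ u, Seen T i e u → Function.update (τ.arr 7) (vid v) f (vid u) =
          τ.arr 7 (vid u) := fun u hu =>
        Function.update_of_ne (fun hc => hne u hu (vid_injective hc)) _ _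
      have hfst : first T v = i :=
        first_eq hmem fun j hj hj' => hv (.inl ⟨j, hj, hj'⟩)
      refine ⟨by omega, fun s => ?_, fun s => ?_, ?_, ?_, ?_, ?_, ?_⟩
      · rw [Function.update_apply]; split_ifs; exacts [le_rfl, i2 s]
      · rw [Function.update_apply]
        split_ifs with hs
        · simp only [true_iff]
          exact ⟨v, hmem, (hseen v).mpr (.inr rfl), by simp [hs]⟩
        · rw [i3]
          constructor
          · rintro ⟨u, hu, hu', hus⟩
            exact ⟨u, hu, (hseen u).mpr (.inl hu'), by rw [hupd u hu', hus]⟩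
          · rintro ⟨u, hu, hu', hus⟩
            rcases (hseen u).mp hu' with h' | rfl
            · exact ⟨u, hu, h', by rw [← hus, hupd u h']⟩
            · simp at hus; exact absurd hus.symm hs
      · have hf : ∀ u ∈ bag T i, Seen T i e u → τ.arr 7 (vid u) ≠ f := by
          rintro u hu hu' rfl
          have := (i3 _).mpr ⟨u, hu, hu', rfl⟩
          omega
        rintro u ⟨hu, hu'⟩ w ⟨hw, hw'⟩ huw
        simp only at huw
        rcases (hseen u).mp hu' with h' | rfl <;> rcases (hseen w).mp hw' with h'' | rfl
        · rw [hupd u h', hupd w h''] at huw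
          exact i4 ⟨hu, h'⟩ ⟨hw, h''⟩ huw
        · rw [hupd u h', Function.update_self] at huw
          exact absurd huw (hf u hu h')
        · rw [hupd w h'', Function.update_self] at huw
          exact absurd huw.symm (hf w hw h'')
        · rfl
      · intro u hu
        simp only [RamState.arr_setReg, RamState.arr_setArr, k6]
        simp
        rcases (hseen u).mp hu with hu | rfl
        · rw [Function.update_of_ne (fun hc => hne u hu (vid_injective hc)), i5.first u hu]
        · simp [hfst]
      · intro u hu
        rw [hseen, not_or] at hu
        simp [k6]
        rw [Function.update_of_ne (fun hc => hu.2 (vid_injective hc)), i5.unseen u hu.1]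
      · intro u hu'
        simp [k7]
        rcases (hseen u).mp hu' with h' | rfl
        · rw [hupd u h']; exact i5.lt u h'
        · simpa using hI2
      · intro j hj u hu w hw huw
        simp [k7, hupd u (.inl ⟨j, hj, hu⟩), hupd w (.inl ⟨j, hj, hw⟩)] at huw
        exact i5.inj j hj hu hw huw
  · intro t τ hI hF
    rw [h14] at hI
    obtain ⟨b1, b2, b3, b4, b5, b6⟩ := hI
    refine ⟨?_, b3, ?_, ?_, ?_, ?_⟩
    · refine b1.trans (by ring_nf; omega)
    · exact fun v hv => b6.first v (seen_length.mpr hv)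
    · exact fun v hv => b6.unseen v (fun h => hv (seen_length.mp h))
    · exact fun v hv => b6.lt v (seen_length.mpr hv)
    · intro j hj
      rcases Nat.lt_succ_iff_lt_or_eq.mp hj with h' | rfl
      · exact b6.inj j h'
      · refine b5.mono ?_
        rintro v (hv : v ∈ bag T j)
        exact ⟨hv, .inr (by rw [List.take_length]; exact hv)⟩

theorem runs_slots {L : List (List Literal)} {T : TreeCode} (hT : ValidCode L T) {σ : RamState}
    (h : σ.arr 0 = input L T) (h0 : σ.reg 0 = 0) (h1 : σ.reg 1 = 1)
    (h3 : σ.reg 3 = T.length) (h4 : σ.reg 4 = maxBag T T.length)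
    (hpos : ∀ i < T.length, σ.arr 1 i = nodePos L T i) (h6 : ∀ v, σ.arr 6 v = 0)
    (h8 : ∀ s, σ.arr 8 s = 0) :
    Runs slots σ fun t τ => t ≤ 2 + T.length * (16 + maxBag T T.length *
      (35 + 6 * maxBag T T.length)) ∧ SlotInv T T.length 0 τ := by
  simp only [slots, block]
  refine (Runs.forLoop_const (fun i τ => (∀ s, τ.arr 8 s ≤ i) ∧ SlotInv T i 0 τ)
    (14 + maxBag T T.length * (35 + 6 * maxBag T T.length)) h1 (by decide) (by decide) (by decide)
    ?_ ?_).mono ?_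
  · refine ⟨by simp [h8], ⟨?_, ?_, ?_, ?_⟩⟩ <;> simp [h6, Seen]
  · rintro i τ hi ⟨i1, i2⟩ hF hn'
    have g0 := hF.reg 0 (by decide)
    have g1 := hF.reg 1 (by decide)
    have g4 := hF.reg 4 (by decide)
    have a0 := hF.arr 0 (by decide)
    have a1 := hF.arr 1 (by decide)
    rw [h3] at hi
    rw [h0] at g0
    rw [h1] at g1
    rw [h4] at g4
    rw [h] at a0
    have hp := hpos i hi
    rw [← a1] at hp
    have hb := input_bag_length L T i hi
    simp [hn', hp, a0, g1, hb]
    refine (runs_markSlots hi (by simpa using a0) (by simpa using g0) (by simpa using g1)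
      (by simp) (by simp) (by simp) (by simpa using i1)
      (i2.congr (by simp) (by simp))).mono ?_
    rintro t υ ⟨j1, j2, j3⟩ hG
    have k0 := hG.reg 0 (by decide)
    have k1 := hG.reg 1 (by decide)
    have k4 := hG.reg 4 (by decide)
    have k12 := hG.reg 12 (by decide)
    have k14 := hG.reg 14 (by decide)
    have k17 := hG.reg 17 (by decide)
    have b0 := hG.arr 0 (by decide)
    have b6 := hG.arr 6 (by decide)
    have b7 := hG.arr 7 (by decide)
    simp [g0, g1, g4, a0] at k0 k1 k4 k12 k14 k17 b0 b6 b7 j3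
    simp [k1, k12]
    refine (runs_assignSlots hi (by simpa using b0) (by simpa using k0) (by simpa using k1)
      (by simpa using k4) (by simp) (by simpa using k14) (by simpa using k17) (by simpa using j2)
      (by simpa [b7] using j3) ?_ (i2.congr (by simpa using b6) (by simpa using b7))).mono ?_
    · simp only [RamState.arr_setReg, b7]
      by_cases hi0 : i = 0
      · subst hi0
        rintro u ⟨_, hu⟩
        simp [Seen] at hu
      · refine (i2.inj (parent T i) (hT.parent_lt i hi (by omega))).mono ?_
        rintro u ⟨hu, hu'⟩
        obtain ⟨j, hj, hj'⟩ := seen_zero.mp hu'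
        exact hT.mem_parent hu ((first_le hj').trans_lt hj)
    · rintro u χ ⟨l1, l2, l3⟩ hH
      refine ⟨?_, l2, l3.congr rfl rfl⟩
      have hle := length_bag_le_maxBag hi
      have : (bag T i).length * (20 + 6 * maxBag T T.length) ≤
        maxBag T T.length * (20 + 6 * maxBag T T.length) := Nat.mul_le_mul_right _ hle
      have e : maxBag T T.length * (35 + 6 * maxBag T T.length) = maxBag T T.length *
        (20 + 6 * maxBag T T.length) + 15 * maxBag T T.length := by ring
      omega
  · rintro t τ ⟨hI, -, hI'⟩ hF
    rw [h3] at hI hI'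
    exact ⟨by refine hI.trans (by ring_nf; omega), hI'⟩

end SharpSat
namespace SharpSat

/-! ### The model count as a sum over subsets of the vertices of the incidence graph -/

/-- The factor of a literal occurrence: `0` if the clause is chosen and the literal is true. -/
noncomputable def litFactor (c v : ℕ ⊕ ℕ) (b : Bool) (γ : Finset (ℕ ⊕ ℕ)) : ℤ :=
  if c ∈ γ ∧ (v ∈ γ ↔ b = true) then 0 else 1

/-- The product of the factors of the first `e` literals of clause `j`. -/
noncomputable def clauseWeight (L : List (List Literal)) (j e : ℕ) (γ : Finset (ℕ ⊕ ℕ)) : ℤ :=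
  ∏ e ∈ Finset.range e, litFactor (.inr j) (.inl ((L.getD j []).getD e (0, true)).1)
    ((L.getD j []).getD e (0, true)).2 γ

/-- The product of the factors of the first `m` clauses. -/
noncomputable def weight (L : List (List Literal)) (m : ℕ) (γ : Finset (ℕ ⊕ ℕ)) : ℤ :=
  ∏ j ∈ Finset.range m, clauseWeight L j (L.getD j []).length γ

/-- The sign of a vertex: `1` for variables and `-1` for clauses. -/
def vertexSign : ℕ ⊕ ℕ → ℤ := Sum.elim (fun _ => 1) (fun _ => -1)

noncomputable def sign (γ : Finset (ℕ ⊕ ℕ)) : ℤ := ∏ v ∈ γ, vertexSign v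

noncomputable def signedCount (L : List (List Literal)) : ℤ :=
  ∑ γ ∈ (names L).toFinset.powerset, sign γ * weight L L.length γ

theorem sum_powerset_disjSum {α β : Type} [DecidableEq α] [DecidableEq β] (A : Finset α)
    (B : Finset β) (f : Finset (α ⊕ β) → ℤ) :
    ∑ γ ∈ (A.disjSum B).powerset, f γ =
      ∑ a ∈ A.powerset, ∑ b ∈ B.powerset, f (a.disjSum b) := by
  rw [← Finset.sum_product']
  symm
  refine Finset.sum_bij' (fun p _ => p.1.disjSum p.2) (fun γ _ => (γ.toLeft, γ.toRight))
    ?_ ?_ ?_ ?_ ?_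
  · rintro ⟨a, b⟩ h
    simp only [Finset.mem_product, Finset.mem_powerset] at h ⊢
    exact Finset.disjSum_mono h.1 h.2
  · intro γ h
    simp only [Finset.mem_product, Finset.mem_powerset] at h ⊢
    constructor
    · intro x hx
      simpa using h (Finset.mem_toLeft.mp hx)
    · intro x hx
      simpa using h (Finset.mem_toRight.mp hx)
  · rintro ⟨a, b⟩ h
    simp
  · intro γ h
    exact Finset.toLeft_disjSum_toRight
  · rintro ⟨a, b⟩ h
    rfl

theorem IsListing.mem_iff {L : List (List Literal)} {φ : CNF} (h : IsListing L φ) {c : Clause} :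
    c ∈ φ ↔ ∃ j < L.length, (L.getD j []).toFinset = c := by
  rw [← h.2.2, List.mem_toFinset, List.mem_map]
  constructor
  · rintro ⟨l, hl, rfl⟩
    obtain ⟨j, hj, rfl⟩ := List.mem_iff_getElem.mp hl
    exact ⟨j, hj, by rw [List.getD_eq_getElem _ _ hj]⟩
  · rintro ⟨j, hj, rfl⟩
    rw [List.getD_eq_getElem _ _ hj]
    exact ⟨_, List.getElem_mem hj, rfl⟩

theorem mem_names {L : List (List Literal)} {v : ℕ ⊕ ℕ} : v ∈ names L ↔
    (∃ j < L.length, ∃ l ∈ L.getD j [], v = .inl l.1) ∨ ∃ j < L.length, v = .inr j := by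
  simp only [names, List.mem_append, List.mem_flatMap, List.mem_map, List.mem_range]
  constructor
  · rintro (⟨c, hc, l, hl, rfl⟩ | ⟨j, hj, rfl⟩)
    · obtain ⟨j, hj, rfl⟩ := List.mem_iff_getElem.mp hc
      exact .inl ⟨j, hj, l, by rwa [List.getD_eq_getElem _ _ hj], rfl⟩
    · exact .inr ⟨j, hj, rfl⟩
  · rintro (⟨j, hj, l, hl, rfl⟩ | ⟨j, hj, rfl⟩)
    · rw [List.getD_eq_getElem _ _ hj] at hl
      exact .inl ⟨_, List.getElem_mem hj, l, hl, rfl⟩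
    · exact .inr ⟨j, hj, rfl⟩

theorem IsListing.mem_vars {L : List (List Literal)} {φ : CNF} (h : IsListing L φ) {x : ℕ} :
    x ∈ vars φ ↔ .inl x ∈ names L := by
  simp only [vars, Finset.mem_biUnion, h.mem_iff, mem_names, Finset.mem_image, Sum.inl.injEq,
    reduceCtorEq, and_false, exists_false, or_false]
  constructor
  · rintro ⟨_, ⟨j, hj, rfl⟩, l, hl, rfl⟩
    exact ⟨j, hj, l, by simpa using hl, rfl⟩
  · rintro ⟨j, hj, l, hl, rfl⟩
    exact ⟨_, ⟨j, hj, rfl⟩, l, by simpa using hl, rfl⟩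

theorem IsListing.names_toFinset {L : List (List Literal)} {φ : CNF} (h : IsListing L φ) :
    (names L).toFinset = (vars φ).disjSum (Finset.range L.length) := by
  ext (x | j)
  · rw [List.mem_toFinset, ← h.mem_vars]; simp
  · rw [List.mem_toFinset, mem_names]; simp

/-- `1` if all literals of clause `j` are false, and `0` otherwise. -/
noncomputable def violation (L : List (List Literal)) (β : Finset ℕ) (j : ℕ) : ℤ :=
  ∏ e ∈ Finset.range (L.getD j []).length, if ((L.getD j []).getD e (0, true)).1 ∈ β ↔
    ((L.getD j []).getD e (0, true)).2 = true then 0 else 1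

theorem violation_eq (L : List (List Literal)) (β : Finset ℕ) (j : ℕ)
    [Decidable (SatisfiesClause β (L.getD j []).toFinset)] :
    1 - violation L β j = if SatisfiesClause β (L.getD j []).toFinset then 1 else 0 := by
  have key : SatisfiesClause β (L.getD j []).toFinset ↔ ∃ e ∈ Finset.range (L.getD j []).length,
      (((L.getD j []).getD e (0, true)).1 ∈ β ↔ ((L.getD j []).getD e (0, true)).2 = true) := by
    simp only [SatisfiesClause, List.mem_toFinset, Finset.mem_range]
    constructor
    · rintro ⟨x, ⟨h, hx⟩ | ⟨h, hx⟩⟩ <;> obtain ⟨e, he, h'⟩ := List.mem_iff_getElem.mp h <;>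
        refine ⟨e, he, ?_⟩ <;> rw [List.getD_eq_getElem _ _ he, h'] <;> simp [hx]
    · rintro ⟨e, he, h⟩
      have hm : (L.getD j []).getD e (0, true) ∈ L.getD j [] := by
        rw [List.getD_eq_getElem _ _ he]; exact List.getElem_mem he
      generalize (L.getD j []).getD e (0, true) = l at h hm
      obtain ⟨x, b⟩ := l
      cases b
      · exact ⟨x, .inr ⟨hm, by simpa using h⟩⟩
      · exact ⟨x, .inl ⟨hm, by simpa using h⟩⟩
  split_ifs with h
  · obtain ⟨e, he, h⟩ := key.mp h
    rw [violation, Finset.prod_eq_zero he (by rw [if_pos h])]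
    simp
  · rw [violation, Finset.prod_eq_one]
    · simp
    · intro e he
      rw [if_neg]
      exact fun h' => h (key.mpr ⟨e, he, h'⟩)

theorem modelCount_eq_signedCount {L : List (List Literal)} {φ : CNF} (h : IsListing L φ) :
    (modelCount φ : ℤ) = signedCount L := by
  classical
  rw [signedCount, h.names_toFinset, sum_powerset_disjSum, modelCount, Finset.card_filter,
    Nat.cast_sum]
  refine Finset.sum_congr rfl fun β _ => ?_
  have h1 : ∀ S ∈ (Finset.range L.length).powerset, sign (β.disjSum S) *
      weight L L.length (β.disjSum S) = ∏ j ∈ S, -violation L β j := by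
    intro S hS
    have hS := Finset.mem_powerset.mp hS
    have h2 : sign (β.disjSum S) = ∏ j ∈ S, (-1) := by
      simp [sign, Finset.prod_disjSum, vertexSign]
    have h3 : weight L L.length (β.disjSum S) = ∏ j ∈ S, violation L β j := by
      rw [weight, ← Finset.prod_subset hS]
      · refine Finset.prod_congr rfl fun j hj => ?_
        refine Finset.prod_congr rfl fun e _ => ?_
        simp [litFactor, hj]
      · intro j _ hj
        refine Finset.prod_eq_one fun e _ => ?_
        simp [litFactor, hj]
    rw [h2, h3, ← Finset.prod_mul_distrib]
    exact Finset.prod_congr rfl fun j _ => by ring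
  rw [Finset.sum_congr rfl h1, ← Finset.prod_one_add]
  simp only [← sub_eq_add_neg, violation_eq]
  rw [Finset.prod_boole]
  push_cast
  refine if_congr ?_ rfl rfl
  simp only [IsModel, h.mem_iff, Finset.mem_range]
  constructor
  · exact fun hm j hj => hm _ ⟨j, hj, rfl⟩
  · rintro hm _ ⟨j, hj, rfl⟩
    exact hm j hj

/-! ### Tables -/

theorem bit_eq_zero_or_one (s i : ℕ) : bit s i = 0 ∨ bit s i = 1 := Nat.mod_two_eq_zero_or_one _

theorem bit_eq_testBit (s i : ℕ) : bit s i = (i.testBit s).toNat := by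
  rw [Nat.toNat_testBit]; rfl

theorem add_two_pow_eq_xor {s i : ℕ} (h : bit s i = 0) : i + 2 ^ s = i ^^^ 2 ^ s := by
  have hr : i % 2 ^ s < 2 ^ s := Nat.mod_lt _ (by positivity)
  have h1 : i = 2 ^ s * (2 * (i / 2 ^ s / 2)) + i % 2 ^ s := by
    have := Nat.div_add_mod i (2 ^ s)
    have h2 : 2 * (i / 2 ^ s / 2) = i / 2 ^ s := by rw [bit] at h; omega
    rw [h2, this]
  generalize i / 2 ^ s / 2 = q at h1
  generalize i % 2 ^ s = r at h1 hr
  subst h1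
  rw [show 2 ^ s * (2 * q) + r + 2 ^ s = 2 ^ s * (2 * q + 1) + r by ring]
  refine Nat.eq_of_testBit_eq fun j => ?_
  rw [Nat.testBit_xor, Nat.testBit_two_pow_mul_add _ hr, Nat.testBit_two_pow_mul_add _ hr,
    Nat.testBit_two_pow]
  split_ifs with hj
  · simp [show s ≠ j by omega]
  · rcases (not_lt.mp hj).eq_or_lt with rfl | hlt
    · simp
    · obtain ⟨k, rfl⟩ : ∃ k, j = s + (k + 1) := ⟨j - s - 1, by omega⟩
      rw [Nat.add_sub_cancel_left, Nat.testBit_succ, Nat.testBit_succ]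
      simp [show (2 * q + 1) / 2 = q by omega]

theorem bit_add_two_pow_self {s i : ℕ} (h : bit s i = 0) : bit s (i + 2 ^ s) = 1 := by
  rw [bit_eq_testBit, add_two_pow_eq_xor h, Nat.testBit_xor]
  rw [bit_eq_testBit] at h
  cases hb : i.testBit s <;> simp_all

theorem bit_add_two_pow_of_ne {s s' i : ℕ} (h : bit s i = 0) (hs : s' ≠ s) :
    bit s' (i + 2 ^ s) = bit s' i := by
  rw [bit_eq_testBit, bit_eq_testBit, add_two_pow_eq_xor h, Nat.testBit_xor,
    Nat.testBit_two_pow_of_ne hs.symm, Bool.xor_false]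

theorem add_two_pow_lt {s i K : ℕ} (h : bit s i = 0) (hs : s < K) (hi : i < 2 ^ K) :
    i + 2 ^ s < 2 ^ K := by
  rw [add_two_pow_eq_xor h]
  exact Nat.xor_lt_two_pow hi (Nat.pow_lt_pow_right (by omega) hs)

theorem exists_add_two_pow {s i : ℕ} (h : bit s i = 1) :
    ∃ j, bit s j = 0 ∧ j + 2 ^ s = i := by
  have h1 : 2 ^ s ≤ i := by
    by_contra h'
    rw [bit_of_lt (by omega)] at h
    omega
  have := bit_sub h1
  exact ⟨i - 2 ^ s, by omega, by omega⟩

/-- The tables in `A`, read through the slots of the vertices in `S`, represent the functions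
`g n`, which depend on the vertices in `S` from the bag number `n` only. -/
structure Represents (T : TreeCode) (slot : ℕ ⊕ ℕ → ℕ) (K : ℕ) (S : Finset (ℕ ⊕ ℕ)) (M : ℕ)
    (A : ℕ → ℤ) (g : ℕ → Finset (ℕ ⊕ ℕ) → ℤ) : Prop where
  depends : ∀ n < M, ∀ γ γ', (∀ v ∈ bag T n, v ∈ S → (v ∈ γ ↔ v ∈ γ')) → g n γ = g n γ'
  value : ∀ n < M, ∀ i < 2 ^ K, ∀ γ, (∀ v ∈ bag T n, v ∈ S → (v ∈ γ ↔ bit (slot v) i = 1)) →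
    A (n * 2 ^ K + i) = g n γ

namespace Represents

variable {T : TreeCode} {slot : ℕ ⊕ ℕ → ℕ} {K M : ℕ} {S : Finset (ℕ ⊕ ℕ)} {A A' : ℕ → ℤ}
  {g : ℕ → Finset (ℕ ⊕ ℕ) → ℤ}

theorem clear (h : Represents T slot K S M A g) {n : ℕ} {c v : ℕ ⊕ ℕ} {b : Bool}
    (hn : n < M) (hc : c ∈ bag T n) (hv : v ∈ bag T n) (hcS : c ∈ S) (hvS : v ∈ S)
    (h1 : ∀ i < 2 ^ K, A' (n * 2 ^ K + i) =
      if bit (slot c) i = 1 ∧ bit (slot v) i = b.toNat then 0 else A (n * 2 ^ K + i))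
    (h2 : ∀ n' ≠ n, ∀ i < 2 ^ K, A' (n' * 2 ^ K + i) = A (n' * 2 ^ K + i)) :
    ∃ g', Represents T slot K S M A' g' ∧ ∀ γ, ∏ n ∈ Finset.range M, g' n γ =
      (∏ n ∈ Finset.range M, g n γ) * litFactor c v b γ := by
  refine ⟨fun n' γ => g n' γ * if n' = n then litFactor c v b γ else 1, ⟨?_, ?_⟩, ?_⟩
  · intro n' hn' γ γ' hγ
    rw [h.depends n' hn' γ γ' hγ]
    split_ifs with hnn
    · subst hnn
      simp only [litFactor, hγ c hc hcS, hγ v hv hvS]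
    · rfl
  · intro n' hn' i hi γ hγ
    split_ifs with hnn
    · subst hnn
      rw [h1 i hi, h.value n' hn' i hi γ hγ, litFactor]
      have e1 := hγ c hc hcS
      have e2 : (v ∈ γ ↔ b = true) ↔ bit (slot v) i = b.toNat := by
        rw [hγ v hv hvS]
        rcases bit_eq_zero_or_one (slot v) i with h | h <;> cases b <;> simp [h]
      simp only [← e1, ← e2]
      split_ifs <;> simp
    · rw [h2 n' hnn i hi, h.value n' hn' i hi γ hγ, mul_one]
  · intro γ
    rw [Finset.prod_mul_distrib, Finset.prod_ite_eq' _ _ (fun _ => litFactor c v b γ),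
      if_pos (Finset.mem_range.mpr hn)]

theorem mul {n p : ℕ} (h : Represents T slot K S (n + 1) A g) (hp : p < n)
    (hS : ∀ v ∈ bag T n, v ∈ S → v ∈ bag T p)
    (h1 : ∀ i < 2 ^ K, A' (p * 2 ^ K + i) = A (p * 2 ^ K + i) * A (n * 2 ^ K + i))
    (h2 : ∀ n' ≠ p, ∀ i < 2 ^ K, A' (n' * 2 ^ K + i) = A (n' * 2 ^ K + i)) :
    ∃ g', Represents T slot K S n A' g' ∧ ∀ γ, ∏ n ∈ Finset.range n, g' n γ =
      ∏ n ∈ Finset.range (n + 1), g n γ := by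
  refine ⟨fun n' γ => g n' γ * if n' = p then g n γ else 1, ⟨?_, ?_⟩, ?_⟩
  · intro n' hn' γ γ' hγ
    rw [h.depends n' (by omega) γ γ' hγ]
    split_ifs with hnn
    · subst hnn
      rw [h.depends n (by omega) γ γ' fun v hv hvS => hγ v (hS v hv hvS) hvS]
    · rfl
  · intro n' hn' i hi γ hγ
    split_ifs with hnn
    · subst hnn
      rw [h1 i hi, h.value n' (by omega) i hi γ hγ,
        h.value n (by omega) i hi γ fun v hv hvS => hγ v (hS v hv hvS) hvS]
    · rw [h2 n' hnn i hi, h.value n' (by omega) i hi γ hγ, mul_one]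
  · intro γ
    rw [Finset.prod_mul_distrib, Finset.prod_ite_eq' _ _ (fun _ => g n γ),
      if_pos (Finset.mem_range.mpr hp), Finset.prod_range_succ]

theorem forget {n : ℕ} (h : Represents T slot K S (n + 1) A g) {v : ℕ ⊕ ℕ} (hv : v ∈ bag T n)
    (hvS : v ∈ S) (hfirst : ∀ n' < n, v ∉ bag T n') (hinj : Set.InjOn slot {v | v ∈ bag T n})
    (hs : slot v < K)
    (h1 : ∀ i < 2 ^ K, bit (slot v) i = 0 →
      A' (n * 2 ^ K + i) = A (n * 2 ^ K + i) + vertexSign v * A (n * 2 ^ K + (i + 2 ^ slot v)) ∧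
      A' (n * 2 ^ K + (i + 2 ^ slot v)) =
        A (n * 2 ^ K + i) + vertexSign v * A (n * 2 ^ K + (i + 2 ^ slot v)))
    (h2 : ∀ n' ≠ n, ∀ i < 2 ^ K, A' (n' * 2 ^ K + i) = A (n' * 2 ^ K + i)) :
    ∃ g', Represents T slot K (S.erase v) (n + 1) A' g' ∧
      ∑ γ ∈ (S.erase v).powerset, sign γ * ∏ n ∈ Finset.range (n + 1), g' n γ =
      ∑ γ ∈ S.powerset, sign γ * ∏ n ∈ Finset.range (n + 1), g n γ := by
  have hlow : ∀ i < 2 ^ K, bit (slot v) i = 0 → ∀ γ,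
      (∀ u ∈ bag T n, u ∈ S.erase v → (u ∈ γ ↔ bit (slot u) i = 1)) →
      A (n * 2 ^ K + i) = g n (γ.erase v) ∧ A (n * 2 ^ K + (i + 2 ^ slot v)) = g n (insert v γ) := by
    intro i hi hb γ hγ
    constructor
    · refine h.value n (by omega) i hi _ fun u hu huS => ?_
      by_cases huv : u = v
      · subst huv; simp [hb]
      · rw [← hγ u hu (Finset.mem_erase.mpr ⟨huv, huS⟩)]
        simp [huv]
    · refine h.value n (by omega) _ (add_two_pow_lt hb hs hi) _ fun u hu huS => ?_
      by_cases huv : u = v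
      · subst huv; simp [bit_add_two_pow_self hb]
      · rw [bit_add_two_pow_of_ne hb fun hc => huv (hinj hu hv hc),
          ← hγ u hu (Finset.mem_erase.mpr ⟨huv, huS⟩)]
        simp [huv]
  refine ⟨fun n' γ => if n' = n then g n (γ.erase v) + vertexSign v * g n (insert v γ)
    else g n' γ, ⟨?_, ?_⟩, ?_⟩
  · intro n' hn' γ γ' hγ
    split_ifs with hnn
    · subst hnn
      rw [h.depends n' hn' (γ.erase v) (γ'.erase v), h.depends n' hn' (insert v γ) (insert v γ')]
      · intro u hu huS
        by_cases huv : u = v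
        · simp [huv]
        · simp [huv, hγ u hu (Finset.mem_erase.mpr ⟨huv, huS⟩)]
      · intro u hu huS
        by_cases huv : u = v
        · simp [huv]
        · simp [huv, hγ u hu (Finset.mem_erase.mpr ⟨huv, huS⟩)]
    · refine h.depends n' hn' γ γ' fun u hu huS => hγ u hu (Finset.mem_erase.mpr ⟨?_, huS⟩)
      rintro rfl
      exact hfirst n' (by omega) hu
  · intro n' hn' i hi γ hγ
    split_ifs with hnn
    · subst hnn
      rcases bit_eq_zero_or_one (slot v) i with hb | hb
      · obtain ⟨e1, e2⟩ := hlow i hi hb γ hγ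
        rw [(h1 i hi hb).1, e1, e2]
      · obtain ⟨j, hj, rfl⟩ := exists_add_two_pow hb
        have hj' : j < 2 ^ K := (Nat.le_add_right _ _).trans_lt hi
        obtain ⟨e1, e2⟩ := hlow j hj' hj γ (fun u hu huS => by
          rw [hγ u hu huS, bit_add_two_pow_of_ne hj]
          exact fun hc => (Finset.mem_erase.mp huS).1 (hinj hu hv hc))
        rw [(h1 j hj' hj).2, e1, e2]
    · rw [h2 n' hnn i hi]
      refine h.value n' hn' i hi γ fun u hu huS => hγ u hu (Finset.mem_erase.mpr ⟨?_, huS⟩)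
      rintro rfl
      exact hfirst n' (by omega) hu
  · conv_rhs => rw [← Finset.insert_erase hvS]
    rw [Finset.sum_powerset_insert (Finset.notMem_erase v S), ← Finset.sum_add_distrib]
    refine Finset.sum_congr rfl fun γ hγ => ?_
    have hvγ : v ∉ γ := fun hc => Finset.notMem_erase v S (Finset.mem_powerset.mp hγ hc)
    have e1 : sign (insert v γ) = vertexSign v * sign γ := Finset.prod_insert hvγ
    have e2 : ∏ n' ∈ Finset.range n, g n' (insert v γ) = ∏ n' ∈ Finset.range n, g n' γ := by
      refine Finset.prod_congr rfl fun n' hn' => ?_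
      have hn' := Finset.mem_range.mp hn'
      refine h.depends n' (by omega) _ _ fun u hu _ => ?_
      have : u ≠ v := by rintro rfl; exact hfirst n' hn' hu
      simp [this]
    have e3 : ∏ n' ∈ Finset.range n, (if n' = n then g n (γ.erase v) +
        vertexSign v * g n (insert v γ) else g n' γ) = ∏ n' ∈ Finset.range n, g n' γ :=
      Finset.prod_congr rfl fun n' hn' => if_neg (Finset.mem_range.mp hn').ne
    rw [Finset.prod_range_succ, Finset.prod_range_succ, Finset.prod_range_succ, e1, e2, e3]
    beta_reduce
    rw [if_pos rfl, Finset.erase_eq_of_notMem hvγ]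
    ring

end Represents

end SharpSat
namespace SharpSat
open RamProg

/-! ### Operations on tables -/

theorem update_range {A A₀ F : ℕ → ℤ} {b n : ℕ}
    (h1 : ∀ a, a < b ∨ b + n ≤ a → A a = A₀ a) (h2 : ∀ i < n, A (b + i) = F i) {z : ℤ}
    (hz : z = F n) :
    (∀ a, a < b ∨ b + (n + 1) ≤ a → Function.update A (b + n) z a = A₀ a) ∧
      ∀ i ≤ n, Function.update A (b + n) z (b + i) = F i := by
  refine ⟨fun a ha => ?_, fun i hi => ?_⟩
  · rw [Function.update_of_ne (by omega), h1 a (by omega)]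
  · rcases hi.lt_or_eq with h | rfl
    · rw [Function.update_of_ne (by omega), h2 i h]
    · rw [Function.update_self, hz]

theorem runs_clearEntries {σ : RamState} {P b sc sv y : ℕ} {f f' : ℕ → ℕ} (h1 : σ.reg 1 = 1)
    (h5 : σ.reg 5 = P) (h27 : σ.reg 27 = b) (h26 : σ.reg 26 = sc) (h19 : σ.reg 19 = sv)
    (h15 : σ.reg 15 = y) (hn : σ.num 2 = 0) (hc : ∀ i < P, σ.arr 4 (sc + i) = f i)
    (hv : ∀ i < P, σ.arr 4 (sv + i) = f' i) (hf : ∀ i, f i ≤ 1) :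
    Runs clearEntries σ fun t τ => t ≤ 2 + 15 * P ∧
      (∀ a, a < b ∨ b + P ≤ a → τ.numArr 0 a = σ.numArr 0 a) ∧
      ∀ i < P, τ.numArr 0 (b + i) = if f i = 1 ∧ f' i = y then 0 else σ.numArr 0 (b + i) := by
  simp only [clearEntries, block]
  refine (Runs.forLoop_const (fun n τ =>
    (∀ a, a < b ∨ b + n ≤ a → τ.numArr 0 a = σ.numArr 0 a) ∧
      ∀ i < n, τ.numArr 0 (b + i) = if f i = 1 ∧ f' i = y then 0 else σ.numArr 0 (b + i)) 13 h1
    (by decide) (by decide) (by decide) (by simp) ?_).mono ?_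
  · rintro n τ hn' ⟨i1, i2⟩ hF h20
    have g4 := hF.arr 4 (by decide)
    have g15 := hF.reg 15 (by decide)
    have g19 := hF.reg 19 (by decide)
    have g26 := hF.reg 26 (by decide)
    have g27 := hF.reg 27 (by decide)
    have gn := hF.num 2 (by decide)
    rw [h5] at hn'
    have c1 := hc n hn'
    have c2 := hv n hn'
    have c3 := hf n
    simp [g4, g15, g19, g26, g27, gn, h15, h19, h26, h27, hn, h20, c1, c2]
    constructor
    · intro hlt
      exact update_range i1 i2 (by rw [if_pos (by omega)])
    · intro hle
      refine ⟨fun a ha => i1 a (by omega), fun i hi => ?_⟩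
      rcases hi.lt_or_eq with h | rfl
      · exact i2 i h
      · rw [i1 _ (by omega), if_neg (by omega)]
  · intro t τ hI hF
    rw [h5] at hI
    exact ⟨by omega, hI.2⟩

theorem runs_mulInto {σ : RamState} {P b b' : ℕ} (h1 : σ.reg 1 = 1)
    (h5 : σ.reg 5 = P) (h27 : σ.reg 27 = b) (h29 : σ.reg 29 = b') (hb : b' + P ≤ b) :
    Runs mulInto σ fun t τ => t ≤ 2 + 9 * P ∧
      (∀ a, a < b' ∨ b' + P ≤ a → τ.numArr 0 a = σ.numArr 0 a) ∧
      ∀ i < P, τ.numArr 0 (b' + i) = σ.numArr 0 (b' + i) * σ.numArr 0 (b + i) := by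
  simp only [mulInto, block]
  refine (Runs.forLoop_const (fun n τ =>
    (∀ a, a < b' ∨ b' + n ≤ a → τ.numArr 0 a = σ.numArr 0 a) ∧
      ∀ i < n, τ.numArr 0 (b' + i) = σ.numArr 0 (b' + i) * σ.numArr 0 (b + i)) 7 h1
    (by decide) (by decide) (by decide) (by simp) ?_).mono ?_
  · rintro n τ hn' ⟨i1, i2⟩ hF h20
    have g27 := hF.reg 27 (by decide)
    have g29 := hF.reg 29 (by decide)
    rw [h5] at hn'
    simp [g27, g29, h27, h29, h20]
    rw [i1 (b + n) (by omega), i1 (b' + n) (by omega)]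
    exact update_range i1 i2 (by ring)
  · intro t τ hI hF
    rw [h5] at hI
    exact ⟨by omega, hI.2⟩

theorem runs_forget {σ : RamState} {K b sv s : ℕ} {v : ℕ ⊕ ℕ} (h0 : σ.reg 0 = 0)
    (h1 : σ.reg 1 = 1) (h5 : σ.reg 5 = 2 ^ K) (h27 : σ.reg 27 = b) (h19 : σ.reg 19 = sv)
    (h28 : σ.reg 28 = 2 ^ s) (h15 : σ.reg 15 = kind v) (hs : s < K)
    (hv : ∀ i < 2 ^ K, σ.arr 4 (sv + i) = bit s i) :
    Runs forget σ fun t τ => t ≤ 2 + 16 * 2 ^ K ∧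
      (∀ a, a < b ∨ b + 2 ^ K ≤ a → τ.numArr 0 a = σ.numArr 0 a) ∧
      ∀ i < 2 ^ K, bit s i = 0 →
        τ.numArr 0 (b + i) =
          σ.numArr 0 (b + i) + vertexSign v * σ.numArr 0 (b + (i + 2 ^ s)) ∧
        τ.numArr 0 (b + (i + 2 ^ s)) =
          σ.numArr 0 (b + i) + vertexSign v * σ.numArr 0 (b + (i + 2 ^ s)) := by
  simp only [forget, block]
  refine (Runs.forLoop_const (fun n τ =>
    (∀ a, a < b ∨ b + 2 ^ K ≤ a → τ.numArr 0 a = σ.numArr 0 a) ∧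
    (∀ i < 2 ^ K, bit s i = 0 → n ≤ i → τ.numArr 0 (b + i) = σ.numArr 0 (b + i) ∧
      τ.numArr 0 (b + (i + 2 ^ s)) = σ.numArr 0 (b + (i + 2 ^ s))) ∧
    ∀ i < n, bit s i = 0 →
        τ.numArr 0 (b + i) =
          σ.numArr 0 (b + i) + vertexSign v * σ.numArr 0 (b + (i + 2 ^ s)) ∧
        τ.numArr 0 (b + (i + 2 ^ s)) =
          σ.numArr 0 (b + i) + vertexSign v * σ.numArr 0 (b + (i + 2 ^ s))) 14 h1
    (by decide) (by decide) (by decide) (by simp) ?_).mono ?_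
  · rintro n τ hn' ⟨i1, i2, i3⟩ hF h20
    have g0 := hF.reg 0 (by decide)
    have g4 := hF.arr 4 (by decide)
    have g15 := hF.reg 15 (by decide)
    have g19 := hF.reg 19 (by decide)
    have g27 := hF.reg 27 (by decide)
    have g28 := hF.reg 28 (by decide)
    rw [h5] at hn'
    have c1 := hv n hn'
    rcases bit_eq_zero_or_one s n with hb | hb
    · have key : ∀ z : ℤ, z = σ.numArr 0 (b + n) + vertexSign v * σ.numArr 0 (b + (n + 2 ^ s)) →
          (∀ a, a < b ∨ b + 2 ^ K ≤ a → Function.update (Function.update (τ.numArr 0) (b + n) z)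
            (b + (n + 2 ^ s)) z a = σ.numArr 0 a) ∧
          (∀ i < 2 ^ K, bit s i = 0 → n + 1 ≤ i →
            Function.update (Function.update (τ.numArr 0) (b + n) z) (b + (n + 2 ^ s)) z (b + i) =
              σ.numArr 0 (b + i) ∧
            Function.update (Function.update (τ.numArr 0) (b + n) z) (b + (n + 2 ^ s)) z
              (b + (i + 2 ^ s)) = σ.numArr 0 (b + (i + 2 ^ s))) ∧
          ∀ i ≤ n, bit s i = 0 →
            Function.update (Function.update (τ.numArr 0) (b + n) z) (b + (n + 2 ^ s)) z (b + i) =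
              σ.numArr 0 (b + i) + vertexSign v * σ.numArr 0 (b + (i + 2 ^ s)) ∧
            Function.update (Function.update (τ.numArr 0) (b + n) z) (b + (n + 2 ^ s)) z
              (b + (i + 2 ^ s)) =
              σ.numArr 0 (b + i) + vertexSign v * σ.numArr 0 (b + (i + 2 ^ s)) := by
        intro z hz
        have hlt := add_two_pow_lt hb hs hn'
        have hne : ∀ i, bit s i = 0 → i ≠ n + 2 ^ s ∧ n ≠ i + 2 ^ s := by
          intro i hi
          constructor
          · rintro rfl
            rw [bit_add_two_pow_self hb] at hi
            omega
          · rintro rfl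
            rw [bit_add_two_pow_self hi] at hb
            omega
        have hpos := Nat.two_pow_pos s
        refine ⟨fun a ha => ?_, fun i hi hbi hni => ?_, fun i hi hbi => ?_⟩
        · rw [Function.update_of_ne (by omega), Function.update_of_ne (by omega), i1 a ha]
        · have := hne i hbi
          rw [Function.update_of_ne (by omega), Function.update_of_ne (by omega),
            Function.update_of_ne (by omega), Function.update_of_ne (by omega)]
          exact i2 i hi hbi (by omega)
        · have := hne i hbi
          rcases hi.lt_or_eq with h | rfl
          · rw [Function.update_of_ne (by omega), Function.update_of_ne (by omega),
              Function.update_of_ne (by omega), Function.update_of_ne (by omega)]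
            exact i3 i h hbi
          · rw [Function.update_of_ne (by omega), Function.update_self, Function.update_self]
            exact ⟨hz, hz⟩
      obtain ⟨e1, e2⟩ := i2 n hn' hb le_rfl
      simp [g0, g4, g15, g19, g27, g28, h0, h15, h19, h27, h28, h20, c1, hb, add_assoc, e1, e2]
      rcases v with v | v
      · simp only [kind, Sum.elim_inl, lt_self_iff_false, IsEmpty.forall_iff, true_and]
        exact fun _ => key _ (by simp [vertexSign])
      · simp only [kind, Sum.elim_inr]
        simp
        exact key _ (by simp [vertexSign]; ring)
    · simp [g0, g4, g19, h0, h19, h20, c1, hb]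
      refine ⟨i1, fun i hi hbi hni => i2 i hi hbi (by omega), fun i hi hbi => i3 i ?_ hbi⟩
      rcases hi.lt_or_eq with h | rfl
      · exact h
      · omega
  · intro t τ hI hF
    rw [h5] at hI
    exact ⟨by omega, hI.2.1, hI.2.2.2⟩

/-! ### Memory layout after the preparations -/

/-- The state after the preparations. -/
structure Layout (L : List (List Literal)) (T : TreeCode) (slot : ℕ ⊕ ℕ → ℕ) (K : ℕ)
    (σ : RamState) : Prop where
  r0 : σ.reg 0 = 0
  r1 : σ.reg 1 = 1
  r2 : σ.reg 2 = L.length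
  r3 : σ.reg 3 = T.length
  r5 : σ.reg 5 = 2 ^ K
  a0 : σ.arr 0 = input L T
  a1 : ∀ i < T.length, σ.arr 1 i = nodePos L T i
  a2 : ∀ s < K, σ.arr 2 s = 2 ^ s
  a3 : ∀ s < K, σ.arr 3 s = s * 2 ^ K
  a4 : ∀ s < K, ∀ i < 2 ^ K, σ.arr 4 (s * 2 ^ K + i) = bit s i
  a5 : ∀ i < T.length, σ.arr 5 i = i * 2 ^ K
  a6 : ∀ v ∈ names L, σ.arr 6 (vid v) = first T v + 1
  a7 : ∀ v ∈ names L, σ.arr 7 (vid v) = slot v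
  n2 : σ.num 2 = 0
  slot_lt : ∀ v ∈ names L, slot v < K
  inj : ∀ i < T.length, Set.InjOn slot {v | v ∈ bag T i}

namespace Layout

variable {L : List (List Literal)} {T : TreeCode} {slot : ℕ ⊕ ℕ → ℕ} {K : ℕ} {σ τ : RamState}

theorem of_eq (h : Layout L T slot K σ) (h0 : τ.reg 0 = σ.reg 0) (h1 : τ.reg 1 = σ.reg 1)
    (h2 : τ.reg 2 = σ.reg 2) (h3 : τ.reg 3 = σ.reg 3) (h5 : τ.reg 5 = σ.reg 5)
    (ha : τ.arr = σ.arr) (hn : τ.num 2 = σ.num 2) : Layout L T slot K τ := by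
  obtain ⟨b0, b1, b2, b3, b5, c0, c1, c2, c3, c4, c5, c6, c7, d2, e1, e2⟩ := h
  constructor <;> first
    | assumption
    | (simp only [h0, h1, h2, h3, h5, ha, hn]; assumption)

theorem setReg (h : Layout L T slot K σ) {r n : ℕ} (hr : 6 ≤ r) :
    Layout L T slot K (σ.setReg r n) := by
  apply h.of_eq <;> (try rw [RamState.reg_setReg, if_neg (by omega)]) <;> rfl

theorem frame (h : Layout L T slot K σ) {p : RamProg} (hF : Frame p σ τ)
    (hr : p.writesReg 0 = false ∧ p.writesReg 1 = false ∧ p.writesReg 2 = false ∧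
      p.writesReg 3 = false ∧ p.writesReg 5 = false ∧ p.writesNum 2 = false)
    (ha : ∀ a, p.writesArr a = false) : Layout L T slot K τ :=
  h.of_eq (hF.reg _ hr.1) (hF.reg _ hr.2.1) (hF.reg _ hr.2.2.1) (hF.reg _ hr.2.2.2.1)
    (hF.reg _ hr.2.2.2.2.1) (funext fun a => hF.arr a (ha a)) (hF.num _ hr.2.2.2.2.2)

end Layout

theorem table_disjoint {n n' i P : ℕ} (h : n' ≠ n) (hi : i < P) :
    n' * P + i < n * P ∨ n * P + P ≤ n' * P + i := by
  rcases Nat.lt_or_gt_of_ne h with h | h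
  · have := Nat.mul_le_mul_right P (Nat.succ_le_of_lt h)
    rw [Nat.succ_mul] at this
    omega
  · have := Nat.mul_le_mul_right P (Nat.succ_le_of_lt h)
    rw [Nat.succ_mul] at this
    omega

/-! ### The literals -/

/-- The product of all tables is the function `W`. -/
def HasWeight (L : List (List Literal)) (T : TreeCode) (slot : ℕ ⊕ ℕ → ℕ) (K : ℕ) (σ : RamState)
    (W : Finset (ℕ ⊕ ℕ) → ℤ) : Prop :=
  ∃ g, Represents T slot K (names L).toFinset T.length (σ.numArr 0) g ∧
    ∀ γ, ∏ n ∈ Finset.range T.length, g n γ = W γ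

variable {L : List (List Literal)} {T : TreeCode} {slot : ℕ ⊕ ℕ → ℕ} {K : ℕ} {σ : RamState}

theorem getD_mem {α : Type} (l : List α) (d : α) {e : ℕ} (he : e < l.length) : l.getD e d ∈ l := by
  rw [List.getD_eq_getElem _ _ he]; exact List.getElem_mem he

theorem runs_clauseLiterals (hT : ValidCode L T) (h : Layout L T slot K σ) {j : ℕ}
    (hj : j < L.length) (h6 : σ.reg 6 = clausePos L j + 1)
    (h14 : σ.reg 14 = (L.getD j []).length) (h25 : σ.reg 25 = first T (.inr j) + 1)
    (h26 : σ.reg 26 = slot (.inr j) * 2 ^ K) {W : Finset (ℕ ⊕ ℕ) → ℤ}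
    (hW : HasWeight L T slot K σ W) :
    Runs clauseLiterals σ fun t τ => t ≤ 2 + (L.getD j []).length * (18 + 15 * 2 ^ K) ∧
      τ.reg 6 = clausePos L (j + 1) ∧
      HasWeight L T slot K τ fun γ => W γ * clauseWeight L j (L.getD j []).length γ := by
  simp only [clauseLiterals, block]
  refine (Runs.forLoop_const (fun e τ => τ.reg 6 = clausePos L j + 1 + 2 * e ∧
      HasWeight L T slot K τ fun γ => W γ * clauseWeight L j e γ) (16 + 15 * 2 ^ K) h.r1
    (by decide) (by decide) (by decide) ?_ ?_).mono ?_
  · simp [h6, clauseWeight]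
    exact hW
  · rintro e τ he ⟨i1, g, i2, i3⟩ hF -
    have hl := h.frame hF (by decide) (fun _ => rfl)
    have g25 := hF.reg 25 (by decide)
    have g26 := hF.reg 26 (by decide)
    rw [h14] at he
    rw [h25] at g25
    rw [h26] at g26
    obtain ⟨b1, b2⟩ := input_literal L T j e hj he
    have hmem := getD_mem _ (0, true) he
    have hw : ∀ γ, clauseWeight L j (e + 1) γ = clauseWeight L j e γ *
      litFactor (.inr j) (.inl ((L.getD j []).getD e (0, true)).1)
        ((L.getD j []).getD e (0, true)).2 γ := fun γ => Finset.prod_range_succ _ _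
    simp only [hw]
    generalize (L.getD j []).getD e (0, true) = l at *
    obtain ⟨x, y⟩ := l
    have hx : Sum.inl x ∈ names L := mem_names.mpr (.inl ⟨j, hj, _, hmem, rfl⟩)
    have hc : Sum.inr j ∈ names L := mem_names.mpr (.inr ⟨j, hj, rfl⟩)
    have f1 : τ.arr 6 (x + x) = first T (.inl x) + 1 := by
      rw [← hl.a6 _ hx]; congr 1; simp [vid]; omega
    have f2 : τ.arr 7 (x + x) = slot (.inl x) := by
      rw [← hl.a7 _ hx]; congr 1; simp [vid]; omega
    simp [hl.r1, hl.a0, i1, b1, b2, f1, f2, hl.a3 _ (hl.slot_lt _ hx), g25]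
    obtain ⟨i₀, hi₀, m1, m2⟩ := hT.edge j hj _ hmem
    obtain ⟨m3, m4⟩ := hT.mem_bag_max i₀ m1 m2
    have key : ∀ υ : RamState, Layout L T slot K υ → υ.numArr 0 = τ.numArr 0 →
        υ.reg 26 = slot (.inr j) * 2 ^ K → υ.reg 19 = slot (.inl x) * 2 ^ K →
        υ.reg 15 = y.toNat → υ.reg 6 = clausePos L j + 1 + 2 * e + 1 + 1 →
        υ.reg 27 = max (first T (.inl x)) (first T (.inr j)) * 2 ^ K →
        Runs clearEntries υ fun t χ => t ≤ 2 + 15 * 2 ^ K ∧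
          χ.reg 6 = clausePos L j + 1 + 2 * (e + 1) ∧ HasWeight L T slot K (χ.setReg 11 (e + 1))
            fun γ => W γ * (clauseWeight L j e γ * litFactor (.inr j) (.inl x) y γ) := by
      intro υ hυ p1 p2 p3 p4 p5 p6
      refine (runs_clearEntries hυ.r1 hυ.r5 p6 p2 p3 p4 hυ.n2 (hυ.a4 _ (hυ.slot_lt _ hc))
        (hυ.a4 _ (hυ.slot_lt _ hx)) fun i => ?_).mono ?_
      · rcases bit_eq_zero_or_one (slot (.inr j)) i with h | h <;> omega
      · rintro t χ ⟨q1, q2, q3⟩ hG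
        refine ⟨q1, by rw [hG.reg 6 (by decide), p5]; omega, ?_⟩
        rw [p1] at q2 q3
        obtain ⟨g', r1, r2⟩ := i2.clear (lt_length_of_mem_bag m3) m4 m3
          (List.mem_toFinset.mpr hc) (List.mem_toFinset.mpr hx) q3
          fun n' hn' i hi => q2 _ (table_disjoint hn' hi)
        exact ⟨g', r1, fun γ => by rw [r2, i3, mul_assoc]⟩
    constructor
    · intro hlt
      refine (key _ ?_ (by simp) (by simpa using g26) (by simp) (by simp) (by simp) ?_).mono ?_
      · repeat refine Layout.setReg ?_ (by decide)
        exact hl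
      · have : first T (.inr j) < T.length := (first_le m2).trans_lt hi₀
        simp [hl.a5 _ this]
        omega
      · rintro t χ ⟨q1, q2, q3⟩ _
        exact ⟨by omega, q2, q3⟩
    · intro hle
      refine (key _ ?_ (by simp) (by simpa using g26) (by simp) (by simp) (by simp) ?_).mono ?_
      · repeat refine Layout.setReg ?_ (by decide)
        exact hl
      · have : first T (.inl x) < T.length := (first_le m1).trans_lt hi₀
        simp [hl.a5 _ this]
        omega
      · rintro t χ ⟨q1, q2, q3⟩ _
        exact ⟨by omega, q2, q3⟩
  · rintro t τ ⟨hI1, hI2, hI3⟩ hF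
    rw [h14] at hI1 hI2 hI3
    exact ⟨by refine hI1.trans (by ring_nf; omega), by rw [hI2, clausePos_succ]; omega, hI3⟩

end SharpSat
namespace SharpSat
open RamProg

variable {L : List (List Literal)} {T : TreeCode} {slot : ℕ ⊕ ℕ → ℕ} {K : ℕ} {σ : RamState}

theorem runs_literals (hT : ValidCode L T) (h : Layout L T slot K σ)
    (hW : HasWeight L T slot K σ fun _ => 1) :
    Runs literals σ fun t τ =>
      t ≤ 5 + ∑ j ∈ Finset.range L.length, (14 + (L.getD j []).length * (18 + 15 * 2 ^ K)) ∧
      HasWeight L T slot K τ (weight L L.length) := by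
  simp [literals, block]
  refine (Runs.forLoop (fun j τ => τ.reg 6 = clausePos L j ∧ τ.reg 24 = 2 * j + 1 ∧
    HasWeight L T slot K τ (weight L j))
    (fun j => 12 + (L.getD j []).length * (18 + 15 * 2 ^ K)) (by simp [h.r1])
    (by decide) (by decide) (by decide) ?_ ?_).mono ?_
  · simp [clausePos]
    have : weight L 0 = fun _ => 1 := by funext γ; simp [weight]
    rw [this]
    exact hW
  · rintro j τ hj ⟨i1, i2, i3⟩ hF -
    have hl : Layout L T slot K τ :=
      Layout.frame (Layout.setReg (Layout.setReg h (by decide)) (by decide)) hF (by decide)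
        (fun _ => rfl)
    simp [h.r2] at hj
    have b1 := input_clause_length L T j hj
    have hc : Sum.inr j ∈ names L := mem_names.mpr (.inr ⟨j, hj, rfl⟩)
    have f1 : τ.arr 6 (2 * j + 1) = first T (.inr j) + 1 := hl.a6 _ hc
    have f2 : τ.arr 7 (2 * j + 1) = slot (.inr j) := hl.a7 _ hc
    simp only [Runs.load, Runs.add, Runs.skip, Runs.seq]
    simp [i1, i2, hl.a0, hl.r1, b1, f1, f2, hl.a3 _ (hl.slot_lt _ hc)]
    refine (runs_clauseLiterals (slot := slot) (K := K) hT ?_ hj (by simp) (by simp) (by simp) (by simp)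
      (by exact i3)).mono ?_
    · repeat refine Layout.setReg ?_ (by decide)
      exact hl
    · rintro t υ ⟨j1, j2, j3⟩ hG
      have k1 := hG.reg 1 (by decide)
      have k24 := hG.reg 24 (by decide)
      simp [hl.r1, i2] at k1 k24
      simp [k1, k24, j2]
      refine ⟨by simp at j1; omega, by ring, ?_⟩
      have : weight L (j + 1) = fun γ =>
          weight L j γ * clauseWeight L j (L.getD j []).length γ := by
        funext γ; exact Finset.prod_range_succ _ _
      rw [this]
      exact j3
  · rintro t τ ⟨hI1, -, -, hI2⟩ hF
    simp [h.r2, add_right_comm 12 _ 2] at hI1 hI2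
    exact ⟨by omega, hI2⟩

/-! ### Elimination -/

/-- The signed sum of the products of the first `M` tables over all subsets of `S` is `Z`. -/
def HasSum (T : TreeCode) (slot : ℕ ⊕ ℕ → ℕ) (K : ℕ) (Z : ℤ) (S : Finset (ℕ ⊕ ℕ)) (M : ℕ)
    (σ : RamState) : Prop :=
  ∃ g, Represents T slot K S M (σ.numArr 0) g ∧
    ∑ γ ∈ S.powerset, sign γ * ∏ n ∈ Finset.range M, g n γ = Z

/-- The vertices which remain when nodes after `i` and the first `e` vertices of the bag number
`i` have been processed. -/
def remaining (L : List (List Literal)) (T : TreeCode) (i e : ℕ) : Finset (ℕ ⊕ ℕ) :=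
  (names L).toFinset.filter fun v => first T v < i ∨ (first T v = i ∧ v ∉ (bag T i).take e)

theorem mem_remaining {i e : ℕ} {v : ℕ ⊕ ℕ} : v ∈ remaining L T i e ↔
    v ∈ names L ∧ (first T v < i ∨ (first T v = i ∧ v ∉ (bag T i).take e)) := by
  simp [remaining]

/-- The number of vertices which are eliminated at node `i`. -/
def newCount (T : TreeCode) (i : ℕ) : ℕ :=
  ((bag T i).toFinset.filter fun v => first T v = i).card

theorem sum_getD {α : Type} (l : List α) (d : α) (f : α → ℕ) :
    ∑ e ∈ Finset.range l.length, f (l.getD e d) = (l.map f).sum := by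
  induction l with
  | nil => simp
  | cons a l ih => simp [Finset.sum_range_succ', ← ih, add_comm]

theorem sum_newCount_le (hT : ValidCode L T) :
    ∑ i ∈ Finset.range T.length, newCount T i ≤ (names L).length := by
  have h : ∑ i ∈ Finset.range T.length, newCount T i = ((Finset.range T.length).biUnion
      fun i => (bag T i).toFinset.filter fun v => first T v = i).card := by
    refine (Finset.card_biUnion fun i _ j _ hij => ?_).symm
    rw [Function.onFun, Finset.disjoint_left]
    intro v hv hv'
    exact hij ((Finset.mem_filter.mp hv).2.symm.trans (Finset.mem_filter.mp hv').2)
  rw [h]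
  refine (Finset.card_le_card ?_).trans (List.toFinset_card_le _)
  intro v hv
  obtain ⟨i, hi, hv⟩ := Finset.mem_biUnion.mp hv
  exact List.mem_toFinset.mpr (hT.mem_names i (Finset.mem_range.mp hi) v
    (List.mem_toFinset.mp (Finset.mem_filter.mp hv).1))

theorem runs_forgetVertices (hT : ValidCode L T) (h : Layout L T slot K σ) {i : ℕ} {Z : ℤ}
    (hi : i < T.length) (h13 : σ.reg 13 = nodePos L T i + 2)
    (h14 : σ.reg 14 = (bag T i).length) (h27 : σ.reg 27 = i * 2 ^ K) (h31 : σ.reg 31 = i + 1)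
    (hZ : HasSum T slot K Z (remaining L T i 0) (i + 1) σ) :
    Runs forgetVertices σ fun t τ =>
      t ≤ 2 + 13 * (bag T i).length + newCount T i * (8 + 16 * 2 ^ K) ∧
      HasSum T slot K Z (remaining L T i (bag T i).length) (i + 1) τ := by
  simp only [forgetVertices, block]
  refine (Runs.forLoop (fun e τ => τ.reg 13 = nodePos L T i + 2 + 2 * e ∧
    HasSum T slot K Z (remaining L T i e) (i + 1) τ)
    (fun e => 11 + if first T ((bag T i).getD e (.inl 0)) = i then 8 + 16 * 2 ^ K else 0) h.r1
    (by decide) (by decide) (by decide) ?_ ?_).mono ?_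
  · exact ⟨h13, hZ⟩
  · rintro e τ he ⟨i1, g, i2, i3⟩ hF -
    have hl := h.frame hF (by decide) (fun _ => rfl)
    have g27 := hF.reg 27 (by decide)
    have g31 := hF.reg 31 (by decide)
    rw [h14] at he
    rw [h27] at g27
    rw [h31] at g31
    rw [Runs.seq, runs_readVertex hl.a0 hl.r1 i1 hi he]
    have hmem := getD_mem _ (.inl 0) he
    have htake := take_succ_getD (.inl 0) (bag T i) e he
    have hnotin : (bag T i).getD e (.inl 0) ∉ (bag T i).take e := by
      have := hT.nodup i hi
      rw [← List.take_append_drop (e + 1) (bag T i), htake, List.append_assoc,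
        List.nodup_append] at this
      intro hc
      exact this.2.2 _ hc _ (by simp) rfl
    generalize (bag T i).getD e (.inl 0) = v at *
    have hv := hT.mem_names i hi v hmem
    have hfi := first_le hmem
    simp [hl.a6 v hv, g31]
    constructor
    · intro hlt
      refine ⟨g, ?_⟩
      have : remaining L T i (e + 1) = remaining L T i e := by
        ext u
        rw [mem_remaining, mem_remaining, htake]
        by_cases hu : u = v
        · subst hu; simp [hlt]
        · simp [hu]
      rw [this]
      exact ⟨i2, i3⟩
    · intro hle
      have hfe : first T v = i := by omega
      have hs := hl.slot_lt v hv
      simp [hl.a7 v hv, hl.a2 _ hs, hl.a3 _ hs, hfe]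
      refine (runs_forget (K := K) (b := i * 2 ^ K) (sv := slot v * 2 ^ K) (s := slot v) (v := v)
        (by simp [hl.r0]) (by simp [hl.r1]) (by simp [hl.r5]) (by simpa using g27) (by simp)
        (by simp) (by simp) hs (by simpa using hl.a4 _ hs)).mono ?_
      rintro t υ ⟨j1, j2, j3⟩ hG
      refine ⟨by omega, hG.reg 13 (by decide), ?_⟩
      obtain ⟨g', r1, r2⟩ := i2.forget hmem (mem_remaining.mpr ⟨hv, .inr ⟨hfe, hnotin⟩⟩)
        (fun n' hn' => not_mem_of_lt_first (by omega)) (hl.inj i hi) hs j3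
        fun n' hn' i hi => j2 _ (table_disjoint hn' hi)
      have : remaining L T i (e + 1) = (remaining L T i e).erase v := by
        ext u
        rw [Finset.mem_erase, mem_remaining, mem_remaining, htake]
        by_cases hu : u = v
        · subst hu; simp [hfe]
        · simp [hu]
      rw [this]
      exact ⟨g', r1, r2.trans i3⟩
  · rintro t τ ⟨hI1, -, hI2⟩ hF
    rw [h14] at hI1 hI2
    refine ⟨hI1.trans ?_, hI2⟩
    have e1 : newCount T i * (8 + 16 * 2 ^ K) = ∑ e ∈ Finset.range (bag T i).length,
        if first T ((bag T i).getD e (.inl 0)) = i then 8 + 16 * 2 ^ K else 0 := by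
      rw [newCount, Finset.card_filter, Finset.sum_mul, List.sum_toFinset _ (hT.nodup i hi),
        sum_getD (bag T i) (.inl 0) fun v => if first T v = i then 8 + 16 * 2 ^ K else 0]
      simp only [ite_mul, one_mul, zero_mul]
    rw [e1, Finset.sum_add_distrib, Finset.sum_add_distrib]
    simp
    omega

theorem runs_eliminate (hT : ValidCode L T) (h : Layout L T slot K σ) {Z : ℤ}
    (hZ : HasSum T slot K Z (names L).toFinset T.length σ) :
    Runs eliminate σ fun t τ => t ≤ 2 + ∑ i ∈ Finset.range T.length,
        (20 + 13 * (bag T i).length + newCount T i * (8 + 16 * 2 ^ K) + 9 * 2 ^ K) ∧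
      τ.numArr 0 0 = Z := by
  simp only [eliminate, block]
  have hfirst : ∀ v ∈ names L, first T v < T.length := fun v hv => by
    obtain ⟨i, hi, hv⟩ := hT.cover v hv
    exact (first_le hv).trans_lt hi
  refine (Runs.forLoop (fun n τ => HasSum T slot K Z
      ((names L).toFinset.filter fun v => first T v < T.length - n) (max 1 (T.length - n)) τ)
    (fun n => (fun i => 18 + 13 * (bag T i).length + newCount T i * (8 + 16 * 2 ^ K) + 9 * 2 ^ K)
      (T.length - 1 - n)) h.r1 (by decide) (by decide) (by decide) ?_ ?_).mono ?_
  · have h1 : (names L).toFinset.filter (fun v => first T v < T.length - 0) =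
        (names L).toFinset :=
      Finset.filter_true_of_mem fun v hv => hfirst v (List.mem_toFinset.mp hv)
    have h2 : max 1 (T.length - 0) = T.length := by have := hT.pos; omega
    rw [h1, h2]
    exact hZ
  · rintro n τ hn hI hF h10
    have hl := h.frame hF (by decide) (fun _ => rfl)
    rw [h.r3] at hn
    obtain ⟨i, hi⟩ : ∃ i, i = T.length - 1 - n := ⟨_, rfl⟩
    have hiN : i < T.length := by omega
    have e1 : T.length - n - 1 = i := by omega
    have e2 : T.length - n = i + 1 := by omega
    have e3 : T.length - (n + 1) = i := by omega
    rw [← hi, e3]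
    rw [e2, max_eq_right (by omega)] at hI
    have b1 := input_bag_length L T i hiN
    have b2 := input_parent L T i hiN
    simp only [Runs.load, Runs.add, Runs.sub, Runs.skip, Runs.seq]
    simp [h10, hl.r3, hl.r1, e1, hl.a1 i hiN, hl.a5 i hiN, hl.a0, b1, b2]
    refine (runs_forgetVertices (slot := slot) (K := K) (Z := Z) hT ?_ hiN (by simp) (by simp)
      (by simp) (by simp) ?_).mono ?_
    · repeat refine Layout.setReg ?_ (by decide)
      exact hl
    · have : remaining L T i 0 = (names L).toFinset.filter fun v => first T v < i + 1 := by
        ext v; simp [remaining]; omega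
      rw [this]
      exact hI
    · have hrem : remaining L T i (bag T i).length =
          (names L).toFinset.filter fun v => first T v < i := by
        ext v
        simp only [remaining, List.take_length, Finset.mem_filter, List.mem_toFinset]
        refine and_congr_right fun hv => ⟨?_, .inl⟩
        rintro (h | ⟨rfl, h⟩)
        · exact h
        · obtain ⟨j, -, hj⟩ := hT.cover v hv
          exact absurd (mem_bag_first hj) h
      rintro t υ ⟨j1, j2⟩ hG
      have k0 := hG.reg 0 (by decide)
      have k1 := hG.reg 1 (by decide)
      have k5 := hG.reg 5 (by decide)
      have k27 := hG.reg 27 (by decide)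
      have k30 := hG.reg 30 (by decide)
      have k32 := hG.reg 32 (by decide)
      have ka := hG.arr 5 (by decide)
      simp [hl.r0, hl.r1, hl.r5] at k0 k1 k5 k27 k30 k32 ka
      rw [hrem] at j2
      simp [k0, k30, k32, ka]
      constructor
      · intro hpos
        have hpar := hT.parent_lt i hiN hpos
        have hple := Nat.mul_le_mul_right (2 ^ K) (Nat.succ_le_of_lt hpar)
        rw [Nat.succ_mul] at hple
        have ha := hl.a5 (parent T i) (by omega)
        refine (runs_mulInto (P := 2 ^ K) (b := i * 2 ^ K) (b' := parent T i * 2 ^ K)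
          (by simpa using k1) (by simpa using k5) (by simpa using k27) (by simp [ha])
          hple).mono ?_
        rintro u χ ⟨l1, l2, l3⟩ -
        refine ⟨by omega, ?_⟩
        obtain ⟨g, i2, i3⟩ := j2
        obtain ⟨g', r1, r2⟩ := i2.mul hpar (fun v hv hvS => by
            simp at hvS; exact hT.mem_parent hv hvS.2) l3
          fun n' hn' i hi => l2 _ (table_disjoint hn' hi)
        rw [max_eq_right (by omega)]
        exact ⟨g', r1, by simp only [r2]; exact i3⟩
      · rintro rfl
        exact ⟨by omega, j2⟩
  · rintro t τ ⟨hI1, g, hI2, hI3⟩ hF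
    rw [h.r3] at hI1 hI2 hI3
    rw [Finset.sum_add_distrib, Finset.sum_range_reflect
      (fun i => 18 + 13 * (bag T i).length + newCount T i * (8 + 16 * 2 ^ K) + 9 * 2 ^ K)] at hI1
    constructor
    · refine hI1.trans (le_of_eq ?_)
      rw [← Finset.sum_add_distrib]
      congr 1
      exact Finset.sum_congr rfl fun i _ => by ring
    · simp [sign] at hI3
      rw [← hI3, ← hI2.value 0 (by simp) 0 (by positivity) ∅ (by simp)]
      simp

end SharpSat
namespace SharpSat
open RamProg

variable {L : List (List Literal)} {T : TreeCode}

theorem sq_le_two_mul_two_pow (n : ℕ) : n * n ≤ 2 * 2 ^ n := by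
  induction n with
  | zero => simp
  | succ n ih =>
    rcases Nat.lt_or_ge n 3 with h | h
    · interval_cases n <;> simp
    · rw [pow_succ]; nlinarith

theorem length_names (L : List (List Literal)) :
    (names L).length = ∑ j ∈ Finset.range L.length, (1 + (L.getD j []).length) := by
  have h : (L.flatMap fun c => c.map fun l : Literal => (.inl l.1 : ℕ ⊕ ℕ)).length =
      ∑ j ∈ Finset.range L.length, (L.getD j []).length := by
    rw [sum_getD L [] List.length, List.length_flatMap]
    simp
  rw [names, List.length_append, h, Finset.sum_add_distrib]
  simp [add_comm]

theorem maxBag_le (hT : ValidCode L T) : maxBag T T.length ≤ (names L).length := by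
  refine Finset.sup_le fun i hi => ?_
  have hi := Finset.mem_range.mp hi
  rw [← List.toFinset_card_of_nodup (hT.nodup i hi)]
  refine (Finset.card_le_card fun v hv => ?_).trans (List.toFinset_card_le (names L))
  exact List.mem_toFinset.mpr (hT.mem_names i hi v (List.mem_toFinset.mp hv))

theorem total_cost {m N K P s a b : ℕ} (hK : K ≤ s) (hKP : K ≤ P) (hKK : K * K ≤ 2 * P)
    (hP : 1 ≤ P) (ha : a ≤ 5 + (18 + 15 * P) * s)
    (hb : b ≤ 2 + N * (20 + 13 * K + 9 * P) + s * (8 + 16 * P)) (hm : m ≤ s) :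
    (7 + 7 * m) + (6 + 11 * N) + (4 + 5 * K) + (4 + K * (8 + 11 * P)) + (5 + N * (6 + 5 * P)) +
      (2 + N * (16 + K * (35 + 6 * K))) + a + b + 10 ≤ 200 * P * (s + 1 + N) := by
  have h1 : K * P ≤ s * P := Nat.mul_le_mul_right _ hK
  have h2 : N * K ≤ N * P := Nat.mul_le_mul_left _ hKP
  have h3 : N * (K * K) ≤ N * (2 * P) := Nat.mul_le_mul_left _ hKK
  have h4 : s * 1 ≤ s * P := Nat.mul_le_mul_left _ hP
  have h5 : N * 1 ≤ N * P := Nat.mul_le_mul_left _ hP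
  ring_nf at *
  omega

theorem runs_prepare (hT : ValidCode L T) {σ : RamState} (hσ : σ = RamState.init
    (encodeFormula L ++ encodeTree T)) :
    Runs prepare σ fun t τ =>
      t ≤ (7 + 7 * L.length) + (6 + 11 * T.length) + (4 + 5 * maxBag T T.length) +
        (4 + maxBag T T.length * (8 + 11 * 2 ^ maxBag T T.length)) +
        (5 + T.length * (6 + 5 * 2 ^ maxBag T T.length)) +
        (2 + T.length * (16 + maxBag T T.length * (35 + 6 * maxBag T T.length))) + 1 ∧
      (∃ slot, Layout L T slot (maxBag T T.length) τ) ∧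
      ∀ a < T.length * 2 ^ maxBag T T.length, τ.numArr 0 a = 1 := by
  have hr : ∀ r, σ.reg r = 0 := by rw [hσ]; exact fun _ => rfl
  have ha0 : σ.arr 0 = input L T := by rw [hσ]; rfl
  have ha : ∀ a, a ≠ 0 → ∀ i, σ.arr a i = 0 := by
    rw [hσ]; exact fun a ha i => if_neg ha
  have hn : ∀ x, σ.num x = 0 := by rw [hσ]; exact fun _ => rfl
  simp only [prepare, block, Runs.seq, Runs.skip]
  refine (runs_skipFormula ha0 (hr 0)).mono ?_
  rintro t1 σ1 ⟨c1, u1, u2, u6⟩ f1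
  have v0 := (f1.reg 0 (by decide)).trans (hr 0)
  have va0 := (f1.arr 0 (by decide)).trans ha0
  refine (runs_readTree va0 u1 u6).mono ?_
  rintro t2 σ2 ⟨c2, w3, w4, wa1⟩ f2
  have w0 := (f2.reg 0 (by decide)).trans v0
  have w1 := (f2.reg 1 (by decide)).trans u1
  have w2 := (f2.reg 2 (by decide)).trans u2
  have wa0 := (f2.arr 0 (by decide)).trans va0
  refine (runs_powers w1).mono ?_
  rintro t3 σ3 ⟨c3, x5, xa2⟩ f3
  have x0 := (f3.reg 0 (by decide)).trans w0
  have x1 := (f3.reg 1 (by decide)).trans w1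
  have x2 := (f3.reg 2 (by decide)).trans w2
  have x3 := (f3.reg 3 (by decide)).trans w3
  have x4 := (f3.reg 4 (by decide)).trans w4
  have xa0 := (f3.arr 0 (by decide)).trans wa0
  have xa1 := f3.arr 1 (by decide)
  rw [w4] at c3 x5 xa2
  refine (runs_bits x1 x4 x5 xa2).mono ?_
  rintro t4 σ4 ⟨c4, ya3, ya4⟩ f4
  have y0 := (f4.reg 0 (by decide)).trans x0
  have y1 := (f4.reg 1 (by decide)).trans x1
  have y2 := (f4.reg 2 (by decide)).trans x2
  have y3 := (f4.reg 3 (by decide)).trans x3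
  have y4 := (f4.reg 4 (by decide)).trans x4
  have y5 := (f4.reg 5 (by decide)).trans x5
  have y0a := (f4.arr 0 (by decide)).trans xa0
  have y1a := (f4.arr 1 (by decide)).trans xa1
  have y2a := f4.arr 2 (by decide)
  refine (runs_tables y1 y5).mono ?_
  rintro t5 σ5 ⟨c5, za5, zn⟩ f5
  have z0 := (f5.reg 0 (by decide)).trans y0
  have z1 := (f5.reg 1 (by decide)).trans y1
  have z2 := (f5.reg 2 (by decide)).trans y2
  have z3 := (f5.reg 3 (by decide)).trans y3
  have z4 := (f5.reg 4 (by decide)).trans y4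
  have z5 := (f5.reg 5 (by decide)).trans y5
  have z0a := (f5.arr 0 (by decide)).trans y0a
  have z1a := (f5.arr 1 (by decide)).trans y1a
  have z2a := (f5.arr 2 (by decide)).trans y2a
  have z3a := f5.arr 3 (by decide)
  have z4a := f5.arr 4 (by decide)
  have zz : ∀ a, a = 6 ∨ a = 8 → ∀ i, σ5.arr a i = 0 := by
    intro a h i
    have e : σ5.arr a = σ.arr a := by
      rcases h with rfl | rfl <;>
      rw [f5.arr _ (by decide), f4.arr _ (by decide), f3.arr _ (by decide), f2.arr _ (by decide),
        f1.arr _ (by decide)]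
    rw [e]
    exact ha a (by omega) i
  rw [y3] at c5 za5 zn
  refine (runs_slots hT z0a z0 z1 z3 z4 (by rw [z1a]; exact wa1) (zz 6 (.inl rfl))
    (zz 8 (.inr rfl))).mono ?_
  rintro t6 σ6 ⟨c6, hS⟩ f6
  refine ⟨by omega, ⟨fun v => σ6.arr 7 (vid v), ?_⟩, ?_⟩
  · have hseen : ∀ v ∈ names L, Seen T T.length 0 v := fun v hv => seen_zero.mpr (hT.cover v hv)
    constructor
    · exact (f6.reg 0 (by decide)).trans z0
    · exact (f6.reg 1 (by decide)).trans z1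
    · exact (f6.reg 2 (by decide)).trans z2
    · exact (f6.reg 3 (by decide)).trans z3
    · exact (f6.reg 5 (by decide)).trans z5
    · exact (f6.arr 0 (by decide)).trans z0a
    · rw [f6.arr 1 (by decide), z1a]; exact wa1
    · rw [f6.arr 2 (by decide), z2a]; exact xa2
    · rw [f6.arr 3 (by decide), z3a]; exact ya3
    · rw [f6.arr 4 (by decide), z4a]; exact ya4
    · rw [f6.arr 5 (by decide)]; exact za5
    · exact fun v hv => hS.first v (hseen v hv)
    · exact fun v hv => rfl
    · rw [f6.num 2 (by decide), f5.num 2 (by decide), f4.num 2 (by decide), f3.num 2 (by decide),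
        f2.num 2 (by decide), f1.num 2 (by decide), hn]
    · exact fun v hv => hS.lt v (hseen v hv)
    · exact hS.inj
  · rw [f6.numArr 0 (by decide)]
    exact zn

theorem computesWithin_countModels (hT : ValidCode L T) :
    ComputesWithin countModels (encodeFormula L ++ encodeTree T) (signedCount L)
      (200 * 2 ^ maxBag T T.length * ((names L).length + 1 + T.length)) := by
  have key : Runs countModels (RamState.init (encodeFormula L ++ encodeTree T)) fun t τ =>
      t ≤ 200 * 2 ^ maxBag T T.length * ((names L).length + 1 + T.length) ∧
        τ.num 0 = signedCount L := by
    simp only [countModels, block, Runs.seq, Runs.skip]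
    refine (runs_prepare hT rfl).mono ?_
    rintro t1 σ1 ⟨c1, ⟨slot, hl⟩, hone⟩ -
    have hW : HasWeight L T slot (maxBag T T.length) σ1 fun _ => 1 := by
      refine ⟨fun _ _ => 1, ⟨fun _ _ _ _ _ => rfl, fun n hn i hi _ _ => hone _ ?_⟩, fun γ => by simp⟩
      have := Nat.mul_le_mul_right (2 ^ maxBag T T.length) (Nat.succ_le_of_lt hn)
      rw [Nat.succ_mul] at this
      omega
    refine (runs_literals hT hl hW).mono ?_
    rintro t2 σ2 ⟨c2, g, hg1, hg2⟩ f2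
    refine (runs_eliminate hT (hl.frame f2 (by decide) (fun _ => rfl)) (Z := signedCount L)
      ⟨g, hg1, by simp only [hg2]; rfl⟩).mono ?_
    rintro t3 σ3 ⟨c3, hZ⟩ f3
    have z0 : σ3.reg 0 = 0 := by rw [f3.reg 0 (by decide), f2.reg 0 (by decide), hl.r0]
    simp [z0, hZ]
    have hm : L.length ≤ (names L).length := by
      rw [names, List.length_append]
      simp
    have ha : t2 ≤ 5 + (18 + 15 * 2 ^ maxBag T T.length) * (names L).length := by
      refine c2.trans (Nat.add_le_add_left ?_ _)
      rw [length_names, Finset.mul_sum]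
      exact Finset.sum_le_sum fun j _ => by ring_nf; omega
    have hb : t3 ≤ 2 + T.length * (20 + 13 * maxBag T T.length + 9 * 2 ^ maxBag T T.length) +
        (names L).length * (8 + 16 * 2 ^ maxBag T T.length) := by
      refine c3.trans ?_
      rw [add_assoc]
      refine Nat.add_le_add_left ?_ _
      have h1 := Nat.mul_le_mul_right (8 + 16 * 2 ^ maxBag T T.length) (sum_newCount_le hT)
      have h2 : ∑ i ∈ Finset.range T.length, (20 + 13 * (bag T i).length +
          9 * 2 ^ maxBag T T.length) ≤
          T.length * (20 + 13 * maxBag T T.length + 9 * 2 ^ maxBag T T.length) := by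
        refine (Finset.sum_le_card_nsmul _ _
          (20 + 13 * maxBag T T.length + 9 * 2 ^ maxBag T T.length) fun i hi => ?_).trans_eq (by simp)
        have := length_bag_le_maxBag (Finset.mem_range.mp hi)
        omega
      rw [Finset.sum_mul] at h1
      refine le_trans (le_of_eq ?_) (Nat.add_le_add h2 h1)
      rw [← Finset.sum_add_distrib]
      exact Finset.sum_congr rfl fun i _ => by ring
    have := total_cost (maxBag_le hT) Nat.lt_two_pow_self.le (sq_le_two_mul_two_pow _)
      Nat.one_le_two_pow ha hb hm (m := L.length) (N := T.length)
    omega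
  obtain ⟨t, τ, h1, h2, h3⟩ := key
  exact ⟨t, τ, h1, h2, h3⟩

end SharpSat
namespace SharpSat

/-! ### Tree codes and tree decompositions -/

section

variable {L : List (List Literal)} {T : TreeCode} {φ : CNF}

theorem bag_eq_get (i : Fin T.length) : bag T i = (T.get i).2 := bag_of_lt i.2

theorem parent_eq_get (i : Fin T.length) : parent T i = (T.get i).1 := by
  simp [parent, List.getD_eq_getElem?_getD]

theorem IsListing.vertexName_clause (hL : IsListing L φ) {j : ℕ} (hj : j < L.length)
    (h : (L.getD j []).toFinset ∈ φ) :
    vertexName L (φ := φ) (.inr ⟨(L.getD j []).toFinset, h⟩) = .inr j := by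
  have hj' : j < (L.map List.toFinset).length := by simpa using hj
  have : (L.getD j []).toFinset = (L.map List.toFinset)[j] := by simp [hj]
  simp only [vertexName, this, hL.2.1.idxOf_getElem j hj']

theorem IsListing.mem_names_iff (hL : IsListing L φ) {v : ℕ ⊕ ℕ} :
    v ∈ names L ↔ ∃ u : IncVertex φ, vertexName L u = v := by
  constructor
  · intro hv
    rcases v with x | j
    · exact ⟨.inl ⟨x, hL.mem_vars.mpr hv⟩, rfl⟩
    · obtain h | ⟨j', hj, h⟩ := mem_names.mp hv
      · simp at h
      · cases h
        have hm : (L.getD j []).toFinset ∈ φ := hL.mem_iff.mpr ⟨j, hj, rfl⟩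
        exact ⟨.inr ⟨_, hm⟩, hL.vertexName_clause hj hm⟩
  · rintro ⟨x | ⟨c, hc⟩, rfl⟩
    · exact hL.mem_vars.mp x.2
    · obtain ⟨j, hj, rfl⟩ := hL.mem_iff.mp hc
      rw [hL.vertexName_clause hj hc]
      exact mem_names.mpr (.inr ⟨j, hj, rfl⟩)

theorem IsListing.vertexName_injective (hL : IsListing L φ) :
    Function.Injective (vertexName L (φ := φ)) := by
  rintro (x | ⟨c, hc⟩) (y | ⟨d, hd⟩) h
  · simp only [vertexName, Sum.inl.injEq] at h
    rw [Subtype.ext h]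
  · simp [vertexName] at h
  · simp [vertexName] at h
  · obtain ⟨j, hj, rfl⟩ := hL.mem_iff.mp hc
    obtain ⟨k, hk, rfl⟩ := hL.mem_iff.mp hd
    rw [hL.vertexName_clause hj hc, hL.vertexName_clause hk hd] at h
    cases h
    rfl

theorem occurs_iff {x : ℕ} {c : List Literal} : Occurs x c.toFinset ↔ ∃ l ∈ c, l.1 = x := by
  simp only [Occurs, List.mem_toFinset]
  constructor
  · rintro (h | h)
    exacts [⟨_, h, rfl⟩, ⟨_, h, rfl⟩]
  · rintro ⟨⟨x, b⟩, h, rfl⟩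
    cases b
    exacts [.inr h, .inl h]

theorem card_incVertex_le (hL : IsListing L φ) : Fintype.card (IncVertex φ) ≤ (names L).length := by
  refine le_trans ?_ (List.toFinset_card_le (names L))
  rw [← Finset.card_univ, ← Finset.card_image_of_injective _ hL.vertexName_injective]
  refine Finset.card_le_card fun v hv => ?_
  obtain ⟨u, -, hu⟩ := Finset.mem_image.mp hv
  exact List.mem_toFinset.mpr (hL.mem_names_iff.mpr ⟨u, hu⟩)

namespace Describes

variable {D : TreeDecomposition (incidenceGraph φ) (Fin T.length)}

theorem mem_bag_iff (h : Describes L T D) (i : Fin T.length) (v : ℕ ⊕ ℕ) :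
    v ∈ SharpSat.bag T i ↔ ∃ u ∈ D.bag i, vertexName L u = v := by
  rw [bag_eq_get, ← List.mem_toFinset, h.bag_eq, Finset.mem_image]

theorem length_bag (hL : IsListing L φ) (h : Describes L T D) (i : Fin T.length) :
    (SharpSat.bag T i).length = (D.bag i).card := by
  rw [bag_eq_get, ← List.toFinset_card_of_nodup (h.bag_nodup i), h.bag_eq,
    Finset.card_image_of_injective _ hL.vertexName_injective]

theorem sup_card (hL : IsListing L φ) (h : Describes L T D) :
    (Finset.univ.sup fun i => (D.bag i).card) = maxBag T T.length := by
  apply le_antisymm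
  · refine Finset.sup_le fun i _ => ?_
    rw [← length_bag hL h]
    exact length_bag_le_maxBag i.2
  · refine Finset.sup_le fun i hi => ?_
    have := length_bag hL h ⟨i, Finset.mem_range.mp hi⟩
    simp only at this
    rw [this]
    exact Finset.le_sup (f := fun i => (D.bag i).card) (Finset.mem_univ _)

theorem validCode (hL : IsListing L φ) (h : Describes L T D) : ValidCode L T := by
  have hpos : 0 < T.length := by
    obtain ⟨i⟩ := D.isTree.1.nonempty
    exact i.pos
  have hparent : ∀ i < T.length, 0 < i → parent T i < i := by
    intro i hi h0
    have := h.parent_lt ⟨i, hi⟩ h0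
    rwa [← parent_eq_get] at this
  refine ⟨hpos, hparent, ?_, ?_, ?_, ?_, ?_⟩
  · intro i hi
    have := h.bag_nodup ⟨i, hi⟩
    rwa [← bag_eq_get] at this
  · intro i hi v hv
    obtain ⟨u, -, hu⟩ := (h.mem_bag_iff ⟨i, hi⟩ v).mp hv
    exact hL.mem_names_iff.mpr ⟨u, hu⟩
  · intro v hv
    obtain ⟨u, rfl⟩ := hL.mem_names_iff.mp hv
    obtain ⟨i, hi⟩ := (D.connected u).nonempty
    exact ⟨i, i.2, (h.mem_bag_iff i _).mpr ⟨u, hi, rfl⟩⟩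
  · intro i hi v hv h0 hv' j hj hvj
    obtain ⟨u, hu, rfl⟩ := (h.mem_bag_iff ⟨i, hi⟩ v).mp hv
    obtain ⟨u', hu', hu''⟩ := (h.mem_bag_iff ⟨j, hj.trans hi⟩ _).mp hvj
    obtain rfl := hL.vertexName_injective hu''
    have hreach := (D.connected u').preconnected ⟨⟨i, hi⟩, hu⟩ ⟨⟨j, hj.trans hi⟩, hu'⟩
    rw [SimpleGraph.reachable_iff_reflTransGen] at hreach
    have key : ∀ a : {k | u' ∈ D.bag k}, Relation.ReflTransGen
        (D.tree.induce {k | u' ∈ D.bag k}).Adj ⟨⟨i, hi⟩, hu⟩ a →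
        Relation.ReflTransGen (fun b c : ℕ => 0 < b ∧ parent T b = c) a.1.1 i := by
      intro a ha
      induction ha with
      | refl => exact .refl
      | @tail b c _ hbc ih =>
        rcases (h.adj_iff b.1 c.1).mp hbc with ⟨hb, hb'⟩ | ⟨hc, hc'⟩
        · rw [← parent_eq_get] at hb'
          rcases ih.cases_head with hbi | ⟨d, ⟨-, rfl⟩, hd⟩
          · exfalso
            rw [hbi] at hb'
            rw [hb', h.mem_bag_iff] at hv'
            exact hv' ⟨u', c.2, rfl⟩
          · rwa [hb'] at hd
        · rw [← parent_eq_get] at hc'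
          exact .head ⟨hc, hc'⟩ ih
    have hji := key _ hreach
    have hle : ∀ b, b < T.length → Relation.ReflTransGen (fun b c : ℕ => 0 < b ∧ parent T b = c) b i →
        i ≤ b := by
      intro b
      induction b using Nat.strong_induction_on with
      | h b ih =>
        intro hb hbi
        rcases hbi.cases_head with rfl | ⟨d, ⟨hb0, rfl⟩, hd⟩
        · exact le_rfl
        · have := hparent b hb hb0
          exact (ih _ this (this.trans hb) hd).trans this.le
    exact absurd (hle j (hj.trans hi) hji) (by omega)
  · intro j hj l hl
    have hc : (L.getD j []).toFinset ∈ φ := hL.mem_iff.mpr ⟨j, hj, rfl⟩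
    have hx : l.1 ∈ vars φ := hL.mem_vars.mpr (mem_names.mpr (.inl ⟨j, hj, l, hl, rfl⟩))
    obtain ⟨i, h1, h2⟩ := D.edge_mem (.inl ⟨l.1, hx⟩) (.inr ⟨_, hc⟩) (occurs_iff.mpr ⟨l, hl, rfl⟩)
    exact ⟨i, i.2, (h.mem_bag_iff i _).mpr ⟨_, h1, rfl⟩,
      (h.mem_bag_iff i _).mpr ⟨_, h2, hL.vertexName_clause hj hc⟩⟩

end Describes

namespace ValidCode

/-- The tree that is given by the parents of the nodes. -/
def graph (hT : ValidCode L T) : SimpleGraph (Fin T.length) where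
  Adj i j := (0 < i.val ∧ parent T i = j) ∨ (0 < j.val ∧ parent T j = i)
  symm := ⟨fun _ _ h => h.symm⟩
  loopless := ⟨fun i h => by
    rcases h with ⟨h, h'⟩ | ⟨h, h'⟩ <;> exact absurd (hT.parent_lt i i.2 h) (by omega)⟩

theorem reachable_zero (hT : ValidCode L T) (i : Fin T.length) :
    hT.graph.Reachable i ⟨0, hT.pos⟩ := by
  obtain ⟨i, hi⟩ := i
  induction i using Nat.strong_induction_on with
  | h i ih =>
    rcases Nat.eq_zero_or_pos i with rfl | h0
    · exact .refl _
    · have hlt := hT.parent_lt i hi h0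
      refine SimpleGraph.Reachable.trans (SimpleGraph.Adj.reachable ?_) (ih _ hlt (hlt.trans hi))
      exact .inl ⟨h0, rfl⟩

theorem isTree_graph (hT : ValidCode L T) : hT.graph.IsTree := by
  have hconn : hT.graph.Connected :=
    { preconnected := fun i j => (hT.reachable_zero i).trans (hT.reachable_zero j).symm
      nonempty := ⟨⟨0, hT.pos⟩⟩ }
  rw [SimpleGraph.isTree_iff_connected_and_card]
  refine ⟨hconn, le_antisymm ?_ hconn.card_vert_le_card_edgeSet_add_one⟩
  let f : Fin T.length → Sym2 (Fin T.length) := fun i =>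
    if h : parent T i < T.length then s(i, ⟨parent T i, h⟩) else s(i, i)
  have hsub : hT.graph.edgeSet ⊆ f '' {i | i ≠ ⟨0, hT.pos⟩} := by
    intro e
    refine Sym2.ind (fun i j hij => ?_) e
    rcases hij with ⟨h, h'⟩ | ⟨h, h'⟩
    · refine ⟨i, ?_, ?_⟩
      · rintro rfl; simp at h
      · simp [f, h', Fin.eta]
    · refine ⟨j, ?_, ?_⟩
      · rintro rfl; simp at h
      · simp [f, h', Fin.eta, Sym2.eq_swap]
  have h1 : Nat.card hT.graph.edgeSet ≤ Nat.card {i : Fin T.length | i ≠ ⟨0, hT.pos⟩} :=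
    (Nat.card_mono (Set.toFinite _) hsub).trans (Set.ncard_image_le (Set.toFinite _))
  have h2 : Nat.card {i : Fin T.length | i ≠ ⟨0, hT.pos⟩} = T.length - 1 := by
    have := Set.ncard_compl ({⟨0, hT.pos⟩} : Set (Fin T.length))
    rw [Set.ncard_singleton, Nat.card_fin] at this
    exact this
  have := hT.pos
  rw [Nat.card_fin]
  omega

open Classical in
theorem exists_describes (hL : IsListing L φ) (hT : ValidCode L T) :
    ∃ D : TreeDecomposition (incidenceGraph φ) (Fin T.length), Describes L T D := by
  let B : Fin T.length → Finset (IncVertex φ) := fun i =>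
    Finset.univ.filter fun u => vertexName L u ∈ bag T i
  have hB : ∀ i u, u ∈ B i ↔ vertexName L u ∈ bag T i := by simp [B]
  have hedge : ∀ (x : {x : ℕ // x ∈ vars φ}) (c : {c : Clause // c ∈ φ}), Occurs x.1 c.1 →
      ∃ i, .inl x ∈ B i ∧ .inr c ∈ B i := by
    rintro x ⟨c, hc⟩ h
    obtain ⟨j, hj, rfl⟩ := hL.mem_iff.mp hc
    obtain ⟨l, hl, hlx⟩ := occurs_iff.mp h
    obtain ⟨i, hi, h1, h2⟩ := hT.edge j hj l hl
    refine ⟨⟨i, hi⟩, (hB _ _).mpr ?_, (hB _ _).mpr ?_⟩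
    · rwa [hlx] at h1
    · rwa [hL.vertexName_clause hj hc]
  refine ⟨⟨hT.graph, hT.isTree_graph, B, ?_, ?_⟩, ?_⟩
  · intro u
    obtain ⟨i₀, hi₀, hu⟩ := hT.cover _ (hL.mem_names_iff.mpr ⟨u, rfl⟩)
    have hf : first T (vertexName L u) < T.length := (first_le hu).trans_lt hi₀
    have hfm : u ∈ B ⟨_, hf⟩ := (hB _ _).mpr (mem_bag_first hu)
    have key : ∀ i (hi : i < T.length) (hui : u ∈ B ⟨i, hi⟩),
        (hT.graph.induce {i | u ∈ B i}).Reachable ⟨⟨i, hi⟩, hui⟩ ⟨⟨_, hf⟩, hfm⟩ := by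
      intro i
      induction i using Nat.strong_induction_on with
      | h i ih =>
        intro hi hui
        have hui' := (hB _ _).mp hui
        rcases (first_le hui').eq_or_lt with h | h
        · have : (⟨⟨i, hi⟩, hui⟩ : {i | u ∈ B i}) = ⟨⟨_, hf⟩, hfm⟩ :=
            Subtype.ext (Fin.ext h.symm)
          rw [this]
        · have hlt := hT.parent_lt i hi ((Nat.zero_le _).trans_lt h)
          refine SimpleGraph.Reachable.trans (SimpleGraph.Adj.reachable ?_)
            (ih _ hlt (hlt.trans hi) ((hB _ _).mpr (hT.mem_parent hui' h)))
          exact .inl ⟨(Nat.zero_le _).trans_lt h, rfl⟩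
    exact { preconnected := fun i j => (key _ i.1.2 i.2).trans (key _ j.1.2 j.2).symm
            nonempty := ⟨⟨⟨_, hf⟩, hfm⟩⟩ }
  · rintro (x | c) (y | d) h
    · exact h.elim
    · exact hedge x d h
    · obtain ⟨i, h1, h2⟩ := hedge y c h
      exact ⟨i, h2, h1⟩
    · exact h.elim
  · refine ⟨?_, ?_, ?_, ?_⟩
    · intro i h0
      rw [← parent_eq_get]
      exact hT.parent_lt i i.2 h0
    · intro i j
      rw [← parent_eq_get, ← parent_eq_get]
      rfl
    · intro i
      rw [← bag_eq_get]
      exact hT.nodup i i.2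
    · intro i
      ext v
      rw [← bag_eq_get, List.mem_toFinset, Finset.mem_image]
      constructor
      · intro hv
        obtain ⟨u, rfl⟩ := hL.mem_names_iff.mp (hT.mem_names i i.2 v hv)
        exact ⟨u, (hB _ _).mpr hv, rfl⟩
      · rintro ⟨u, hu, rfl⟩
        exact (hB _ _).mp hu

end ValidCode

end

end SharpSat
namespace SharpSat

/-! ### Short rooted decompositions -/

open Classical in
theorem exists_tree_parent {ι : Type} {G : SimpleGraph ι} (hG : G.IsTree) (r : ι) :
    ∃ p : ι → ι, (∀ a, a ≠ r → G.dist r (p a) < G.dist r a) ∧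
      ∀ a b, G.Adj a b → (a ≠ r ∧ p a = b) ∨ (b ≠ r ∧ p b = a) := by
  have hex : ∀ a, ∃ b, a ≠ r → G.Adj a b ∧ G.dist r b < G.dist r a := by
    intro a
    by_cases ha : a = r
    · exact ⟨a, fun h => absurd ha h⟩
    · obtain ⟨w, hw⟩ := (hG.1.preconnected a r).exists_walk_length_eq_dist
      cases w with
      | nil => exact absurd rfl ha
      | @cons _ b _ h w =>
        refine ⟨b, fun _ => ⟨h, ?_⟩⟩
        rw [SimpleGraph.dist_comm, SimpleGraph.dist_comm (u := r), ← hw, SimpleGraph.Walk.length_cons]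
        exact Nat.lt_succ_of_le (SimpleGraph.dist_le w)
  choose p hp using hex
  have huniq : ∀ a b c, G.Adj a b → G.Adj a c → G.dist r b < G.dist r a →
      G.dist r c < G.dist r a → b = c := by
    intro a b c hb hc hb' hc'
    have key : ∀ b, ∀ h : G.Adj a b, G.dist r b < G.dist r a →
        ∃ w : G.Walk b r, (SimpleGraph.Walk.cons h w).IsPath := by
      intro b h hlt
      obtain ⟨w, hw⟩ := (hG.1.preconnected b r).exists_walk_length_eq_dist
      refine ⟨w, SimpleGraph.Walk.isPath_of_length_eq_dist _
        (le_antisymm ?_ (SimpleGraph.dist_le _))⟩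
      rw [SimpleGraph.Walk.length_cons, hw, SimpleGraph.dist_comm,
        SimpleGraph.dist_comm (u := a)]
      exact hlt
    obtain ⟨v, hv⟩ := key b hb hb'
    obtain ⟨w, hw⟩ := key c hc hc'
    have := (hG.existsUnique_path a r).unique hv hw
    injection this
  refine ⟨p, fun a ha => (hp a ha).2, fun a b hab => ?_⟩
  have hne : ∀ {a b}, G.dist r a < G.dist r b → b ≠ r := by
    rintro a b h rfl
    simp at h
  rcases hG.dist_eq_dist_add_one_of_adj r hab with h | h
  · have hlt : G.dist r b < G.dist r a := by omega
    exact .inl ⟨hne hlt, huniq _ _ _ (hp a (hne hlt)).1 hab (hp a (hne hlt)).2 hlt⟩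
  · have hlt : G.dist r a < G.dist r b := by omega
    exact .inr ⟨hne hlt, huniq _ _ _ (hp b (hne hlt)).1 hab.symm (hp b (hne hlt)).2 hlt⟩

/-- A rooted tree decomposition on a finite set of nodes: a node is a top of `v` if its bag
contains `v` and the bag of its parent does not, and every vertex has at most one top. -/
structure RootedDecomposition {V : Type} (G : SimpleGraph V) (ι : Type) where
  nodes : Finset ι
  root : ι
  parent : ι → ι
  rank : ι → ℕ
  bag : ι → Finset V
  root_mem : root ∈ nodes
  parent_mem : ∀ i ∈ nodes, i ≠ root → parent i ∈ nodes
  rank_lt : ∀ i ∈ nodes, i ≠ root → rank (parent i) < rank i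
  top_unique : ∀ v, ∀ i ∈ nodes, ∀ j ∈ nodes, v ∈ bag i → (i ≠ root → v ∉ bag (parent i)) →
    v ∈ bag j → (j ≠ root → v ∉ bag (parent j)) → i = j
  cover : ∀ v, ∃ i ∈ nodes, v ∈ bag i
  edge : ∀ u v, G.Adj u v → ∃ i ∈ nodes, u ∈ bag i ∧ v ∈ bag i

theorem TreeDecomposition.exists_rooted {V ι : Type} [Fintype ι] {G : SimpleGraph V}
    (D : TreeDecomposition G ι) : ∃ R : RootedDecomposition G ι, R.bag = D.bag := by
  obtain ⟨r⟩ := D.isTree.1.nonempty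
  obtain ⟨p, hlt, hadj⟩ := exists_tree_parent D.isTree r
  have key : ∀ v i j, v ∈ D.bag i → (i ≠ r → v ∉ D.bag (p i)) → v ∈ D.bag j →
      j = i ∨ D.tree.dist r i < D.tree.dist r j := by
    intro v i j hi hi' hj
    have hreach := (D.connected v).preconnected ⟨i, hi⟩ ⟨j, hj⟩
    rw [SimpleGraph.reachable_iff_reflTransGen] at hreach
    have key : ∀ a : {k | v ∈ D.bag k}, Relation.ReflTransGen
        (D.tree.induce {k | v ∈ D.bag k}).Adj ⟨i, hi⟩ a →
        Relation.ReflTransGen (fun b c : ι => b ≠ r ∧ p b = c) a.1 i := by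
      intro a ha
      induction ha with
      | refl => exact .refl
      | @tail b c _ hbc ih =>
        rcases hadj b.1 c.1 hbc with ⟨hb, hb'⟩ | h
        · rcases ih.cases_head with hbi | ⟨d, ⟨-, rfl⟩, hd⟩
          · rw [hbi] at hb hb'
            exact absurd (hb' ▸ c.2) (hi' hb)
          · rwa [hb'] at hd
        · exact .head h ih
    have hji := key _ hreach
    clear hreach hi'
    simp only at hji
    clear hj
    induction hji using Relation.ReflTransGen.head_induction_on with
    | refl => exact .inl rfl
    | head h _ ih =>
      obtain ⟨h, rfl⟩ := h
      right
      rcases ih with ih | ih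
      · rw [← ih]
        exact hlt _ h
      · exact ih.trans (hlt _ h)
  refine ⟨⟨Finset.univ, r, p, D.tree.dist r, D.bag, Finset.mem_univ _, fun _ _ _ => Finset.mem_univ _,
    fun i _ hi => hlt i hi, ?_, ?_, ?_⟩, rfl⟩
  · intro v i _ j _ hi hi' hj hj'
    rcases key v i j hi hi' hj with h | h
    · exact h.symm
    · rcases key v j i hj hj' hi with h' | h'
      · exact h'
      · exact absurd h h'.asymm
  · intro v
    obtain ⟨i, hi⟩ := (D.connected v).nonempty
    exact ⟨i, Finset.mem_univ _, hi⟩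
  · intro u v h
    obtain ⟨i, hi⟩ := D.edge_mem u v h
    exact ⟨i, Finset.mem_univ _, hi⟩

namespace RootedDecomposition

variable {V ι : Type} {G : SimpleGraph V}

open Classical in
theorem exists_contract [Fintype V] (R : RootedDecomposition G ι)
    (h : Fintype.card V + 1 < R.nodes.card) :
    ∃ R' : RootedDecomposition G ι, R'.bag = R.bag ∧ R'.nodes.card < R.nodes.card := by
  obtain ⟨i, hi, hir, hsub⟩ : ∃ i ∈ R.nodes, i ≠ R.root ∧ R.bag i ⊆ R.bag (R.parent i) := by
    by_contra! hcon
    have hex : ∀ i, ∃ v, i ∈ R.nodes.erase R.root → v ∈ R.bag i ∧ v ∉ R.bag (R.parent i) := by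
      intro i
      by_cases hi : i ∈ R.nodes.erase R.root
      · obtain ⟨v, hv⟩ := Finset.not_subset.mp
          (hcon i (Finset.mem_of_mem_erase hi) (Finset.ne_of_mem_erase hi))
        exact ⟨v, fun _ => hv⟩
      · obtain ⟨v⟩ : Nonempty V := by
          have h2 : 1 < R.nodes.card := by omega
          obtain ⟨j, hj, hjr⟩ := Finset.exists_mem_ne h2 R.root
          exact ⟨(Finset.not_subset.mp (hcon j hj hjr)).choose⟩
        exact ⟨v, fun h => absurd h hi⟩
    choose f hf using hex
    have := Finset.card_le_card_of_injOn f (s := R.nodes.erase R.root) (t := Finset.univ)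
      (fun _ _ => Finset.mem_univ _) fun i hi j hj hij =>
        R.top_unique (f i) i (Finset.mem_of_mem_erase hi) j (Finset.mem_of_mem_erase hj)
          (hf i hi).1 (fun _ => (hf i hi).2) (hij ▸ (hf j hj).1) (fun _ => hij ▸ (hf j hj).2)
    rw [Finset.card_erase_of_mem R.root_mem, Finset.card_univ] at this
    omega
  have hpi : R.parent i ≠ i := fun h => (R.rank_lt i hi hir).ne (by rw [h])
  have htop : ∀ v j, (j ≠ R.root → v ∉ R.bag (if R.parent j = i then R.parent i else R.parent j)) →
      j ≠ R.root → v ∉ R.bag (R.parent j) := by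
    intro v j h hj
    have := h hj
    split_ifs at this with hji
    · rw [hji]
      exact fun h => this (hsub h)
    · exact this
  refine ⟨⟨R.nodes.erase i, R.root, fun j => if R.parent j = i then R.parent i else R.parent j,
    R.rank, R.bag, Finset.mem_erase.mpr ⟨hir.symm, R.root_mem⟩, ?_, ?_, ?_, ?_, ?_⟩, rfl,
    Finset.card_erase_lt_of_mem hi⟩
  · intro j hj hjr
    split_ifs with hji
    · exact Finset.mem_erase.mpr ⟨hpi, R.parent_mem i hi hir⟩
    · exact Finset.mem_erase.mpr ⟨hji, R.parent_mem j (Finset.mem_of_mem_erase hj) hjr⟩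
  · intro j hj hjr
    have := R.rank_lt j (Finset.mem_of_mem_erase hj) hjr
    split_ifs with hji
    · rw [hji] at this
      exact (R.rank_lt i hi hir).trans this
    · exact this
  · intro v j hj k hk hvj hj' hvk hk'
    exact R.top_unique v j (Finset.mem_of_mem_erase hj) k (Finset.mem_of_mem_erase hk) hvj
      (htop v j hj') hvk (htop v k hk')
  · intro v
    obtain ⟨k, hk, hv⟩ := R.cover v
    by_cases hki : k = i
    · exact ⟨_, Finset.mem_erase.mpr ⟨hpi, R.parent_mem i hi hir⟩, hsub (hki ▸ hv)⟩
    · exact ⟨k, Finset.mem_erase.mpr ⟨hki, hk⟩, hv⟩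
  · intro u v huv
    obtain ⟨k, hk, hu, hv⟩ := R.edge u v huv
    by_cases hki : k = i
    · exact ⟨_, Finset.mem_erase.mpr ⟨hpi, R.parent_mem i hi hir⟩, hsub (hki ▸ hu), hsub (hki ▸ hv)⟩
    · exact ⟨k, Finset.mem_erase.mpr ⟨hki, hk⟩, hu, hv⟩

theorem exists_card_le [Fintype V] (R : RootedDecomposition G ι) :
    ∃ R' : RootedDecomposition G ι, R'.bag = R.bag ∧ R'.nodes.card ≤ Fintype.card V + 1 := by
  induction hn : R.nodes.card using Nat.strong_induction_on generalizing R with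
  | h n ih =>
    by_cases h : Fintype.card V + 1 < R.nodes.card
    · obtain ⟨R', hb, hlt⟩ := R.exists_contract h
      obtain ⟨R'', hb', hle⟩ := ih _ (hn ▸ hlt) R' rfl
      exact ⟨R'', hb'.trans hb, hle⟩
    · exact ⟨R, rfl, not_lt.mp h⟩

theorem rank_root_lt (R : RootedDecomposition G ι) : ∀ i ∈ R.nodes, i ≠ R.root →
    R.rank R.root < R.rank i := by
  intro i
  induction hn : R.rank i using Nat.strong_induction_on generalizing i with
  | h n ih =>
    intro hi hir
    have hlt := R.rank_lt i hi hir
    rw [hn] at hlt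
    by_cases h : R.parent i = R.root
    · rwa [h] at hlt
    · exact (ih _ hlt _ rfl (R.parent_mem i hi hir) h).trans hlt

theorem exists_top (R : RootedDecomposition G ι) {v : V} : ∀ i ∈ R.nodes, v ∈ R.bag i →
    ∃ t ∈ R.nodes, v ∈ R.bag t ∧ (t ≠ R.root → v ∉ R.bag (R.parent t)) ∧
      (t = i ∨ R.rank t < R.rank i) := by
  intro i
  induction hn : R.rank i using Nat.strong_induction_on generalizing i with
  | h n ih =>
    intro hi hv
    by_cases h : i ≠ R.root ∧ v ∈ R.bag (R.parent i)
    · have hlt := R.rank_lt i hi h.1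
      rw [hn] at hlt
      obtain ⟨t, ht, hvt, htop, hle⟩ := ih _ hlt _ rfl (R.parent_mem i hi h.1) h.2
      refine ⟨t, ht, hvt, htop, .inr ?_⟩
      rcases hle with rfl | hle
      exacts [hlt, hle.trans hlt]
    · exact ⟨i, hi, hv, fun h1 h2 => h ⟨h1, h2⟩, .inl rfl⟩

open Classical in
theorem exists_validCode {φ : CNF} {L : List (List Literal)} (hL : IsListing L φ)
    (R : RootedDecomposition (incidenceGraph φ) ι) (m : ℕ) (hm : ∀ i, (R.bag i).card ≤ m) :
    ∃ T, ValidCode L T ∧ maxBag T T.length ≤ m ∧ T.length = R.nodes.card ∧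
      ∀ i < T.length, SharpSat.parent T i ≤ T.length := by
  obtain ⟨l, hnd, hmem, hsort, hlen⟩ : ∃ l : List ι, l.Nodup ∧ (∀ i, i ∈ l ↔ i ∈ R.nodes) ∧
      l.Pairwise (fun i j => R.rank i ≤ R.rank j) ∧ l.length = R.nodes.card := by
    have : Std.Total fun i j : ι => R.rank i ≤ R.rank j := ⟨fun i j => le_total _ _⟩
    have : IsTrans ι fun i j => R.rank i ≤ R.rank j := ⟨fun i j k => le_trans⟩
    have hp := List.perm_insertionSort (fun i j => R.rank i ≤ R.rank j) R.nodes.toList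
    refine ⟨R.nodes.toList.insertionSort fun i j => R.rank i ≤ R.rank j,
      hp.nodup_iff.mpr R.nodes.nodup_toList, fun i => ?_, List.pairwise_insertionSort _ _, ?_⟩
    · rw [hp.mem_iff, Finset.mem_toList]
    · rw [hp.length_eq, Finset.length_toList]
  have hsort' : ∀ i j (hi : i < l.length) (hj : j < l.length), R.rank l[i] < R.rank l[j] → i < j := by
    intro i j hi hj h
    by_contra! hji
    rcases hji.eq_or_lt with rfl | hji
    · exact lt_irrefl _ h
    · exact absurd (List.pairwise_iff_getElem.mp hsort j i hj hi hji) (not_le.mpr h)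
  have hnode : ∀ i (hi : i < l.length), l[i] ∈ R.nodes := fun i hi => (hmem _).mp (l.getElem_mem hi)
  have hroot : ∀ i (hi : i < l.length), 0 < i ↔ l[i] ≠ R.root := by
    obtain ⟨k, hk, hkr⟩ := List.getElem_of_mem ((hmem _).mpr R.root_mem)
    have hk0 : k = 0 := by
      by_contra hk0
      have h0 : 0 < l.length := (Nat.zero_le k).trans_lt hk
      have hne : l[0] ≠ R.root := by
        rw [← hkr]
        exact fun h => hk0 ((hnd.getElem_inj_iff).mp h).symm
      have := hsort' k 0 hk h0 (by rw [hkr]; exact R.rank_root_lt _ (hnode 0 h0) hne)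
      omega
    subst hk0
    intro i hi
    rw [← hkr, Ne, hnd.getElem_inj_iff]
    omega
  let T : TreeCode := l.map fun i => (l.idxOf (R.parent i), (R.bag i).toList.map (vertexName L))
  have hTl : T.length = l.length := List.length_map _
  have hbag : ∀ i (hi : i < l.length), SharpSat.bag T i = (R.bag l[i]).toList.map (vertexName L) := by
    intro i hi
    rw [bag_of_lt (hTl ▸ hi)]
    simp [T]
  have hpar : ∀ i (hi : i < l.length), SharpSat.parent T i = l.idxOf (R.parent l[i]) := by
    intro i hi
    simp [SharpSat.parent, T, List.getD_eq_getElem?_getD, hi]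
  have hmb : ∀ i (hi : i < l.length) u, vertexName L u ∈ SharpSat.bag T i ↔ u ∈ R.bag l[i] := by
    intro i hi u
    rw [hbag i hi, List.mem_map_of_injective hL.vertexName_injective, Finset.mem_toList]
  have hpl : ∀ i (hi : i < l.length), 0 < i → ∃ h : SharpSat.parent T i < l.length,
      l[SharpSat.parent T i] = R.parent l[i] := by
    intro i hi h0
    have hm := (hmem _).mpr (R.parent_mem _ (hnode i hi) ((hroot i hi).mp h0))
    have hlt := List.idxOf_lt_length_of_mem hm
    refine ⟨(hpar i hi).trans_lt hlt, ?_⟩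
    simp only [hpar i hi, List.getElem_idxOf]
  have hcover : ∀ i ∈ R.nodes, ∃ k, ∃ h : k < l.length, l[k] = i := fun i hi =>
    List.getElem_of_mem ((hmem i).mpr hi)
  refine ⟨T, ⟨?_, ?_, ?_, ?_, ?_, ?_, ?_⟩, ?_, hTl.trans hlen, ?_⟩
  · rw [hTl, hlen]
    exact Finset.card_pos.mpr ⟨_, R.root_mem⟩
  · intro i hi h0
    rw [hTl] at hi
    obtain ⟨h1, h2⟩ := hpl i hi h0
    refine hsort' _ _ h1 hi ?_
    rw [h2]
    exact R.rank_lt _ (hnode i hi) ((hroot i hi).mp h0)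
  · intro i hi
    rw [hbag i (hTl ▸ hi)]
    exact (Finset.nodup_toList _).map hL.vertexName_injective
  · intro i hi v hv
    rw [hbag i (hTl ▸ hi), List.mem_map] at hv
    obtain ⟨u, -, rfl⟩ := hv
    exact hL.mem_names_iff.mpr ⟨u, rfl⟩
  · intro v hv
    obtain ⟨u, rfl⟩ := hL.mem_names_iff.mp hv
    obtain ⟨i, hi, hu⟩ := R.cover u
    obtain ⟨k, hk, rfl⟩ := hcover i hi
    exact ⟨k, hTl ▸ hk, (hmb k hk u).mpr hu⟩
  · intro i hi v hv h0 hv' j hj hvj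
    rw [hTl] at hi
    have hv2 := hv
    rw [hbag i hi, List.mem_map] at hv2
    obtain ⟨u, -, rfl⟩ := hv2
    have hj' := hj.trans hi
    rw [hmb i hi] at hv
    rw [hmb j hj'] at hvj
    obtain ⟨h1, h2⟩ := hpl i hi h0
    rw [hmb _ h1, h2] at hv'
    obtain ⟨t, ht, hut, htop, hle⟩ := R.exists_top _ (hnode j hj') hvj
    have hti := R.top_unique u t ht _ (hnode i hi) hut htop hv fun _ => hv'
    rw [hti, hnd.getElem_inj_iff] at hle
    rcases hle with hle | hle
    · omega
    · have := hsort' _ _ hi hj' hle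
      omega
  · intro j hj x hx
    have hc : (L.getD j []).toFinset ∈ φ := hL.mem_iff.mpr ⟨j, hj, rfl⟩
    have hxv : x.1 ∈ vars φ := hL.mem_vars.mpr (mem_names.mpr (.inl ⟨j, hj, x, hx, rfl⟩))
    obtain ⟨i, hi, h1, h2⟩ := R.edge (.inl ⟨x.1, hxv⟩) (.inr ⟨_, hc⟩) (occurs_iff.mpr ⟨x, hx, rfl⟩)
    obtain ⟨k, hk, rfl⟩ := hcover i hi
    refine ⟨k, hTl ▸ hk, (hmb k hk _).mpr h1, ?_⟩
    rw [← hL.vertexName_clause hj hc]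
    exact (hmb k hk _).mpr h2
  · refine Finset.sup_le fun i hi => ?_
    rw [Finset.mem_range, hTl] at hi
    rw [hbag i hi, List.length_map, Finset.length_toList]
    exact hm _
  · intro i hi
    rw [hTl] at hi ⊢
    rw [hpar i hi]
    exact List.idxOf_le_length

end RootedDecomposition

/-- Every tree decomposition of the incidence graph is as wide as a short valid code. -/
theorem TreeDecomposition.exists_validCode {φ : CNF} {L : List (List Literal)}
    (hL : IsListing L φ) {N : ℕ} (D : TreeDecomposition (incidenceGraph φ) (Fin N)) :
    ∃ T, ValidCode L T ∧ maxBag T T.length ≤ (Finset.univ.sup fun i => (D.bag i).card) ∧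
      T.length ≤ (names L).length + 1 ∧ ∀ i < T.length, parent T i ≤ T.length := by
  obtain ⟨R, hR⟩ := D.exists_rooted
  obtain ⟨R', hR', hcard⟩ := R.exists_card_le
  obtain ⟨T, hT, hm, hlen, hp⟩ := R'.exists_validCode hL _ fun i => by
    rw [hR', hR]
    exact Finset.le_sup (f := fun i => (D.bag i).card) (Finset.mem_univ i)
  refine ⟨T, hT, hm, ?_, hp⟩
  have := card_incVertex_le hL
  omega

end SharpSat
namespace SharpSat

/-! ### Computing an optimal tree decomposition -/

section

variable {α β : Type} [Primcodable α] [Primcodable β]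

theorem primrecPred_forall_mem {f : α → List β} {p : α → β → Prop} (hf : Primrec f)
    (hp : PrimrecRel p) : PrimrecPred fun a => ∀ x ∈ f a, p a x :=
  (PrimrecRel.forall_mem_list (R := fun x a => p a x) hp.swap).comp hf .id

theorem primrecPred_forall_lt {f : α → ℕ} {p : α → ℕ → Prop} (hf : Primrec f) (hp : PrimrecRel p) :
    PrimrecPred fun a => ∀ x < f a, p a x :=
  (primrecPred_forall_mem (Primrec.list_range.comp hf) hp).of_eq fun a => by simp

theorem primrecPred_exists_lt {f : α → ℕ} {p : α → ℕ → Prop} (hf : Primrec f) (hp : PrimrecRel p) :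
    PrimrecPred fun a => ∃ x < f a, p a x :=
  (primrecPred_forall_lt hf (p := fun a x => ¬ p a x) (PrimrecPred.not hp)).not.of_eq fun a => by simp

theorem primrecPred_mem {f : α → β} {g : α → List β} (hf : Primrec f) (hg : Primrec g) :
    PrimrecPred fun a => f a ∈ g a :=
  ((PrimrecRel.exists_mem_list (R := fun x b : β => x = b) Primrec.eq).comp hg hf).of_eq
    fun a => by simp

theorem primrecPred_imp {p q : α → Prop} (hp : PrimrecPred p) (hq : PrimrecPred q) :
    PrimrecPred fun a => p a → q a :=
  (hp.not.or hq).of_eq fun _ => imp_iff_not_or.symm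

theorem primrecPred_nodup {f : α → List β} (hf : Primrec f) : PrimrecPred fun a => (f a).Nodup := by
  have h : PrimrecPred fun a => ∀ j < (f a).length, ∀ i < j, (f a)[i]? ≠ (f a)[j]? :=
    primrecPred_forall_lt (Primrec.list_length.comp hf) (primrecPred_forall_lt .snd
      (Primrec.eq.comp (Primrec.list_getElem?.comp (hf.comp (.comp .fst .fst)) .snd)
        (Primrec.list_getElem?.comp (hf.comp (.comp .fst .fst)) (.comp .snd .fst))).not)
  refine h.of_eq fun a => ?_
  rw [List.nodup_iff_getElem?_ne_getElem?]
  exact ⟨fun h i j hij hj => h j hj i hij, fun h j hj i hij => h i j hij hj⟩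

/-- The lists of length at most `n` over `A`. -/
def boundedLists {γ : Type} (A : List γ) : ℕ → List (List γ) :=
  Nat.rec [[]] fun _ r => [] :: A.flatMap fun a => r.map fun l => a :: l

theorem mem_boundedLists {γ : Type} {A : List γ} : ∀ {n : ℕ} {l : List γ},
    l ∈ boundedLists A n ↔ l.length ≤ n ∧ ∀ a ∈ l, a ∈ A
  | 0, l => by cases l <;> simp [boundedLists]
  | n + 1, [] => by simp [boundedLists]
  | n + 1, a :: l => by
    have ih := mem_boundedLists (A := A) (n := n) (l := l)
    change a :: l ∈ [] :: A.flatMap (fun a => (boundedLists A n).map fun l => a :: l) ↔ _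
    simp only [List.mem_cons, List.mem_flatMap, List.mem_map, List.cons.injEq, reduceCtorEq,
      false_or, List.length_cons, Nat.add_le_add_iff_right, forall_eq_or_imp]
    constructor
    · rintro ⟨a, ha, l, hl, rfl, rfl⟩
      exact ⟨(ih.mp hl).1, ha, (ih.mp hl).2⟩
    · rintro ⟨h, ha, h'⟩
      exact ⟨a, ha, l, ih.mpr ⟨h, h'⟩, rfl, rfl⟩

theorem primrec_boundedLists : Primrec₂ (boundedLists (γ := α)) :=
  Primrec.nat_rec (.const [[]]) (Primrec.list_cons.comp (.const [])
    (Primrec.list_flatMap .fst (Primrec.list_map (.comp .snd (.comp .snd .fst))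
      (Primrec.list_cons.comp (.comp .snd .fst) .snd).to₂).to₂)).to₂

end

theorem primrec_names : Primrec names :=
  Primrec.list_append.comp
    (Primrec.list_flatMap .id
      (Primrec.list_map .snd (Primrec.sumInl.comp (.comp .fst .snd))))
    (Primrec.list_map (Primrec.list_range.comp Primrec.list_length) (Primrec.sumInr.comp .snd))

theorem primrec_entry : Primrec₂ fun (T : TreeCode) i => T.getD i (0, []) :=
  Primrec.list_getD _

theorem primrec_parent : Primrec₂ parent := Primrec.fst.comp primrec_entry

theorem primrec_bag : Primrec₂ bag := Primrec.snd.comp primrec_entry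

theorem primrec_maxBag : Primrec₂ maxBag := by
  refine (Primrec.nat_rec (f := fun _ : TreeCode => 0)
    (g := fun T p => max (bag T p.1).length p.2) (.const 0) ?_).of_eq fun T i => ?_
  · exact Primrec.nat_max.comp (Primrec.list_length.comp (primrec_bag.comp .fst (.comp .fst .snd)))
      (.comp .snd .snd)
  · induction i with
    | zero => rfl
    | succ i ih => rw [maxBag_succ, ← ih]

theorem validCode_iff {L : List (List Literal)} {T : TreeCode} : ValidCode L T ↔
    0 < T.length ∧ (∀ i < T.length, 0 < i → parent T i < i) ∧
    (∀ i < T.length, (bag T i).Nodup) ∧ (∀ i < T.length, ∀ v ∈ bag T i, v ∈ names L) ∧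
    (∀ v ∈ names L, ∃ i < T.length, v ∈ bag T i) ∧
    (∀ i < T.length, ∀ v ∈ bag T i, 0 < i → v ∉ bag T (parent T i) → ∀ j < i, v ∉ bag T j) ∧
    ∀ j < L.length, ∀ l ∈ L.getD j [], ∃ i < T.length, .inl l.1 ∈ bag T i ∧ .inr j ∈ bag T i :=
  ⟨fun ⟨h1, h2, h3, h4, h5, h6, h7⟩ => ⟨h1, h2, h3, h4, h5, h6, h7⟩,
    fun ⟨h1, h2, h3, h4, h5, h6, h7⟩ => ⟨h1, h2, h3, h4, h5, h6, h7⟩⟩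

theorem primrecPred_conn : PrimrecPred fun p : List (List Literal) × TreeCode =>
      ∀ i < p.2.length, ∀ v ∈ bag p.2 i, 0 < i → v ∉ bag p.2 (parent p.2 i) →
        ∀ j < i, v ∉ bag p.2 j := by
  have hT : Primrec fun p : List (List Literal) × TreeCode => p.2.length :=
    Primrec.list_length.comp .snd
  have hbag : Primrec fun p : (List (List Literal) × TreeCode) × ℕ => bag p.1.2 p.2 :=
    primrec_bag.comp (.comp .snd .fst) .snd
  have hpar : Primrec fun p : (List (List Literal) × TreeCode) × ℕ => parent p.1.2 p.2 :=
    primrec_parent.comp (.comp .snd .fst) .snd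
  refine primrecPred_forall_lt hT (primrecPred_forall_mem hbag (primrecPred_imp ?_
    (primrecPred_imp (primrecPred_mem .snd ?_).not (primrecPred_forall_lt ?_
      (primrecPred_mem (.comp .snd .fst) ?_).not))))
  · exact Primrec.nat_lt.comp (.const 0) (.comp .snd .fst)
  · exact hbag.comp (.pair (.comp .fst .fst) (hpar.comp .fst))
  · exact .comp .snd .fst
  · exact hbag.comp (.pair (.comp .fst (.comp .fst .fst)) .snd)

theorem primrecPred_edge : PrimrecPred fun p : List (List Literal) × TreeCode => ∀ j < p.1.length,
    ∀ l ∈ p.1.getD j [], ∃ i < p.2.length, .inl l.1 ∈ bag p.2 i ∧ .inr j ∈ bag p.2 i := by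
  have hbag : Primrec fun q : (((List (List Literal) × TreeCode) × ℕ) × Literal) × ℕ =>
      bag q.1.1.1.2 q.2 :=
    primrec_bag.comp (.comp .snd (.comp .fst (.comp .fst .fst))) .snd
  have hx : Primrec fun q : (((List (List Literal) × TreeCode) × ℕ) × Literal) × ℕ =>
      (.inl q.1.2.1 : ℕ ⊕ ℕ) := Primrec.sumInl.comp (.comp .fst (.comp .snd .fst))
  have hj : Primrec fun q : (((List (List Literal) × TreeCode) × ℕ) × Literal) × ℕ =>
      (.inr q.1.1.2 : ℕ ⊕ ℕ) := Primrec.sumInr.comp (.comp .snd (.comp .fst .fst))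
  have hex : PrimrecPred fun q : ((List (List Literal) × TreeCode) × ℕ) × Literal =>
      ∃ i < q.1.1.2.length, .inl q.2.1 ∈ bag q.1.1.2 i ∧ .inr q.1.2 ∈ bag q.1.1.2 i :=
    primrecPred_exists_lt (Primrec.list_length.comp (.comp .snd (.comp .fst .fst)))
      (PrimrecPred.and (primrecPred_mem hx hbag) (primrecPred_mem hj hbag))
  have hl : Primrec fun q : (List (List Literal) × TreeCode) × ℕ => q.1.1.getD q.2 [] :=
    (Primrec.list_getD []).comp (.comp .fst .fst) .snd
  exact primrecPred_forall_lt (Primrec.list_length.comp .fst) (primrecPred_forall_mem hl hex)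

theorem primrecRel_validCode : PrimrecRel ValidCode := by
  have hT : Primrec fun p : List (List Literal) × TreeCode => p.2.length :=
    Primrec.list_length.comp .snd
  have hbag : Primrec fun p : (List (List Literal) × TreeCode) × ℕ => bag p.1.2 p.2 :=
    primrec_bag.comp (.comp .snd .fst) .snd
  have hpar : Primrec fun p : (List (List Literal) × TreeCode) × ℕ => parent p.1.2 p.2 :=
    primrec_parent.comp (.comp .snd .fst) .snd
  have h1 : PrimrecPred fun p : List (List Literal) × TreeCode => 0 < p.2.length :=
    Primrec.nat_lt.comp (.const 0) hT
  have h2 : PrimrecPred fun p : List (List Literal) × TreeCode =>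
      ∀ i < p.2.length, 0 < i → parent p.2 i < i :=
    primrecPred_forall_lt hT (primrecPred_imp (Primrec.nat_lt.comp (.const 0) .snd)
      (Primrec.nat_lt.comp hpar .snd))
  have h3 : PrimrecPred fun p : List (List Literal) × TreeCode =>
      ∀ i < p.2.length, (bag p.2 i).Nodup :=
    primrecPred_forall_lt hT (primrecPred_nodup hbag)
  have h4 : PrimrecPred fun p : List (List Literal) × TreeCode =>
      ∀ i < p.2.length, ∀ v ∈ bag p.2 i, v ∈ names p.1 :=
    primrecPred_forall_lt hT (primrecPred_forall_mem hbag
      (primrecPred_mem .snd (primrec_names.comp (.comp .fst (.comp .fst .fst)))))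
  have h5 : PrimrecPred fun p : List (List Literal) × TreeCode =>
      ∀ v ∈ names p.1, ∃ i < p.2.length, v ∈ bag p.2 i :=
    primrecPred_forall_mem (primrec_names.comp .fst) (primrecPred_exists_lt (hT.comp .fst)
      (primrecPred_mem (.comp .snd .fst) (hbag.comp (.pair (.comp .fst .fst) .snd))))
  exact (h1.and (h2.and (h3.and (h4.and (h5.and (primrecPred_conn.and primrecPred_edge)))))).of_eq
    fun p => validCode_iff.symm

/-- Finitely many tree codes, among them optimal ones. -/
def codes (L : List (List Literal)) : List TreeCode :=
  boundedLists ((List.range ((names L).length + 2)).flatMap fun i =>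
    (boundedLists (names L) (names L).length).map fun b => (i, b)) ((names L).length + 1)

theorem primrec_codes : Primrec codes := by
  have hn : Primrec fun L => (names L).length := Primrec.list_length.comp primrec_names
  refine primrec_boundedLists.comp (Primrec.list_flatMap (Primrec.list_range.comp
    (Primrec.nat_add.comp hn (.const 2))) (Primrec.list_map (primrec_boundedLists.comp
      (primrec_names.comp .fst) (hn.comp .fst)) (Primrec.pair (.comp .snd .fst) .snd).to₂).to₂)
    (Primrec.nat_add.comp hn (.const 1))

theorem ValidCode.mem_codes {L : List (List Literal)} {T : TreeCode} (hT : ValidCode L T)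
    (hlen : T.length ≤ (names L).length + 1) (hp : ∀ i < T.length, parent T i ≤ T.length) :
    T ∈ codes L := by
  refine mem_boundedLists.mpr ⟨hlen, fun p hpT => ?_⟩
  obtain ⟨i, hi, rfl⟩ := List.getElem_of_mem hpT
  have hb := bag_of_lt hi
  have hpi : parent T i = T[i].1 := by simp [parent, List.getD_eq_getElem?_getD, hi]
  have hsub := hT.mem_names i hi
  have hnd := hT.nodup i hi
  have hple := hp i hi
  rw [hb] at hsub hnd
  rw [hpi] at hple
  refine List.mem_flatMap.mpr ⟨T[i].1, List.mem_range.mpr (by omega), List.mem_map.mpr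
    ⟨T[i].2, mem_boundedLists.mpr ⟨(hnd.subperm hsub).length_le, hsub⟩, rfl⟩⟩

/-- `T` is a valid code, and no code in `codes L` that is valid has smaller bags. -/
def IsOptimal (T : TreeCode) (L : List (List Literal)) : Prop :=
  ValidCode L T ∧ ∀ U ∈ codes L, ValidCode L U → maxBag T T.length ≤ maxBag U U.length

theorem primrecRel_isOptimal : PrimrecRel IsOptimal := by
  have hm : Primrec fun T : TreeCode => maxBag T T.length :=
    primrec_maxBag.comp .id Primrec.list_length
  refine PrimrecPred.and (primrecRel_validCode.comp .snd .fst) (primrecPred_forall_mem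
    (primrec_codes.comp .snd) (primrecPred_imp (primrecRel_validCode.comp (.comp .snd .fst) .snd)
      (Primrec.nat_le.comp (hm.comp (.comp .fst .fst)) (hm.comp .snd))))

open Classical in
/-- The first optimal tree code. -/
noncomputable def decompose (L : List (List Literal)) : TreeCode :=
  (((codes L).filter fun T => decide (IsOptimal T L)).head?).getD []

open Classical in
theorem computable_decompose : Computable decompose :=
  ((Primrec.option_getD.comp (Primrec.list_head?.comp
    ((PrimrecRel.listFilter primrecRel_isOptimal).comp primrec_codes .id)) (.const []))).to_comp

theorem isOptimal_decompose {L : List (List Literal)} (h : ∃ T ∈ codes L, ValidCode L T) :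
    IsOptimal (decompose L) L ∧ decompose L ∈ codes L := by
  classical
  obtain ⟨T, hT, hmin⟩ := Finset.exists_min_image
    ((codes L).toFinset.filter fun T => ValidCode L T) (fun T => maxBag T T.length) (by
      obtain ⟨T, hT, hT'⟩ := h
      exact ⟨T, Finset.mem_filter.mpr ⟨List.mem_toFinset.mpr hT, hT'⟩⟩)
  rw [Finset.mem_filter, List.mem_toFinset] at hT
  have hne : (codes L).filter (fun T => decide (IsOptimal T L)) ≠ [] := by
    refine List.ne_nil_of_mem (a := T) (List.mem_filter.mpr ⟨hT.1, decide_eq_true ⟨hT.2, ?_⟩⟩)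
    exact fun U hU hU' => hmin U (Finset.mem_filter.mpr ⟨List.mem_toFinset.mpr hU, hU'⟩)
  have hmem : decompose L ∈ (codes L).filter (fun T => decide (IsOptimal T L)) := by
    rw [decompose, List.head?_eq_some_head (by convert hne), Option.getD_some]
    convert List.head_mem hne
  rw [List.mem_filter] at hmem
  exact ⟨of_decide_eq_true hmem.2, hmem.1⟩

theorem validCode_singleton (L : List (List Literal)) : ValidCode L [(0, (names L).dedup)] := by
  have hbag : bag [(0, (names L).dedup)] 0 = (names L).dedup := rfl
  have h0 : ∀ {i}, i < [((0 : ℕ), (names L).dedup)].length → i = 0 := fun h => by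
    simpa using h
  refine ⟨Nat.one_pos, ?_, ?_, ?_, ?_, ?_, ?_⟩
  · rintro i hi h
    exact absurd (h0 hi) h.ne'
  · rintro i hi
    rw [h0 hi, hbag]
    exact List.nodup_dedup _
  · rintro i hi v hv
    rw [h0 hi, hbag] at hv
    exact List.mem_dedup.mp hv
  · exact fun v hv => ⟨0, Nat.one_pos, hbag ▸ List.mem_dedup.mpr hv⟩
  · rintro i hi v - h
    exact absurd (h0 hi) h.ne'
  · intro j hj l hl
    exact ⟨0, Nat.one_pos, hbag ▸ List.mem_dedup.mpr (mem_names.mpr (.inl ⟨j, hj, l, hl, rfl⟩)),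
      hbag ▸ List.mem_dedup.mpr (mem_names.mpr (.inr ⟨j, hj, rfl⟩))⟩

theorem decompose_spec {φ : CNF} {L : List (List Literal)} (hL : IsListing L φ) :
    ∃ D : TreeDecomposition (incidenceGraph φ) (Fin (decompose L).length),
      Describes L (decompose L) D ∧ D.width = itw φ ∧
        (decompose L).length ≤ (names L).length + 1 := by
  have hmem : [(0, (names L).dedup)] ∈ codes L :=
    (validCode_singleton L).mem_codes (Nat.le_add_left _ _) fun i hi => by
      obtain rfl : i = 0 := by simpa using hi
      exact Nat.zero_le _
  obtain ⟨hopt, hcodes⟩ := isOptimal_decompose ⟨_, hmem, validCode_singleton L⟩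
  obtain ⟨D, hD⟩ := hopt.1.exists_describes hL
  refine ⟨D, hD, le_antisymm (le_csInf ⟨_, _, D, rfl⟩ ?_) (Nat.sInf_le ⟨_, D, rfl⟩),
    (mem_boundedLists.mp hcodes).1⟩
  rintro w ⟨N, D', rfl⟩
  obtain ⟨T, hT, hm, hlen, hp⟩ := D'.exists_validCode hL
  rw [TreeDecomposition.width, hD.sup_card hL]
  exact Nat.sub_le_sub_right ((hopt.2 T (hT.mem_codes hlen hp) hT).trans hm) 1

end SharpSat
namespace SharpSat

theorem IsListing.formulaSize_eq {L : List (List Literal)} {φ : CNF} (hL : IsListing L φ) :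
    formulaSize φ = (names L).length + 1 := by
  have h : ∑ c ∈ φ, (1 + c.card) = (L.map fun c => 1 + c.length).sum := by
    rw [← hL.2.2, List.sum_toFinset _ hL.2.1, List.map_map]
    refine congrArg _ (List.map_congr_left fun c hc => ?_)
    rw [Function.comp_apply, List.toFinset_card_of_nodup (hL.1 c hc)]
  rw [formulaSize, h, length_names, sum_getD L [] fun c => 1 + c.length, add_comm]

theorem Describes.computesWithin {L : List (List Literal)} {φ : CNF} {T : TreeCode}
    {D : TreeDecomposition (incidenceGraph φ) (Fin T.length)} (hL : IsListing L φ)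
    (h : Describes L T D) : ComputesWithin RamProg.countModels (encodeFormula L ++ encodeTree T)
      (modelCount φ : ℤ) (400 * 2 ^ D.width * (formulaSize φ + T.length)) := by
  obtain ⟨t, τ, hexec, ht, hres⟩ := computesWithin_countModels (h.validCode hL)
  refine ⟨t, τ, hexec, ht.trans ?_, hres.trans (modelCount_eq_signedCount hL).symm⟩
  rw [hL.formulaSize_eq]
  refine Nat.mul_le_mul_right _ ?_
  rw [show 400 = 200 * 2 from rfl, mul_assoc, ← pow_succ', TreeDecomposition.width, h.sup_card hL]
  exact Nat.mul_le_mul_left _ (Nat.pow_le_pow_right two_pos (by omega))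

end SharpSat

open SharpSat

theorem mainTheorem9 :
    ∃ (p : RamProg) (C : ℕ),
      -- the algorithm on a formula with an arbitrary tree decomposition of its incidence graph
      (∀ (φ : CNF) (L : List (List Literal)), IsListing L φ →
        ∀ (T : TreeCode) (D : TreeDecomposition (incidenceGraph φ) (Fin T.length)),
          Describes L T D →
          ComputesWithin p (encodeFormula L ++ encodeTree T) (modelCount φ : ℤ)
            (C * 2 ^ D.width * (formulaSize φ + T.length))) ∧
      -- the algorithm on a formula alone
      ∃ decompose : List (List Literal) → TreeCode, Computable decompose ∧
        ∀ (φ : CNF) (L : List (List Literal)), IsListing L φ →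
          (∃ D : TreeDecomposition (incidenceGraph φ) (Fin (decompose L).length),
            Describes L (decompose L) D ∧ D.width = itw φ ∧
              (decompose L).length ≤ formulaSize φ) ∧
          ComputesWithin p (encodeFormula L ++ encodeTree (decompose L)) (modelCount φ : ℤ)
            (C * 2 ^ itw φ * formulaSize φ) := by
  refine ⟨RamProg.countModels, 800, fun φ L hL T D h => ?_, decompose, computable_decompose,
    fun φ L hL => ?_⟩
  · obtain ⟨t, τ, hexec, ht, hres⟩ := h.computesWithin hL
    refine ⟨t, τ, hexec, ht.trans ?_, hres⟩
    gcongr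
    norm_num
  · obtain ⟨D, hD, hw, hlen⟩ := decompose_spec hL
    rw [← hL.formulaSize_eq] at hlen
    refine ⟨⟨D, hD, hw, hlen⟩, ?_⟩
    obtain ⟨t, τ, hexec, ht, hres⟩ := hD.computesWithin hL
    refine ⟨t, τ, hexec, ht.trans ?_, hres⟩
    rw [hw]
    calc 400 * 2 ^ itw φ * (formulaSize φ + (SharpSat.decompose L).length)
        ≤ 400 * 2 ^ itw φ * (formulaSize φ + formulaSize φ) := by gcongr
      _ = 800 * 2 ^ itw φ * formulaSize φ := by ring
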